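/- All languages are over $\{0,1\}$ and classes are sets of languages. Machines are multi-tape Turing machines with a read-only input tape, a write-only output tape and finitely many work tapes. $\mathrm{DLIN}$ is the class of languages decided by deterministic machines in time $O(n)$, and $\mathrm{NP}=\bigcup_k \mathrm{NTIME}[O(n^k)]$. For strings $x_1,\dots,x_m$, $\langle x_1,\dots,x_m\rangle$ is the string obtained by replacing $0$ by $00$ and $1$ by $10$ in each $x_i$ and putting $01$ between consecutive ones; numbers are written in binary. For a class $\mathcal C$ let $\mathrm E\,\mathcal C$ be the class of the languages $\{x \mid \exists y\in\{0,1\}^{m|x|}\ \langle x,y\rangle\in L'\}$, and $\mathrm u\,\mathcal C$ the class of the languages $\{x \mid \forall y\in\{0,1\}^{\lceil\log_2 (m|x|)\rceil}\ \langle x,y\rangle\in L'\}$ (with the logarithm of $0$ read as $0$), where $L'\in\mathcal C$ and $m\ge 1$ is an integer constant. Let $(\mathrm{Eu})^{\mathrm{lin}}_k=(\mathrm{E}\,\mathrm{u})^k\,\mathrm{DLIN}$ and $\mathrm{Eu}\text{-}\mathrm{LinH}=\bigcup_{k\ge 0}(\mathrm{Eu})^{\mathrm{lin}}_k$. For a class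 $\mathcal C$ let $\xi\,\mathcal C$ be the class of the languages $$\{x \mid \exists w\in\{0,1\}^{n^{d_1}}\ \forall i<n^{d_2}\ \ \langle x,i,(w)_{f_1(n,i)},(w)_{f_2(n,i)}\rangle\in L'\},\qquad n=\max(1,|x|),$$ where $L'\in\mathcal C$, $d_1\ge d_2\ge 0$ are integer constants, $(w)_i$ is the $i$th block (counting from $0$) of $w$ when $w$ is split into $n^{d_2}$ blocks of size $n^{d_1-d_2}$, and $f_1(n,\cdot),f_2(n,\cdot)$ map $\{0,\dots,n^{d_2}-1\}$ to itself and are computable in deterministic polynomial time from $n$ in unary and $i$ in binary. Let $(\xi)^{\mathrm{lin}}_k=\xi^k\,\mathrm{DLIN}$ and $\xi\text{-}\mathrm{LinH}=\bigcup_{k\ge 0}(\xi)^{\mathrm{lin}}_k$. Theorem. 1. For every class $\mathcal C$ that is closed under deterministic linear-time many-one reductions, $\xi\xi\,\mathcal C\subseteq\xi\,\mathcal C$. 2. For every $k\ge 1$, $(\xi)^{\mathrm{lin}}_k=(\xi)^{\mathrm{lin}}_1=\xi\,\mathrm{DLIN}$. Moreover $\xi\,\mathrm{DLIN}\subseteq\mathrm{NP}$,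 and $(\xi)^{\mathrm{lin}}_k\subseteq\mathrm{NP}$ for every $k\ge 0$. 3. For every $k\ge 0$, $(\mathrm{Eu})^{\mathrm{lin}}_k\subseteq(\xi)^{\mathrm{lin}}_k$; hence $\mathrm{Eu}\text{-}\mathrm{LinH}\subseteq\xi\text{-}\mathrm{LinH}$. -/

import Mathlib

namespace XiHier

/-! ## Multi-tape Turing machines -/

/-- What a machine does in one step: the next state, the move of the head on the input tape,
the symbols written on the work tapes, the moves of the work heads (`none` is "stay"), and
possibly one bit appended to the output tape. -/
structure MoveData (State Symbol : Type) (tapes : ℕ) where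
  next : State
  inMove : Option Turing.Dir
  write : Fin tapes → Symbol
  move : Fin tapes → Option Turing.Dir
  out : Option Bool

/-- A (possibly nondeterministic) Turing machine with a read-only input tape, finitely many work
tapes over a finite alphabet (`default` is the blank) and a write-only output tape. The input
alphabet is binary; the input head reads `none` outside the input. `trans` gives the set of
actions that are allowed in a given situation; the machine halts where there is none. -/
structure Machine where
  tapes : ℕ
  State : Type
  Symbol : Type
  [finState : Finite State]
  [finSymbol : Finite Symbol]
  [inhSymbol : Inhabited Symbol]
  start : State
  accepting : Set State
  trans : State → Option Bool → (Fin tapes → Symbol) → Set (MoveData State Symbol tapes)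

attribute [instance] Machine.finState Machine.finSymbol Machine.inhSymbol

/-- The machine is deterministic: there is never more than one possible action. -/
def Machine.Deterministic (M : Machine) : Prop :=
  ∀ q a g, (M.trans q a g).Subsingleton

/-- Configurations of a machine. -/
structure Machine.Cfg (M : Machine) where
  state : M.State
  input : Turing.Tape (Option Bool)
  work : Fin M.tapes → Turing.Tape M.Symbol
  output : List Bool

/-- The initial configuration on input `x`: the head scans the first symbol of `x`, the work
tapes are blank, the output is empty. -/
def Machine.init (M : Machine) (x : List Bool) : M.Cfg where
  state := M.start
  input := Turing.Tape.mk₁ (x.map some)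
  work := fun _ => Turing.Tape.mk₁ []
  output := []

/-- Move the head on a tape, or leave it in place. -/
def moveHead {Γ : Type} [Inhabited Γ] : Option Turing.Dir → Turing.Tape Γ → Turing.Tape Γ
  | none, T => T
  | some d, T => T.move d

/-- The set of actions that are possible in a configuration. -/
def Machine.actions (M : Machine) (c : M.Cfg) : Set (MoveData M.State M.Symbol M.tapes) :=
  M.trans c.state c.input.head (fun i => (c.work i).head)

/-- The configuration that results from an action. -/
def Machine.act (M : Machine) (c : M.Cfg) (a : MoveData M.State M.Symbol M.tapes) : M.Cfg where
  state := a.next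
  input := moveHead a.inMove c.input
  work := fun i => moveHead (a.move i) ((c.work i).write (a.write i))
  output := c.output ++ a.out.toList

/-- One step of the machine. -/
def Machine.Step (M : Machine) (c c' : M.Cfg) : Prop :=
  ∃ a ∈ M.actions c, c' = M.act c a

/-- The machine can get from `c` to `c'` in exactly `n` steps. -/
def Machine.Reaches (M : Machine) : ℕ → M.Cfg → M.Cfg → Prop
  | 0, c, c' => c = c'
  | n + 1, c, c' => ∃ d, M.Step c d ∧ M.Reaches n d c'

/-- No further step is possible. -/
def Machine.Halted (M : Machine) (c : M.Cfg) : Prop :=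
  M.actions c = ∅

/-- Every computation of `M` on input `x` consists of at most `t` steps. -/
def Machine.RunsIn (M : Machine) (x : List Bool) (t : ℕ) : Prop :=
  ∀ n c, M.Reaches n (M.init x) c → n ≤ t

/-- Some computation of `M` on input `x` halts in an accepting state. -/
def Machine.Accepts (M : Machine) (x : List Bool) : Prop :=
  ∃ n c, M.Reaches n (M.init x) c ∧ M.Halted c ∧ c.state ∈ M.accepting

/-- Some computation of `M` on input `x` halts with output `y` (for a deterministic machine there
is at most one halting computation). -/
def Machine.Outputs (M : Machine) (x y : List Bool) : Prop :=
  ∃ n c, M.Reaches n (M.init x) c ∧ M.Halted c ∧ c.output = y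

/-! ## Time classes -/

/-- `DTIME[t]`, running times being taken up to constant factors. -/
def DTIME (t : ℕ → ℕ) : Set (Language Bool) :=
  {L | ∃ (M : Machine) (c : ℕ), M.Deterministic ∧
    ∀ x : List Bool, M.RunsIn x (c * t x.length + c) ∧ (x ∈ L ↔ M.Accepts x)}

/-- `NTIME[t]`, running times being taken up to constant factors. -/
def NTIME (t : ℕ → ℕ) : Set (Language Bool) :=
  {L | ∃ (M : Machine) (c : ℕ),
    ∀ x : List Bool, M.RunsIn x (c * t x.length + c) ∧ (x ∈ L ↔ M.Accepts x)}

/-- Deterministic linear time. -/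
def DLIN : Set (Language Bool) := DTIME fun n => n

/-- Nondeterministic polynomial time. -/
def NP : Set (Language Bool) := ⋃ k : ℕ, NTIME fun n => n ^ k

/-- String functions that are computable in deterministic linear time. -/
def LinTimeComputable (r : List Bool → List Bool) : Prop :=
  ∃ (M : Machine) (c : ℕ), M.Deterministic ∧
    ∀ x : List Bool, M.RunsIn x (c * x.length + c) ∧ M.Outputs x (r x)

/-- The class is closed under deterministic linear-time many-one reductions. -/
def ClosedUnderLinTimeReductions (C : Set (Language Bool)) : Prop :=
  ∀ (r : List Bool → List Bool) (L L' : Language Bool), LinTimeComputable r → L' ∈ C →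
    (∀ x, x ∈ L ↔ r x ∈ L') → L ∈ C

/-! ## Coding of sequences -/

/-- Replace every `0` by `00` and every `1` by `10`. -/
def doubleBits (x : List Bool) : List Bool := x.flatMap fun b => [b, false]

/-- The sequence `⟨x₁, …, xₙ⟩`: the strings `doubleBits xᵢ` separated by `01`. -/
def tuple (xs : List (List Bool)) : List Bool :=
  [false, true].intercalate (xs.map doubleBits)

/-- A number as a string: its binary digits (`Nat.bits`: least significant digit first). -/
def numeral (i : ℕ) : List Bool := Nat.bits i

/-- Functions `(n, i) ↦ f n i` that are computable in deterministic polynomial time from `n` in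
unary and `i` in binary. -/
def PolyTimeIndex (f : ℕ → ℕ → ℕ) : Prop :=
  ∃ (M : Machine) (c k : ℕ), M.Deterministic ∧ ∀ n i : ℕ,
    M.RunsIn (tuple [List.replicate n true, numeral i])
      (c * (tuple [List.replicate n true, numeral i]).length ^ k + c) ∧
    M.Outputs (tuple [List.replicate n true, numeral i]) (numeral (f n i))

/-! ## Quantifiers -/

/-- The quantifier `E` with linear bounds: `∃ y ∈ {0,1}^{m|x|}`. -/
def QE (C : Set (Language Bool)) : Set (Language Bool) :=
  {L | ∃ (m : ℕ) (L' : Language Bool), 0 < m ∧ L' ∈ C ∧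
    ∀ x : List Bool, x ∈ L ↔
      ∃ y : List Bool, y.length = m * x.length ∧ tuple [x, y] ∈ L'}

/-- The quantifier `u` with linear bounds: `∀ y ∈ {0,1}^{log (m|x|)}`, where `log` is the binary
logarithm, rounded up. -/
def Qu (C : Set (Language Bool)) : Set (Language Bool) :=
  {L | ∃ (m : ℕ) (L' : Language Bool), 0 < m ∧ L' ∈ C ∧
    ∀ x : List Bool, x ∈ L ↔
      ∀ y : List Bool, y.length = Nat.clog 2 (m * x.length) → tuple [x, y] ∈ L'}

/-- The `i`-th block (counted from `0`) of `w` when `w` is split into blocks of size `s`. -/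
def block (s : ℕ) (w : List Bool) (i : ℕ) : List Bool := (w.drop (i * s)).take s

/-- The length of `x`, the empty string being treated as if it had length one. -/
def size (x : List Bool) : ℕ := max 1 x.length

/-- The quantifier `ξ`: with `n = |x|`, a string `w ∈ {0,1}^{n^d₁}` is guessed and split into
`n^d₂` blocks of size `n^(d₁-d₂)`; for each index `i < n^d₂` the blocks number `f₁(i)` and `f₂(i)`
are looked at. The selection functions depend only on `n`. -/
def Xi (C : Set (Language Bool)) : Set (Language Bool) :=
  {L | ∃ (d₁ d₂ : ℕ) (f₁ f₂ : ℕ → ℕ → ℕ) (L' : Language Bool),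
    d₂ ≤ d₁ ∧ L' ∈ C ∧ PolyTimeIndex f₁ ∧ PolyTimeIndex f₂ ∧
    (∀ n i, i < n ^ d₂ → f₁ n i < n ^ d₂ ∧ f₂ n i < n ^ d₂) ∧
    ∀ x : List Bool, x ∈ L ↔
      ∃ w : List Bool, w.length = size x ^ d₁ ∧
        ∀ i < size x ^ d₂,
          tuple [x, numeral i,
            block (size x ^ (d₁ - d₂)) w (f₁ (size x) i),
            block (size x ^ (d₁ - d₂)) w (f₂ (size x) i)] ∈ L'}

/-- `(Eu)^lin_k`. -/
def EuLin (k : ℕ) : Set (Language Bool) := (fun C => QE (Qu C))^[k] DLIN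

/-- `(ξ)^lin_k`. -/
def XiLin (k : ℕ) : Set (Language Bool) := Xi^[k] DLIN

/-- `Eu-LinH`. -/
def EuLinH : Set (Language Bool) := ⋃ k, EuLin k

/-- `ξ-LinH`. -/
def XiLinH : Set (Language Bool) := ⋃ k, XiLin k

end XiHier

set_option linter.unusedSectionVars false

namespace XiHier

open Function

/-! The core is that one `Xi` can verify more than two pieces of a guess at a time. Suppose that `x
∈ L` means: there is a function `W` on strings such that, for every index `l` in a polynomial range,
a test holds of `x`, `l` and four values of `W`, taken at places that are computed in polynomial
time from `|x|` and `l`. Give each `l` a block of its own that contains `W l` and copies of the four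
values needed at `l`. Four checks compare the copies with the blocks that they were copied from,
each involving two blocks; a further check runs the test on the copies alone. So two blocks per
check suffice (`mem_Xi_of_queries`).

One obstacle is that the validity of an index is decidable in polynomial time only, while the
language under the quantifier must stay within linear-time reach of the class. The selection
functions may take polynomial time, so they decide validity and report it through the block that
they choose: a valid test looks at block 1, which a separate check forces to carry a flag; an
invalid index looks at block 0, which an honest prover leaves empty.

Nested quantifiers are merged by Skolemization (`mem_Xi_of_queries_Xi`). If every outer index `i`
has its own inner guess, all of these and the outer guess together form one function `W`. A check
for outer index `i` and inner index `j` reads two outer and two inner blocks, which makes four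
values. The number of inner blocks must depend only on `|x|` and `i`, which holds because all
lengths are prescribed.

With a `Xi` outside, this gives `Xi (Xi C) ⊆ Xi C` (`Xi_Xi_subset`); with `QE` and `Qu` outside,
where the guessed string is a single value of `W` and the logarithmically long string is the index,
it gives `QE (Qu (Xi DLIN)) ⊆ Xi DLIN` (an instance of `QE_Qu_Xi_subset`). As `DLIN ⊆ Xi DLIN`, all
levels from the first on coincide, and the inclusion of the hierarchies follows by induction.
Finally `Xi DLIN ⊆ NP`: guess `w` and try all indices (`Xi_DLIN_subset_NP`).

All concrete algorithms are written as programs on stacks of bits. Programs compile to machines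
(`compile_spec`), and deterministic machines are simulated by programs with two stacks per tape
(`exists_runs_sim`), both with constant-factor overhead. Hence linear and polynomial time may be
handled through programs, uniformly in a class of bounds (`Growth`). -/

/-! ## Programs on stacks -/

/-- Programs that work on a family of stacks of bits. `cases r p q` pops the top of the stack `r`
and branches on it; `loop r p` repeats `p` while the stack `r` is not empty. -/
inductive Prog (ι : Type) : Type
  | skip : Prog ι
  | push : ι → Bool → Prog ι
  | guess : ι → Prog ι
  | seq : Prog ι → Prog ι → Prog ι
  | cases : ι → Prog ι → (Bool → Prog ι) → Prog ι
  | loop : ι → Prog ι → Prog ι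

/-- The contents of the stacks, the top coming first. -/
abbrev Store (ι : Type) := ι → List Bool

namespace Prog

/-- The program makes no guesses. -/
def Det {ι : Type} : Prog ι → Prop
  | skip => True
  | push _ _ => True
  | guess _ => False
  | seq p q => p.Det ∧ q.Det
  | cases _ p q => p.Det ∧ ∀ b, (q b).Det
  | loop _ p => p.Det

/-- Renaming of the stacks. -/
def map {ι κ : Type} (σ : ι → κ) : Prog ι → Prog κ
  | skip => skip
  | push r b => push (σ r) b
  | guess r => guess (σ r)
  | seq p q => seq (p.map σ) (q.map σ)
  | cases r p q => cases (σ r) (p.map σ) (fun b => (q b).map σ)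
  | loop r p => loop (σ r) (p.map σ)

theorem Det.map {ι κ : Type} (σ : ι → κ) {p : Prog ι} (h : p.Det) : (p.map σ).Det := by
  induction p with
  | skip => trivial
  | push _ _ => trivial
  | guess _ => exact h
  | seq p q hp hq => exact ⟨hp h.1, hq h.2⟩
  | cases r p q hp hq => exact ⟨hp h.1, fun b => hq b (h.2 b)⟩
  | loop r p hp => exact hp h

end Prog

/-- `Runs p s t s'`: the guess-free program `p`, started with `s`, ends with `s'` after at most
`t` steps. -/
inductive Runs {ι : Type} [DecidableEq ι] : Prog ι → Store ι → ℕ → Store ι → Prop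
  | skip {s t} : 1 ≤ t → Runs .skip s t s
  -- The cost is 2 because the compiled machine first moves to the free cell and then writes.
  | push {r b s t} : 2 ≤ t → Runs (.push r b) s t (Function.update s r (b :: s r))
  | seq {p q s s' s'' t₁ t₂ t} : Runs p s t₁ s' → Runs q s' t₂ s'' → t₁ + t₂ + 1 ≤ t →
      Runs (.seq p q) s t s''
  | cases_nil {r p q s s' t₁ t} : s r = [] → Runs p s t₁ s' → t₁ + 1 ≤ t →
      Runs (.cases r p q) s t s'
  | cases_cons {r p q s s' b l t₁ t} : s r = b :: l → Runs (q b) (Function.update s r l) t₁ s' →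
      t₁ + 1 ≤ t → Runs (.cases r p q) s t s'
  | loop_nil {r p s t} : s r = [] → 1 ≤ t → Runs (.loop r p) s t s
  | loop_cons {r p s s' s'' t₁ t₂ t} : s r ≠ [] → Runs p s t₁ s' → Runs (.loop r p) s' t₂ s'' →
      t₁ + t₂ + 1 ≤ t → Runs (.loop r p) s t s''

namespace Runs

variable {ι κ : Type} [DecidableEq ι] [DecidableEq κ]

theorem mono {p : Prog ι} {s s' : Store ι} {t t' : ℕ} (h : Runs p s t s') (ht : t ≤ t') :
    Runs p s t' s' := by
  cases h with
  | skip h => exact skip (h.trans ht)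
  | push h => exact push (h.trans ht)
  | seq h₁ h₂ h => exact seq h₁ h₂ (h.trans ht)
  | cases_nil h₁ h₂ h => exact cases_nil h₁ h₂ (h.trans ht)
  | cases_cons h₁ h₂ h => exact cases_cons h₁ h₂ (h.trans ht)
  | loop_nil h₁ h => exact loop_nil h₁ (h.trans ht)
  | loop_cons h₁ h₂ h₃ h => exact loop_cons h₁ h₂ h₃ (h.trans ht)

/-- Only `push` lengthens a stack, by one bit. Thus running times bound the lengths of results,
which is what makes composition and cleaning up affordable. -/
theorem length_le {p : Prog ι} {s s' : Store ι} {t : ℕ} (h : Runs p s t s') (r : ι) :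
    (s' r).length ≤ (s r).length + t := by
  induction h with
  | skip h => omega
  | @push r' b s t h =>
    by_cases hr : r = r'
    · subst hr; simp; omega
    · simp [hr]
  | seq h₁ h₂ h ih₁ ih₂ => omega
  | cases_nil h₁ h₂ h ih => omega
  | @cases_cons r' p q s s' b l t₁ t h₁ h₂ h ih =>
    by_cases hr : r = r'
    · subst hr
      simp only [Function.update_self] at ih
      rw [h₁]; simp; omega
    · simp only [Function.update_of_ne hr] at ih
      omega
  | loop_nil h₁ h => omega
  | loop_cons h₁ h₂ h₃ h ih₁ ih₂ => omega

/-- Stacks outside the range of `σ` are never touched. This lets several programs work side by side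
on disjoint stacks of a larger store. -/
theorem map {σ : ι → κ} (hσ : Function.Injective σ) {p : Prog ι} {s s' : Store ι} {t : ℕ}
    (h : Runs p s t s') (S : Store κ) (hS : ∀ i, S (σ i) = s i) :
    Runs (p.map σ) S t (Function.extend σ s' S) := by
  have key : ∀ (s : Store ι) (S : Store κ), (∀ i, S (σ i) = s i) → Function.extend σ s S = S := by
    intro s S hS
    funext r
    by_cases hr : ∃ i, σ i = r
    · obtain ⟨i, rfl⟩ := hr
      rw [hσ.extend_apply, hS]
    · rw [Function.extend_apply' _ _ _ hr]
  have key2 : ∀ (s s' : Store ι) (S : Store κ),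
      Function.extend σ s' (Function.extend σ s S) = Function.extend σ s' S := by
    intro s s' S
    funext r
    by_cases hr : ∃ i, σ i = r
    · obtain ⟨i, rfl⟩ := hr
      rw [hσ.extend_apply, hσ.extend_apply]
    · simp only [Function.extend_apply' _ _ _ hr]
  have key3 : ∀ (s : Store ι) (S : Store κ) (r : ι) (l : List Bool), (∀ i, S (σ i) = s i) →
      Function.extend σ (Function.update s r l) S = Function.update S (σ r) l := by
    intro s S r l hS
    funext r'
    by_cases hr : ∃ i, σ i = r'
    · obtain ⟨i, rfl⟩ := hr
      rw [hσ.extend_apply]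
      by_cases hi : i = r
      · subst hi; simp
      · rw [Function.update_of_ne hi, Function.update_of_ne (hσ.ne hi), hS]
    · rw [Function.extend_apply' _ _ _ hr, Function.update_of_ne]
      rintro rfl
      exact hr ⟨r, rfl⟩
  induction h generalizing S with
  | skip h => rw [key _ _ hS]; exact skip h
  | @push r b s t h =>
    rw [key3 _ _ _ _ hS, ← hS]
    exact push h
  | @seq p q s s' s'' t₁ t₂ t h₁ h₂ h ih₁ ih₂ =>
    have := ih₂ (Function.extend σ s' S) (fun i => hσ.extend_apply _ _ _)
    rw [key2] at this
    exact seq (ih₁ S hS) this h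
  | cases_nil h₁ h₂ h ih => exact cases_nil (by rw [hS, h₁]) (ih S hS) h
  | @cases_cons r p q s s' b l t₁ t h₁ h₂ h ih =>
    refine cases_cons (by rw [hS, h₁]) ?_ h
    have := ih (Function.update S (σ r) l) (by
      intro i
      by_cases hi : i = r
      · subst hi; simp
      · rw [Function.update_of_ne hi, Function.update_of_ne (hσ.ne hi), hS])
    rw [← key3 s S r l hS, key2] at this
    rwa [← key3 s S r l hS]
  | loop_nil h₁ h => rw [key _ _ hS]; exact loop_nil (by rw [hS, h₁]) h
  | @loop_cons r p s s' s'' t₁ t₂ t h₁ h₂ h₃ h ih₁ ih₂ =>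
    have := ih₂ (Function.extend σ s' S) (fun i => hσ.extend_apply _ _ _)
    rw [key2] at this
    exact loop_cons (by rwa [hS]) (ih₁ S hS) this h

end Runs

/-- All stacks are empty except `i`, which contains `x`. -/
def single {ι : Type} [DecidableEq ι] (i : ι) (x : List Bool) : Store ι :=
  Function.update (fun _ => []) i x

/-! ## Computations of machines -/

namespace Machine

variable {M : Machine}

/-- Every computation that starts with `c` has at most `t` steps. -/
def Bounded (M : Machine) (c : M.Cfg) (t : ℕ) : Prop :=
  ∀ n c', M.Reaches n c c' → n ≤ t

/-- Some computation that starts with `c` halts in a configuration with the property `P`. -/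
def Ends (M : Machine) (P : M.Cfg → Prop) (c : M.Cfg) : Prop :=
  ∃ n c', M.Reaches n c c' ∧ M.Halted c' ∧ P c'

theorem Bounded.mono {c : M.Cfg} {t t' : ℕ} (h : M.Bounded c t) (ht : t ≤ t') : M.Bounded c t' :=
  fun n c' hn => (h n c' hn).trans ht

theorem bounded_of_forall {c : M.Cfg} {t : ℕ} (h : ∀ a ∈ M.actions c, M.Bounded (M.act c a) t) :
    M.Bounded c (t + 1) := by
  intro n c' hn
  cases n with
  | zero => omega
  | succ n =>
    obtain ⟨d, ⟨a, ha, rfl⟩, hd⟩ := hn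
    exact Nat.succ_le_succ (h a ha n c' hd)

theorem ends_iff {P : M.Cfg → Prop} {c : M.Cfg} (h : (M.actions c).Nonempty) :
    M.Ends P c ↔ ∃ a ∈ M.actions c, M.Ends P (M.act c a) := by
  constructor
  · rintro ⟨n, c', hn, hh, hP⟩
    cases n with
    | zero =>
      obtain rfl : c = c' := hn
      rw [Halted] at hh
      exact absurd h (by simp [hh])
    | succ n =>
      obtain ⟨d, ⟨a, ha, rfl⟩, hd⟩ := hn
      exact ⟨a, ha, n, c', hd, hh, hP⟩
  · rintro ⟨a, ha, n, c', hn, hh, hP⟩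
    exact ⟨n + 1, c', ⟨_, ⟨a, ha, rfl⟩, hn⟩, hh, hP⟩

theorem bounded_of_halted {c : M.Cfg} (h : M.Halted c) : M.Bounded c 0 := by
  intro n c' hn
  cases n with
  | zero => exact le_rfl
  | succ n =>
    obtain ⟨d, ⟨a, ha, rfl⟩, hd⟩ := hn
    rw [Halted] at h
    simp [h] at ha

theorem ends_of_halted {P : M.Cfg → Prop} {c : M.Cfg} (h : M.Halted c) : M.Ends P c ↔ P c := by
  constructor
  · rintro ⟨n, c', hn, hh, hP⟩
    have := bounded_of_halted h n c' hn
    obtain rfl : n = 0 := by omega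
    obtain rfl : c = c' := hn
    exact hP
  · intro hP
    exact ⟨0, c, rfl, h, hP⟩

/-- All computations from `c` pass through `d`, after at most `t` steps. -/
def Leads (M : Machine) (c d : M.Cfg) (t : ℕ) : Prop :=
  (∀ b, M.Bounded d b → M.Bounded c (b + t)) ∧ ∀ P, M.Ends P c ↔ M.Ends P d

theorem Leads.refl (c : M.Cfg) (t : ℕ) : M.Leads c c t :=
  ⟨fun _ hb => hb.mono (by omega), fun _ => Iff.rfl⟩

theorem Leads.trans {c d e : M.Cfg} {t t' : ℕ} (h : M.Leads c d t) (h' : M.Leads d e t') :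
    M.Leads c e (t + t') :=
  ⟨fun b hb => (h.1 _ (h'.1 _ hb)).mono (by omega), fun P => (h.2 P).trans (h'.2 P)⟩

theorem Leads.mono {c d : M.Cfg} {t t' : ℕ} (h : M.Leads c d t) (ht : t ≤ t') : M.Leads c d t' :=
  ⟨fun b hb => (h.1 _ hb).mono (by omega), h.2⟩

theorem Leads.of_actions {c : M.Cfg} {a} (h : M.actions c = {a}) : M.Leads c (M.act c a) 1 := by
  refine ⟨fun b hb => bounded_of_forall ?_, fun P => ?_⟩
  · intro a' ha'
    rw [h] at ha'
    obtain rfl := Set.mem_singleton_iff.1 ha'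
    exact hb
  · rw [ends_iff (by simp [h]), h]
    simp

end Machine

/-! ## Stacks as tapes -/

/-- The tape that represents a stack: the head scans the top. -/
def stackTape (l : List Bool) : Turing.Tape (Option Bool) :=
  ⟨l.head?, Turing.ListBlank.mk (l.tail.map some), Turing.ListBlank.mk []⟩

/-- The tape that represents a stack, with the head on the free cell next to the top. -/
def stackTapeRight (l : List Bool) : Turing.Tape (Option Bool) :=
  ⟨none, Turing.ListBlank.mk (l.map some), Turing.ListBlank.mk []⟩

/-- Blanks at the end of a half-tape are invisible, so a stack can be popped or approached from the
right without leaving a trace. -/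
theorem ListBlank.cons_default_nil {Γ : Type} [Inhabited Γ] :
    (Turing.ListBlank.mk ([] : List Γ)).cons default = Turing.ListBlank.mk [] := by
  refine Turing.ListBlank.ext fun i => ?_
  cases i <;> simp

theorem stackTape_move_right (l : List Bool) :
    (stackTape l).move .right = stackTapeRight l := by
  cases l with
  | nil =>
    change (⟨_, _, _⟩ : Turing.Tape (Option Bool)) = ⟨_, _, _⟩
    congr 1
    exact ListBlank.cons_default_nil
  | cons a l => rfl

theorem stackTapeRight_write (l : List Bool) (b : Bool) :
    (stackTapeRight l).write (some b) = stackTape (b :: l) := rfl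

theorem stackTape_pop (l : List Bool) (b : Bool) :
    ((stackTape (b :: l)).write none).move .left = stackTape l := by
  cases l with
  | nil =>
    change (⟨_, _, _⟩ : Turing.Tape (Option Bool)) = ⟨_, _, _⟩
    congr 1
    exact ListBlank.cons_default_nil
  | cons a l =>
    change (⟨_, _, _⟩ : Turing.Tape (Option Bool)) = ⟨_, _, _⟩
    congr 1
    exact ListBlank.cons_default_nil

/-! ## From programs to machines -/

namespace Prog

/-- The control stacks that occur while `p` is carried out with `K` waiting. -/
def conts {ι : Type} : Prog ι → List (Prog ι) → Set (List (Prog ι))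
  | skip, K => {skip :: K, K}
  | push r b, K => {push r b :: K, K}
  | guess r, K => {guess r :: K, K}
  | seq p q, K => {seq p q :: K, K} ∪ (p.conts (q :: K) ∪ q.conts K)
  | cases r p q, K => {cases r p q :: K, K} ∪ (p.conts K ∪ ⋃ b, (q b).conts K)
  | loop r p, K => {loop r p :: K, K} ∪ p.conts (loop r p :: K)

variable {ι : Type}

/-- A loop reappears only as a waiting item below its own body, so the recursion is structural.
Finiteness allows control stacks to be used as machine states. -/
theorem finite_conts (p : Prog ι) (K : List (Prog ι)) : (p.conts K).Finite := by
  induction p generalizing K with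
  | skip => exact (Set.toFinite {_, _})
  | push _ _ => exact (Set.toFinite {_, _})
  | guess _ => exact (Set.toFinite {_, _})
  | seq p q hp hq => exact (Set.toFinite _).union ((hp _).union (hq _))
  | cases r p q hp hq =>
    exact (Set.toFinite _).union ((hp _).union (Set.finite_iUnion fun b => hq b _))
  | loop r p hp => exact (Set.toFinite _).union (hp _)

theorem cons_mem_conts (p : Prog ι) (K : List (Prog ι)) : p :: K ∈ p.conts K := by
  cases p <;> simp [conts]

theorem mem_conts (p : Prog ι) (K : List (Prog ι)) : K ∈ p.conts K := by
  cases p <;> simp [conts]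

end Prog

/-- The states of the machine that carries out a program. -/
inductive Ctl (ι : Type) : Type
  | load : Ctl ι
  | loadPut : Bool → Ctl ι
  | run : List (Prog ι) → Ctl ι
  | put : ι → Bool → List (Prog ι) → Ctl ι
  | unload : Bool → Ctl ι

section Compile

variable {ι : Type} [DecidableEq ι] {k : ℕ} (e : ι ≃ Fin k)

/-- An action that concerns only one tape. -/
def oneTape (g : Fin k → Option Bool) (next : Ctl ι) (inMove : Option Turing.Dir) (r : ι)
    (a : Option Bool) (d : Option Turing.Dir) (out : Option Bool) :
    MoveData (Ctl ι) (Option Bool) k where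
  next := next
  inMove := inMove
  write := Function.update g (e r) a
  move := Function.update (fun _ => none) (e r) d
  out := out

/-- An action that changes only the state. -/
def idle (g : Fin k → Option Bool) (next : Ctl ι) : MoveData (Ctl ι) (Option Bool) k where
  next := next
  inMove := none
  write := g
  move := fun _ => none
  out := none

/-- The actions of the machine for the program `p`, which is given the reversed input on the
stack `i`, and leaves the output on the stack `o`. -/
def ctlTrans (p : Prog ι) (i o : ι) : Ctl ι → Option Bool → (Fin k → Option Bool) →
    Set (MoveData (Ctl ι) (Option Bool) k)
  | .load, some b, g =>
    {oneTape e g (.loadPut b) (some .right) i (g (e i)) (some .right) none}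
  | .load, none, g => {idle g (.run [p])}
  | .loadPut b, _, g => {oneTape e g .load none i (some b) none none}
  | .run [], _, g => {idle g (.unload false)}
  | .run (.skip :: K), _, g => {idle g (.run K)}
  | .run (.push r b :: K), _, g =>
    {oneTape e g (.put r b K) none r (g (e r)) (some .right) none}
  | .run (.guess r :: K), _, g =>
    {m | ∃ b, m = oneTape e g (.put r b K) none r (g (e r)) (some .right) none}
  | .run (.seq p q :: K), _, g => {idle g (.run (p :: q :: K))}
  | .run (.cases r p q :: K), _, g =>
    match g (e r) with
    | none => {idle g (.run (p :: K))}
    | some b => {oneTape e g (.run (q b :: K)) none r none (some .left) none}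
  | .run (.loop r p :: K), _, g =>
    match g (e r) with
    | none => {idle g (.run K)}
    | some _ => {idle g (.run (p :: .loop r p :: K))}
  | .put r b K, _, g => {oneTape e g (.run K) none r (some b) none none}
  | .unload _, _, g =>
    match g (e o) with
    | none => ∅
    | some b => {oneTape e g (.unload b) none o none (some .left) (some b)}

/-- The states that are needed for the program `p`. -/
def ctlStates (p : Prog ι) : Set (Ctl ι) :=
  {c | match c with
    | .load => True
    | .loadPut _ => True
    | .run K => K ∈ p.conts []
    | .put _ _ K => K ∈ p.conts []
    | .unload _ => True}

theorem finite_ctlStates {ι : Type} [Finite ι] (p : Prog ι) : (ctlStates p).Finite := by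
  have h : ctlStates p ⊆ {Ctl.load} ∪ Set.range Ctl.loadPut ∪ Ctl.run '' p.conts [] ∪
      Set.range Ctl.unload ∪
      (fun x : ι × Bool × List (Prog ι) => Ctl.put x.1 x.2.1 x.2.2) ''
        (Set.univ ×ˢ (Set.univ ×ˢ p.conts [])) := by
    rintro (_ | _ | K | ⟨r, b, K⟩ | _) h
    · simp
    · simp
    · left; left; right; exact ⟨K, h, rfl⟩
    · right; exact ⟨(r, b, K), ⟨trivial, trivial, h⟩, rfl⟩
    · simp
  refine Set.Finite.subset ?_ h
  have hc := p.finite_conts []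
  refine Set.Finite.union (Set.Finite.union (Set.Finite.union (Set.Finite.union ?_ ?_) ?_) ?_) ?_
  · exact Set.finite_singleton _
  · exact Set.finite_range _
  · exact hc.image _
  · exact Set.finite_range _
  · exact (Set.finite_univ.prod (Set.finite_univ.prod hc)).image _

/-- The machine that carries out the program `p`. -/
abbrev compile [Finite ι] (p : Prog ι) (i o : ι) : Machine where
  tapes := k
  State := ctlStates p
  Symbol := Option Bool
  finState := (finite_ctlStates p).to_subtype
  start := ⟨.load, trivial⟩
  accepting := {q | q.1 = .unload true}
  trans q a g := {m | (⟨m.next.1, m.inMove, m.write, m.move, m.out⟩ :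
    MoveData (Ctl ι) (Option Bool) k) ∈ ctlTrans e p i o q.1 a g}

theorem update_stackTape {e : ι ≃ Fin k} (s : Store ι) (r : ι) (l : List Bool) :
    Function.update (fun j => stackTape (s (e.symm j))) (e r) (stackTape l) =
      fun j => stackTape (Function.update s r l (e.symm j)) := by
  funext j
  by_cases hj : j = e r
  · subst hj; simp
  · rw [Function.update_of_ne hj, Function.update_of_ne]
    rintro rfl
    simp at hj

theorem Machine.Cfg.ext {M : Machine} {c d : M.Cfg} (h₁ : c.state = d.state)
    (h₂ : c.input = d.input) (h₃ : c.work = d.work) (h₄ : c.output = d.output) : c = d := by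
  cases c; cases d; simp_all

variable [Finite ι] {e} {p : Prog ι} {i o : ι}

/-- A configuration whose tapes are given by a family of stacks. -/
def stackCfg (e : ι ≃ Fin k) (p : Prog ι) (i o : ι) (q : ctlStates p)
    (inp : Turing.Tape (Option Bool)) (s : Store ι) (out : List Bool) :
    (compile e p i o).Cfg where
  state := q
  input := inp
  work := fun j => stackTape (s (e.symm j))
  output := out

/-- The states of the compiled machine are restricted to a finite set; the condition `hm` guarantees
that the restriction does not discard the intended action. -/
theorem actions_eq_singleton {ι : Type} [Finite ι] [DecidableEq ι] {e : ι ≃ Fin k}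
    {p : Prog ι} {i o : ι} {c : (compile e p i o).Cfg} {m : MoveData (Ctl ι) (Option Bool) k}
    (hm : m.next ∈ ctlStates p)
    (h : ctlTrans e p i o c.state.1 c.input.head (fun j => (c.work j).head) = {m}) :
    (compile e p i o).actions c =
      {(⟨⟨m.next, hm⟩, m.inMove, m.write, m.move, m.out⟩ :
        MoveData (ctlStates p) (Option Bool) k)} := by
  ext a
  change (_ ∈ ctlTrans e p i o c.state.1 c.input.head (fun j => (c.work j).head)) ↔ _
  rw [h]
  obtain ⟨⟨n, hn⟩, im, w, mv, out⟩ := a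
  obtain ⟨n', im', w', mv', out'⟩ := m
  rw [Set.mem_singleton_iff, Set.mem_singleton_iff, MoveData.mk.injEq, MoveData.mk.injEq,
    Subtype.mk_eq_mk]

theorem leads_idle {c : (compile e p i o).Cfg} {next : Ctl ι} (hn : next ∈ ctlStates p)
    (h : ctlTrans e p i o c.state.1 c.input.head (fun j => (c.work j).head) =
      {idle (fun j => (c.work j).head) next}) :
    (compile e p i o).Leads c { c with state := ⟨next, hn⟩ } 1 := by
  have := Machine.Leads.of_actions (actions_eq_singleton (e := e) (m := idle _ next) hn h)
  convert this using 1
  obtain ⟨q, inp, w, out⟩ := c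
  refine Machine.Cfg.ext rfl rfl ?_ (List.append_nil _).symm
  funext j
  exact (Turing.Tape.write_self _).symm

theorem leads_oneTape {c : (compile e p i o).Cfg} {next : Ctl ι} (hn : next ∈ ctlStates p)
    {im r a d out}
    (h : ctlTrans e p i o c.state.1 c.input.head (fun j => (c.work j).head) =
      {oneTape e (fun j => (c.work j).head) next im r a d out}) :
    (compile e p i o).Leads c
      { state := ⟨next, hn⟩
        input := moveHead im c.input
        work := Function.update c.work (e r) (moveHead d ((c.work (e r)).write a))
        output := c.output ++ out.toList } 1 := by
  have := Machine.Leads.of_actions (actions_eq_singleton (e := e)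
    (m := oneTape e _ next im r a d out) hn h)
  convert this using 1
  obtain ⟨q, inp, w, out⟩ := c
  refine Machine.Cfg.ext rfl rfl ?_ rfl
  funext j
  simp only [Machine.act, oneTape]
  by_cases hj : j = e r
  · subst hj; rw [Function.update_self, Function.update_self, Function.update_self]
  · rw [Function.update_of_ne hj, Function.update_of_ne hj, Function.update_of_ne hj]
    exact (Turing.Tape.write_self _).symm

variable {inp : Turing.Tape (Option Bool)} {s : Store ι} {out : List Bool}

theorem leads_put {r : ι} {b : Bool} {K : List (Prog ι)} (hK : K ∈ p.conts []) :
    (compile e p i o).Leads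
      { state := ⟨.put r b K, hK⟩
        input := inp
        work := Function.update (fun j => stackTape (s (e.symm j))) (e r) (stackTapeRight (s r))
        output := out }
      (stackCfg e p i o ⟨.run K, hK⟩ inp (Function.update s r (b :: s r)) out) 1 := by
  refine (congrArg (fun d => Machine.Leads _ _ d 1) ?_).mp
    (leads_oneTape (e := e) (next := .run K) hK rfl)
  refine Machine.Cfg.ext rfl rfl ?_ (List.append_nil _)
  simp only [stackCfg]
  rw [Function.update_self, Function.update_idem]
  change Function.update (fun j => stackTape (s (e.symm j))) (e r) ((stackTapeRight (s r)).write (some b)) = _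
  rw [stackTapeRight_write, update_stackTape]

theorem leads_push {r : ι} {b : Bool} {K : List (Prog ι)} (hK : K ∈ p.conts [])
    (hK' : Prog.push r b :: K ∈ p.conts []) :
    (compile e p i o).Leads (stackCfg e p i o ⟨.run (.push r b :: K), hK'⟩ inp s out)
      (stackCfg e p i o ⟨.run K, hK⟩ inp (Function.update s r (b :: s r)) out) 2 := by
  refine Machine.Leads.trans (t := 1) (t' := 1) ?_ (leads_put hK)
  refine (congrArg (fun d => Machine.Leads _ _ d 1) ?_).mp
    (leads_oneTape (e := e) (next := .put r b K) hK rfl)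
  refine Machine.Cfg.ext rfl rfl ?_ (List.append_nil _)
  simp only [stackCfg, Equiv.symm_apply_apply, Turing.Tape.write_self]
  change Function.update (fun j => stackTape (s (e.symm j))) (e r) ((stackTape (s r)).move .right) = _
  rw [stackTape_move_right]

/-- Induction on the run; the costs in `Runs` are exactly the numbers of machine steps. The
inclusion `hK` keeps all control stacks that occur among the states. -/
theorem leads_run {q : Prog ι} {s s' : Store ι} {t : ℕ} (h : Runs q s t s') :
    ∀ (K : List (Prog ι)) (hK : q.conts K ⊆ p.conts []),
      (compile e p i o).Leads
        (stackCfg e p i o ⟨.run (q :: K), hK (q.cons_mem_conts K)⟩ inp s out)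
        (stackCfg e p i o ⟨.run K, hK (q.mem_conts K)⟩ inp s' out) t := by
  induction h with
  | skip h => intro K hK; exact (leads_idle _ rfl).mono h
  | push h => intro K hK; exact (leads_push _ _).mono h
  | @seq q₁ q₂ s s' s'' t₁ t₂ t h₁ h₂ h ih₁ ih₂ =>
    intro K hK
    have hq₁ : q₁.conts (q₂ :: K) ⊆ p.conts [] := fun x hx => hK (Or.inr (Or.inl hx))
    have hq₂ : q₂.conts K ⊆ p.conts [] := fun x hx => hK (Or.inr (Or.inr hx))
    have h0 : (compile e p i o).Leads
        (stackCfg e p i o ⟨.run (.seq q₁ q₂ :: K), hK (Prog.cons_mem_conts _ K)⟩ inp s out)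
        (stackCfg e p i o ⟨.run (q₁ :: q₂ :: K), hq₁ (q₁.cons_mem_conts _)⟩ inp s out) 1 :=
      leads_idle _ rfl
    exact ((h0.trans (ih₁ _ hq₁)).trans (ih₂ _ hq₂)).mono (by omega)
  | @cases_nil r q₁ q₂ s s' t₁ t h₁ h₂ h ih =>
    intro K hK
    have hq₁ : q₁.conts K ⊆ p.conts [] := fun x hx => hK (Or.inr (Or.inl hx))
    have h0 : (compile e p i o).Leads
        (stackCfg e p i o ⟨.run (.cases r q₁ q₂ :: K), hK (Prog.cons_mem_conts _ K)⟩ inp s out)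
        (stackCfg e p i o ⟨.run (q₁ :: K), hq₁ (q₁.cons_mem_conts _)⟩ inp s out) 1 := by
      refine leads_idle _ ?_
      simp [stackCfg, ctlTrans, h₁, stackTape]
    exact (h0.trans (ih _ hq₁)).mono (by omega)
  | @cases_cons r q₁ q₂ s s' b l t₁ t h₁ h₂ h ih =>
    intro K hK
    have hq₂ : (q₂ b).conts K ⊆ p.conts [] := fun x hx =>
      hK (Or.inr (Or.inr (Set.mem_iUnion.2 ⟨b, hx⟩)))
    have h0 : (compile e p i o).Leads
        (stackCfg e p i o ⟨.run (.cases r q₁ q₂ :: K), hK (Prog.cons_mem_conts _ K)⟩ inp s out)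
        (stackCfg e p i o ⟨.run (q₂ b :: K), hq₂ ((q₂ b).cons_mem_conts _)⟩ inp
          (Function.update s r l) out) 1 := by
      refine (congrArg (fun d => Machine.Leads _ _ d 1) ?_).mp
        (leads_oneTape (e := e) (next := .run (q₂ b :: K)) (im := none) (r := r) (a := none)
          (d := some .left) (out := none) (hq₂ ((q₂ b).cons_mem_conts _)) ?_)
      · refine Machine.Cfg.ext rfl rfl ?_ (List.append_nil _)
        simp only [stackCfg]
        rw [Equiv.symm_apply_apply, h₁]
        change Function.update (fun j => stackTape (s (e.symm j))) (e r) (((stackTape (b :: l)).write none).move .left) = _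
        rw [stackTape_pop, update_stackTape]
      · simp [stackCfg, ctlTrans, h₁, stackTape]
    exact (h0.trans (ih _ hq₂)).mono (by omega)
  | @loop_nil r q s t h₁ h =>
    intro K hK
    refine (leads_idle _ ?_).mono h
    simp [stackCfg, ctlTrans, h₁, stackTape]
  | @loop_cons r q s s' s'' t₁ t₂ t h₁ h₂ h₃ h ih₁ ih₂ =>
    intro K hK
    have hq : q.conts (.loop r q :: K) ⊆ p.conts [] := fun x hx => hK (Or.inr hx)
    have h0 : (compile e p i o).Leads
        (stackCfg e p i o ⟨.run (.loop r q :: K), hK (Prog.cons_mem_conts _ K)⟩ inp s out)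
        (stackCfg e p i o ⟨.run (q :: .loop r q :: K), hq (q.cons_mem_conts _)⟩ inp s out) 1 := by
      refine leads_idle _ ?_
      obtain ⟨b, l, hl⟩ := List.exists_cons_of_ne_nil h₁
      simp [stackCfg, ctlTrans, hl, stackTape]
    exact ((h0.trans (ih₁ _ hq)).trans (ih₂ _ hK)).mono (by omega)

theorem leads_load (x : List Bool) (T : Turing.ListBlank (Option Bool)) :
    ∃ inp', (compile e p i o).Leads
      (stackCfg e p i o ⟨.load, trivial⟩
        (Turing.Tape.mk' T (Turing.ListBlank.mk (x.map some))) s out)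
      (stackCfg e p i o ⟨.run [p], p.cons_mem_conts []⟩ inp'
        (Function.update s i (x.reverse ++ s i)) out) (2 * x.length + 1) := by
  induction x generalizing T s with
  | nil =>
    refine ⟨Turing.Tape.mk' T (Turing.ListBlank.mk []), ?_⟩
    simp only [List.reverse_nil, List.nil_append, Function.update_eq_self]
    exact leads_idle _ rfl
  | cons b x ih =>
    obtain ⟨inp', h⟩ := ih (s := Function.update s i (b :: s i)) (T.cons (some b))
    refine ⟨inp', ?_⟩
    have h₁ : (compile e p i o).Leads
        (stackCfg e p i o ⟨.load, trivial⟩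
          (Turing.Tape.mk' T (Turing.ListBlank.mk ((b :: x).map some))) s out)
        { state := ⟨.loadPut b, trivial⟩
          input := Turing.Tape.mk' (T.cons (some b)) (Turing.ListBlank.mk (x.map some))
          work := Function.update (fun j => stackTape (s (e.symm j))) (e i)
            (stackTapeRight (s i))
          output := out } 1 := by
      refine (congrArg (fun d => Machine.Leads _ _ d 1) ?_).mp
        (leads_oneTape (e := e) (next := .loadPut b) (im := some .right) (r := i)
          (a := (s i).head?) (d := some .right) (out := none) trivial ?_)
      · refine Machine.Cfg.ext rfl ?_ ?_ (List.append_nil _)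
        · simp [moveHead, stackCfg]
        · simp only [stackCfg, Equiv.symm_apply_apply]
          change Function.update (fun j => stackTape (s (e.symm j))) (e i)
            ((stackTape (s i)).move .right) = _
          rw [stackTape_move_right]
      · simp [stackCfg, ctlTrans, stackTape]
    have h₂ : (compile e p i o).Leads
        { state := ⟨.loadPut b, trivial⟩
          input := Turing.Tape.mk' (T.cons (some b)) (Turing.ListBlank.mk (x.map some))
          work := Function.update (fun j => stackTape (s (e.symm j))) (e i)
            (stackTapeRight (s i))
          output := out }
        (stackCfg e p i o ⟨.load, trivial⟩
          (Turing.Tape.mk' (T.cons (some b)) (Turing.ListBlank.mk (x.map some)))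
          (Function.update s i (b :: s i)) out) 1 := by
      refine (congrArg (fun d => Machine.Leads _ _ d 1) ?_).mp
        (leads_oneTape (e := e) (next := .load) trivial rfl)
      refine Machine.Cfg.ext rfl rfl ?_ (List.append_nil _)
      simp only [stackCfg]
      rw [Function.update_self, Function.update_idem]
      change Function.update (fun j => stackTape (s (e.symm j))) (e i)
        ((stackTapeRight (s i)).write (some b)) = _
      rw [stackTapeRight_write, update_stackTape]
    have := (h₁.trans h₂).trans h
    simp only [Function.update_self, Function.update_idem] at this
    simp only [List.reverse_cons, List.append_assoc, List.singleton_append]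
    exact this.mono (by simp; omega)

/-- The state remembers the bit written last, so that acceptance can be read off from the end of the
output; `c` covers the case of an empty stack. -/
theorem leads_unload (c : Bool) :
    (compile e p i o).Leads (stackCfg e p i o ⟨.unload c, trivial⟩ inp s out)
      (stackCfg e p i o ⟨.unload ((s o).getLastD c), trivial⟩ inp (Function.update s o [])
        (out ++ s o)) (s o).length := by
  obtain ⟨l, hl⟩ : ∃ l, s o = l := ⟨_, rfl⟩
  induction l generalizing s c out with
  | nil =>
    have : Function.update s o [] = s := by rw [← hl, Function.update_eq_self]
    rw [this, hl]
    simp only [List.append_nil]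
    exact Machine.Leads.refl _ _
  | cons b l ih =>
    have h₀ : (compile e p i o).Leads (stackCfg e p i o ⟨.unload c, trivial⟩ inp s out)
        (stackCfg e p i o ⟨.unload b, trivial⟩ inp (Function.update s o l) (out ++ [b])) 1 := by
      refine (congrArg (fun d => Machine.Leads _ _ d 1) ?_).mp
        (leads_oneTape (e := e) (next := .unload b) (im := none) (r := o) (a := none)
          (d := some .left) (out := some b) trivial ?_)
      · refine Machine.Cfg.ext rfl rfl ?_ rfl
        simp only [stackCfg]
        rw [Equiv.symm_apply_apply, hl]
        change Function.update (fun j => stackTape (s (e.symm j))) (e o)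
          (((stackTape (b :: l)).write none).move .left) = _
        rw [stackTape_pop, update_stackTape]
      · simp [stackCfg, ctlTrans, hl, stackTape]
    have h₁ := ih (s := Function.update s o l) (out := out ++ [b]) b (by simp)
    simp only [Function.update_self, Function.update_idem] at h₁
    rw [hl]
    have := h₀.trans h₁
    rw [List.append_assoc, List.singleton_append] at this
    have h₂ : (b :: l).getLastD c = l.getLastD b := by cases l <;> rfl
    rw [h₂]
    exact this.mono (by simp; omega)

theorem leads_halt : ∃ d, (compile e p i o).Leads
      (stackCfg e p i o ⟨.run [], p.mem_conts []⟩ inp s out) d ((s o).length + 1) ∧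
    (compile e p i o).Halted d ∧ d.output = out ++ s o ∧
    d.state.1 = .unload ((s o).getLastD false) := by
  have h₀ : (compile e p i o).Leads
      (stackCfg e p i o ⟨.run [], p.mem_conts []⟩ inp s out)
      (stackCfg e p i o ⟨.unload false, trivial⟩ inp s out) 1 := leads_idle _ rfl
  refine ⟨_, (h₀.trans (leads_unload false)).mono (by omega), ?_, rfl, rfl⟩
  rw [Machine.Halted]
  ext a
  simp [Machine.actions, stackCfg, ctlTrans, stackTape]

/-! ### Nondeterministic guessing in a compiled machine -/

/-- The guessing of as many bits as there are symbols on the stack `u`. -/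
def guessLoop (u w : ι) : Prog ι := .loop u (.cases u .skip fun _ => .guess w)

/-- `Runs` covers guess-free programs only, so this loop is analysed on the machine itself. A round
takes four steps: loop, pop, choose a bit, write it. Both time and acceptance are reduced to what
happens after the loop, for all outcomes `v`. -/
theorem guessLoop_spec {u w : ι} (huw : u ≠ w) {K : List (Prog ι)}
    (hK : (guessLoop u w).conts K ⊆ p.conts []) :
    (∀ b, (∀ v : List Bool, v.length = (s u).length → (compile e p i o).Bounded
        (stackCfg e p i o ⟨.run K, hK (Prog.mem_conts _ K)⟩ inp
          (Function.update (Function.update s u []) w (v ++ s w)) out) b) →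
      (compile e p i o).Bounded
        (stackCfg e p i o ⟨.run (guessLoop u w :: K), hK (Prog.cons_mem_conts _ K)⟩ inp s out)
        (b + 4 * (s u).length + 1)) ∧
    ∀ P, (compile e p i o).Ends P
        (stackCfg e p i o ⟨.run (guessLoop u w :: K), hK (Prog.cons_mem_conts _ K)⟩ inp s out) ↔
      ∃ v : List Bool, v.length = (s u).length ∧ (compile e p i o).Ends P
        (stackCfg e p i o ⟨.run K, hK (Prog.mem_conts _ K)⟩ inp
          (Function.update (Function.update s u []) w (v ++ s w)) out) := by
  obtain ⟨l, hl⟩ : ∃ l, s u = l := ⟨_, rfl⟩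
  induction l generalizing s with
  | nil =>
    have hs : Function.update s u [] = s := by rw [← hl, Function.update_eq_self]
    have h₀ : (compile e p i o).Leads
        (stackCfg e p i o ⟨.run (guessLoop u w :: K), hK (Prog.cons_mem_conts _ K)⟩ inp s out)
        (stackCfg e p i o ⟨.run K, hK (Prog.mem_conts _ K)⟩ inp s out) 1 := by
      refine leads_idle _ ?_
      simp [stackCfg, ctlTrans, hl, stackTape, guessLoop]
    have h₁ : ∀ v : List Bool, v.length = (s u).length →
        Function.update (Function.update s u []) w (v ++ s w) = s := by
      intro v hv
      rw [hl] at hv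
      rw [List.eq_nil_of_length_eq_zero hv, hs, List.nil_append, Function.update_eq_self]
    refine ⟨fun b hb => ?_, fun P => ?_⟩
    · have := hb [] (by simp [hl])
      rw [h₁ _ (by simp [hl])] at this
      exact (h₀.1 _ this).mono (by omega)
    · rw [h₀.2]
      constructor
      · intro h
        exact ⟨[], by simp [hl], by rwa [h₁ _ (by simp [hl])]⟩
      · rintro ⟨v, hv, h⟩
        rwa [h₁ v hv] at h
  | cons a l ih =>
    have hb : (Prog.cases u .skip fun _ => .guess w).conts (guessLoop u w :: K) ⊆ p.conts [] :=
      fun x hx => hK (Or.inr hx)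
    have hg : Prog.guess w :: guessLoop u w :: K ∈ p.conts [] :=
      hb (Or.inr (Or.inr (Set.mem_iUnion.2 ⟨true, Prog.cons_mem_conts _ _⟩)))
    have h₀ : (compile e p i o).Leads
        (stackCfg e p i o ⟨.run (guessLoop u w :: K), hK (Prog.cons_mem_conts _ K)⟩ inp s out)
        (stackCfg e p i o ⟨.run (.cases u .skip (fun _ => .guess w) :: guessLoop u w :: K),
          hb (Prog.cons_mem_conts _ _)⟩ inp s out) 1 := by
      refine leads_idle _ ?_
      simp [stackCfg, ctlTrans, hl, stackTape, guessLoop]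
    have h₁ : (compile e p i o).Leads
        (stackCfg e p i o ⟨.run (.cases u .skip (fun _ => .guess w) :: guessLoop u w :: K),
          hb (Prog.cons_mem_conts _ _)⟩ inp s out)
        (stackCfg e p i o ⟨.run (.guess w :: guessLoop u w :: K), hg⟩ inp
          (Function.update s u l) out) 1 := by
      refine (congrArg (fun d => Machine.Leads _ _ d 1) ?_).mp
        (leads_oneTape (e := e) (next := .run (.guess w :: guessLoop u w :: K)) (im := none)
          (r := u) (a := none) (d := some .left) (out := none) hg ?_)
      · refine Machine.Cfg.ext rfl rfl ?_ (List.append_nil _)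
        simp only [stackCfg]
        rw [Equiv.symm_apply_apply, hl]
        change Function.update (fun j => stackTape (s (e.symm j))) (e u)
          (((stackTape (a :: l)).write none).move .left) = _
        rw [stackTape_pop, update_stackTape]
      · simp [stackCfg, ctlTrans, hl, stackTape]
    have h₂ := h₀.trans h₁
    set s₁ := Function.update s u l with hs₁
    set c₁ := stackCfg e p i o ⟨.run (.guess w :: guessLoop u w :: K), hg⟩ inp s₁ out with hc₁
    set mid : Bool → (compile e p i o).Cfg := fun b =>
      { state := ⟨.put w b (guessLoop u w :: K), hK (Prog.cons_mem_conts _ _)⟩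
        input := inp
        work := Function.update (fun j => stackTape (s₁ (e.symm j))) (e w)
          (stackTapeRight (s₁ w))
        output := out } with hmid
    -- The possible actions at the guess correspond to the two bits; this is the only branching
    -- point.
    have hact : ∀ b, ∃ a ∈ (compile e p i o).actions c₁, (compile e p i o).act c₁ a = mid b := by
      intro b
      refine ⟨(⟨⟨.put w b (guessLoop u w :: K), hK (Prog.cons_mem_conts _ _)⟩, none,
        Function.update (fun j => (c₁.work j).head) (e w) (c₁.work (e w)).head,
        Function.update (fun _ => none) (e w) (some .right), none⟩ :
        MoveData (ctlStates p) (Option Bool) k), ⟨b, rfl⟩, ?_⟩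
      refine Machine.Cfg.ext rfl rfl ?_ (List.append_nil _)
      funext j
      simp only [Machine.act, hmid]
      by_cases hj : j = e w
      · subst hj
        rw [Function.update_self, Function.update_self, Function.update_self,
          Turing.Tape.write_self]
        simp only [hc₁, stackCfg, Equiv.symm_apply_apply]
        exact stackTape_move_right _
      · rw [Function.update_of_ne hj, Function.update_of_ne hj, Function.update_of_ne hj]
        exact Turing.Tape.write_self _
    have hact' : ∀ a ∈ (compile e p i o).actions c₁, ∃ b, (compile e p i o).act c₁ a = mid b := by
      intro a ha
      obtain ⟨b, hb⟩ : ∃ b, (⟨a.next.1, a.inMove, a.write, a.move, a.out⟩ :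
          MoveData (Ctl ι) (Option Bool) k) = oneTape e (fun j => (c₁.work j).head)
            (.put w b (guessLoop u w :: K)) none w (c₁.work (e w)).head (some .right) none := ha
      refine ⟨b, ?_⟩
      obtain ⟨a', ha', h⟩ := hact b
      rw [← h]
      obtain ⟨⟨n, hn⟩, im, wr, mv, out'⟩ := a
      simp only [oneTape, MoveData.mk.injEq] at hb
      obtain ⟨rfl, rfl, rfl, rfl, rfl⟩ := hb
      rw [h]
      refine Machine.Cfg.ext rfl rfl ?_ (List.append_nil _)
      funext j
      simp only [Machine.act, hmid]
      by_cases hj : j = e w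
      · subst hj
        rw [Function.update_self, Function.update_self, Function.update_self,
          Turing.Tape.write_self]
        simp only [hc₁, stackCfg, Equiv.symm_apply_apply]
        exact stackTape_move_right _
      · rw [Function.update_of_ne hj, Function.update_of_ne hj, Function.update_of_ne hj]
        exact Turing.Tape.write_self _
    have hput : ∀ b, (compile e p i o).Leads (mid b)
        (stackCfg e p i o ⟨.run (guessLoop u w :: K), hK (Prog.cons_mem_conts _ _)⟩ inp
          (Function.update s₁ w (b :: s₁ w)) out) 1 := fun b => leads_put _
    have hlen : ∀ b, Function.update s₁ w (b :: s₁ w) u = l := by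
      intro b
      rw [Function.update_of_ne huw, hs₁, Function.update_self]
    have hw : s₁ w = s w := Function.update_of_ne huw.symm _ _
    have hfin : ∀ (b : Bool) (v : List Bool),
        Function.update (Function.update (Function.update s₁ w (b :: s₁ w)) u []) w
          (v ++ Function.update s₁ w (b :: s₁ w) w) =
        Function.update (Function.update s u []) w ((v ++ [b]) ++ s w) := by
      intro b v
      rw [Function.update_self, hw, Function.update_comm huw.symm, Function.update_idem, hs₁,
        Function.update_idem, List.append_assoc, List.singleton_append]
    refine ⟨fun b hb => ?_, fun P => ?_⟩
    · have : ∀ c, (compile e p i o).Bounded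
          (stackCfg e p i o ⟨.run (guessLoop u w :: K), hK (Prog.cons_mem_conts _ _)⟩ inp
            (Function.update s₁ w (c :: s₁ w)) out) (b + 4 * l.length + 1) := by
        intro c
        have := (ih (s := Function.update s₁ w (c :: s₁ w)) (hlen c)).1 b
        rw [hlen c] at this
        refine this fun v hv => ?_
        rw [hfin]
        exact hb _ (by simp [hl, hv])
      have h₃ : (compile e p i o).Bounded c₁ ((b + 4 * l.length + 1) + 1 + 1) := by
        refine Machine.bounded_of_forall fun a ha => ?_
        obtain ⟨c, hc⟩ := hact' a ha
        rw [hc]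
        exact (hput c).1 _ (this c)
      refine (h₂.1 _ h₃).mono ?_
      rw [hl, List.length_cons]
      omega
    · rw [h₂.2, Machine.ends_iff (let ⟨a, ha, _⟩ := hact true; ⟨a, ha⟩)]
      have hih : ∀ c, (compile e p i o).Ends P (mid c) ↔ ∃ v : List Bool, v.length = l.length ∧
          (compile e p i o).Ends P (stackCfg e p i o ⟨.run K, hK (Prog.mem_conts _ K)⟩ inp
            (Function.update (Function.update s u []) w ((v ++ [c]) ++ s w)) out) := by
        intro c
        have := (ih (s := Function.update s₁ w (c :: s₁ w)) (hlen c)).2 P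
        rw [hlen c] at this
        rw [(hput c).2, this]
        simp only [hfin]
      constructor
      · rintro ⟨a, ha, h⟩
        obtain ⟨c, hc⟩ := hact' a ha
        rw [hc, hih] at h
        obtain ⟨v, hv, h⟩ := h
        exact ⟨v ++ [c], by simp [hl, hv], h⟩
      · rintro ⟨v, hv, h⟩
        rw [hl, List.length_cons] at hv
        -- Later bits are pushed on top of earlier ones, so the first guess is the last symbol of
        -- `v`.
        obtain ⟨v', c, rfl⟩ : ∃ v' c, v = v' ++ [c] :=
          ⟨v.dropLast, v.getLast (by rintro rfl; simp at hv),
            (List.dropLast_append_getLast _).symm⟩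
        obtain ⟨a, ha, hc⟩ := hact c
        refine ⟨a, ha, ?_⟩
        rw [hc, hih]
        exact ⟨v', by simpa using hv, h⟩

end Compile

/-! ## Deterministic programs -/

theorem compile_deterministic {ι : Type} [Finite ι] [DecidableEq ι] {k : ℕ} (e : ι ≃ Fin k)
    {p : Prog ι} (hp : p.Det) (i o : ι) : (compile e p i o).Deterministic := by
  -- A guess-free program has no guess on any control stack that it can reach, and guesses are the
  -- only source of several actions.
  have hdet : ∀ (q : Prog ι) (K : List (Prog ι)), q.Det → (∀ q' ∈ K, q'.Det) →
      ∀ K' ∈ q.conts K, ∀ q' ∈ K', q'.Det := by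
    intro q
    induction q with
    | skip =>
      rintro K - hK K' (rfl | rfl)
      · simpa [Prog.Det] using hK
      · exact hK
    | push r b =>
      rintro K - hK K' (rfl | rfl)
      · simpa [Prog.Det] using hK
      · exact hK
    | guess r => intro K h; exact h.elim
    | seq p q ihp ihq =>
      rintro K h hK K' ((rfl | rfl) | h' | h')
      · simpa [h] using hK
      · exact hK
      · refine ihp (q :: K) h.1 ?_ K' h'
        simpa [h.2] using hK
      · exact ihq K h.2 hK K' h'
    | cases r p q ihp ihq =>
      rintro K h hK K' ((rfl | rfl) | h' | h')
      · simpa [h] using hK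
      · exact hK
      · exact ihp K h.1 hK K' h'
      · obtain ⟨b, hb⟩ := Set.mem_iUnion.1 h'
        exact ihq b K (h.2 b) hK K' hb
    | loop r p ih =>
      rintro K h hK K' ((rfl | rfl) | h')
      · simpa [h] using hK
      · exact hK
      · refine ih (.loop r p :: K) h ?_ K' h'
        simpa [h] using hK
  have hraw : ∀ (c : Ctl ι) a g, c ∈ ctlStates p → (ctlTrans e p i o c a g).Subsingleton := by
    intro c a g hc
    match c, a, hc with
    | .load, some b, _ => exact Set.subsingleton_singleton
    | .load, none, _ => exact Set.subsingleton_singleton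
    | .loadPut b, _, _ => exact Set.subsingleton_singleton
    | .run [], _, _ => exact Set.subsingleton_singleton
    | .run (.skip :: K), _, _ => exact Set.subsingleton_singleton
    | .run (.push r b :: K), _, _ => exact Set.subsingleton_singleton
    | .run (.guess r :: K), _, hc => exact (hdet p [] hp (by simp) _ hc (.guess r) (by simp)).elim
    | .run (.seq p q :: K), _, _ => exact Set.subsingleton_singleton
    | .run (.cases r p q :: K), _, _ =>
      simp only [ctlTrans]
      split <;> exact Set.subsingleton_singleton
    | .run (.loop r p :: K), _, _ =>
      simp only [ctlTrans]
      split <;> exact Set.subsingleton_singleton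
    | .put r b K, _, _ => exact Set.subsingleton_singleton
    | .unload _, _, _ =>
      simp only [ctlTrans]
      split
      · exact Set.subsingleton_empty
      · exact Set.subsingleton_singleton
  intro q a g m hm m' hm'
  have := hraw q.1 a g q.2 hm hm'
  obtain ⟨⟨n, hn⟩, im, w, mv, out⟩ := m
  obtain ⟨⟨n', hn'⟩, im', w', mv', out'⟩ := m'
  simp only [MoveData.mk.injEq] at this
  obtain ⟨rfl, rfl, rfl, rfl, rfl⟩ := this
  rfl

section

variable {ι : Type} [Finite ι] [DecidableEq ι] {k : ℕ} {e : ι ≃ Fin k} {p : Prog ι} {i o : ι}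

theorem init_compile (x : List Bool) : (compile e p i o).init x =
    stackCfg e p i o ⟨.load, trivial⟩
      (Turing.Tape.mk' (Turing.ListBlank.mk []) (Turing.ListBlank.mk (x.map some)))
      (fun _ => []) [] := rfl

theorem compile_spec {x : List Bool} {s : Store ι} {t : ℕ}
    (h : Runs p (single i x.reverse) t s) :
    (compile e p i o).RunsIn x (2 * x.length + t + (s o).length + 2) ∧
    (compile e p i o).Outputs x (s o) ∧
    ((compile e p i o).Accepts x ↔ (s o).getLastD false = true) := by
  obtain ⟨inp, h₁⟩ := leads_load (e := e) (p := p) (i := i) (o := o) (s := fun _ => [])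
    (out := []) x (Turing.ListBlank.mk [])
  rw [← init_compile, List.append_nil] at h₁
  have h₂ := leads_run (e := e) (p := p) (i := i) (o := o) (inp := inp) (out := []) h []
    (fun _ hx => hx)
  obtain ⟨d, h₃, hd, hout, hst⟩ := leads_halt (e := e) (p := p) (i := i) (o := o) (inp := inp)
    (s := s) (out := [])
  have h₄ := (h₁.trans h₂).trans h₃
  refine ⟨?_, ?_, ?_⟩
  · exact ((h₄.1 0 (Machine.bounded_of_halted hd))).mono (by omega)
  · exact (h₄.2 fun c => c.output = s o).2 ((Machine.ends_of_halted hd).2 (by simpa using hout))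
  · refine (h₄.2 fun c => c.state ∈ (compile e p i o).accepting).trans ?_
    rw [Machine.ends_of_halted hd]
    change d.state.1 = .unload true ↔ _
    rw [hst]
    simp

end

/-! ## Basic programs -/

section Basic

variable {ι : Type} [DecidableEq ι]

namespace Prog

/-- Carry out `p b` for every symbol `b` on the stack `a`, from the top. -/
def forEach {ι : Type} (a : ι) (p : Bool → Prog ι) : Prog ι := .loop a (.cases a .skip p)

/-- Move the contents of `a` to `b`, in reverse order. -/
def mv {ι : Type} (a b : ι) : Prog ι := forEach a (.push b)

/-- Empty the stack `a`. -/
def clear {ι : Type} (a : ι) : Prog ι := forEach a fun _ => .skip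

/-- Move the contents of `a` to `b`, using `c`. -/
def xfer {ι : Type} (a c b : ι) : Prog ι := .seq (mv a c) (mv c b)

/-- Move the contents of `a` to `b` and to `d`, using `c`. -/
def xfer₂ {ι : Type} (a c b d : ι) : Prog ι :=
  .seq (mv a c) (forEach c fun x => .seq (.push b x) (.push d x))

/-- Push a string, its last symbol first. -/
def pushAll {ι : Type} (a : ι) : List Bool → Prog ι
  | [] => .skip
  | b :: l => .seq (pushAll a l) (.push a b)

/-- Carry out `p i` for the members `i` of a list. -/
def seqList {ι α : Type} (p : α → Prog ι) : List α → Prog ι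
  | [] => .skip
  | i :: l => .seq (p i) (seqList p l)

theorem det_forEach {a : ι} {p : Bool → Prog ι} : (forEach a p).Det ↔ ∀ b, (p b).Det := by
  simp [forEach, Det]

@[simp] theorem det_mv (a b : ι) : (mv a b).Det := by simp [mv, forEach, Det]
@[simp] theorem det_clear (a : ι) : (clear a).Det := by simp [clear, forEach, Det]
@[simp] theorem det_xfer (a b c : ι) : (xfer a b c).Det := by simp [xfer, Det]
@[simp] theorem det_xfer₂ (a b c d : ι) : (xfer₂ a b c d).Det := by simp [xfer₂, forEach, Det]

@[simp] theorem det_pushAll (a : ι) (l : List Bool) : (pushAll a l).Det := by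
  induction l with
  | nil => trivial
  | cons b l ih => exact ⟨ih, trivial⟩

theorem det_seqList {α : Type} {p : α → Prog ι} (h : ∀ i, (p i).Det) (l : List α) :
    (seqList p l).Det := by
  induction l with
  | nil => trivial
  | cons b l ih => exact ⟨h _, ih⟩

end Prog

theorem Runs.congr {p : Prog ι} {s s' s'' : Store ι} {t : ℕ} (h : Runs p s t s')
    (hs : s' = s'') : Runs p s t s'' := hs ▸ h

/-- The store is described as a function of the unread part of `a` and of an accumulator. Beyond the
cost `k` of the body, each round pays one step for the loop and one for the pop. -/
theorem runs_forEach {a : ι} {p : Bool → Prog ι} {α : Type} (st : List Bool → α → Store ι)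
    (f : α → Bool → α) {k : ℕ} (hst : ∀ l c, st l c a = l)
    (h : ∀ b l c, Runs (p b) (update (st (b :: l) c) a l) k (st l (f c b))) (l : List Bool)
    (c : α) : Runs (.forEach a p) (st l c) ((k + 2) * l.length + 1) (st [] (l.foldl f c)) := by
  induction l generalizing c with
  | nil => exact .loop_nil (hst _ _) (by simp)
  | cons b l ih =>
    refine .loop_cons (by rw [hst]; simp) (.cases_cons (hst _ _) (h b l c) le_rfl)
      (ih (f c b)) ?_
    rw [List.length_cons]
    ring_nf
    omega

theorem foldl_cons_eq (l m : List Bool) :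
    l.foldl (fun acc c => c :: acc) m = l.reverse ++ m := by
  induction l generalizing m with
  | nil => rfl
  | cons a l ih => simp [ih]

theorem runs_mv {a b : ι} (hab : a ≠ b) (s : Store ι) :
    Runs (.mv a b) s (4 * (s a).length + 1)
      (update (update s a []) b ((s a).reverse ++ s b)) := by
  have := runs_forEach (a := a) (p := .push b) (fun l acc => update (update s a l) b acc)
    (fun acc c => c :: acc) (k := 2) (by simp [hab]) (by
      intro c l acc
      have := Runs.push (ι := ι) (r := b) (b := c)
        (s := update (update (update s a (c :: l)) b acc) a l) le_rfl
      convert this using 1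
      rw [update_comm hab.symm]
      simp) (s a) (s b)
  rw [foldl_cons_eq, update_eq_self, update_eq_self] at this
  exact this

theorem runs_clear {a : ι} (s : Store ι) :
    Runs (.clear a) s (3 * (s a).length + 1) (update s a []) := by
  have := runs_forEach (a := a) (p := fun _ => .skip) (fun l (_ : Unit) => update s a l)
    (fun acc c => acc) (k := 1) (by simp) (by
      intro c l acc
      simpa using Runs.skip le_rfl) (s a) ()
  rw [update_eq_self] at this
  exact this

theorem runs_xfer {a b c : ι} (hab : a ≠ b) (hac : a ≠ c) (hbc : b ≠ c) (s : Store ι)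
    (hc : s c = []) :
    Runs (.xfer a c b) s (8 * (s a).length + 3)
      (update (update s a []) b (s a ++ s b)) := by
  have h₁ := runs_mv hac s
  have h₂ := runs_mv hbc.symm (update (update s a []) c ((s a).reverse ++ s c))
  have := Runs.seq h₁ h₂ (t := 8 * (s a).length + 3) (by simp [hc]; omega)
  refine this.congr ?_
  funext r
  by_cases h1 : r = a
  · subst h1; simp [hab, hac]
  by_cases h2 : r = b
  · subst h2; simp [hc, hab.symm, hbc]
  by_cases h3 : r = c
  · subst h3; simp [hc, h1, h2]
  simp [h1, h2, h3]

theorem runs_xfer₂ {a b c d : ι} (hab : a ≠ b) (hac : a ≠ c) (had : a ≠ d) (hbc : b ≠ c)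
    (hbd : b ≠ d) (hcd : c ≠ d) (s : Store ι) (hc : s c = []) :
    Runs (.xfer₂ a c b d) s (11 * (s a).length + 3)
      (update (update (update s a []) b (s a ++ s b)) d (s a ++ s d)) := by
  have h₁ := runs_mv hac s
  have h₂ := runs_forEach (a := c) (p := fun x => .seq (.push b x) (.push d x))
    (fun l acc => update (update (update (update s a []) c l) b (acc ++ s b)) d (acc ++ s d))
    (fun acc x => x :: acc) (k := 5) (by simp [hcd, hbc.symm]) (by
      intro x l acc
      refine (congrArg (fun S => Runs _ _ _ S) ?_).mp (Runs.seq (.push le_rfl) (.push le_rfl) le_rfl)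
      funext r
      by_cases h1 : r = d
      · subst h1; simp [hbd.symm, hcd.symm]
      by_cases h2 : r = b
      · subst h2; simp [h1, hbc]
      by_cases h3 : r = c
      · subst h3; simp [h1, h2]
      simp [h1, h2, h3]) (s a).reverse []
  rw [foldl_cons_eq] at h₂
  have h₃ : update (update (update (update s a []) c (s a).reverse) b ([] ++ s b)) d ([] ++ s d) =
      update (update s a []) c ((s a).reverse ++ s c) := by
    funext r
    by_cases h1 : r = d
    · subst h1; simp [hcd.symm, had.symm]
    by_cases h2 : r = b
    · subst h2; simp [h1, hbc, hab.symm]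
    simp [h1, h2, hc]
  rw [h₃] at h₂
  have := Runs.seq h₁ h₂ (t := 11 * (s a).length + 3) (by simp; omega)
  refine this.congr ?_
  funext r
  by_cases h1 : r = d
  · subst h1; simp
  by_cases h2 : r = b
  · subst h2; simp [h1]
  by_cases h3 : r = c
  · subst h3; simp [h1, h2, hc, hac.symm]
  simp [h1, h2, h3]

theorem runs_pushAll (a : ι) (l : List Bool) (s : Store ι) :
    Runs (.pushAll a l) s (3 * l.length + 1) (update s a (l ++ s a)) := by
  induction l with
  | nil => exact (Runs.skip (by simp)).congr (by simp)
  | cons b l ih =>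
    have := Runs.seq ih (.push (r := a) (b := b) le_rfl) (t := 3 * (b :: l).length + 1)
      (by simp; omega)
    exact this.congr (by simp)

/-- The invariant depends on the list of items still to be treated. That this list is a suffix of
`is` shows, for lists without repetitions, that the current item does not occur again. -/
theorem runs_seqList {α : Type} {p : α → Prog ι} (st : List α → Store ι) {k : ℕ} (is : List α)
    (h : ∀ i l, i :: l <:+ is → Runs (p i) (st (i :: l)) k (st l)) :
    Runs (.seqList p is) (st is) ((k + 1) * is.length + 1) (st []) := by
  induction is with
  | nil => exact .skip (by simp)
  | cons i is ih =>
    refine .seq (h i is List.suffix_rfl)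
      (ih fun j l hl => h j l (hl.trans (List.suffix_cons _ _))) ?_
    rw [List.length_cons]
    ring_nf
    omega

end Basic

/-! ## Symbols as blocks of bits -/

/-- A binary code with words of equal positive length. -/
structure Code (Γ : Type) where
  len : ℕ
  code : Γ → List Bool
  dec : List Bool → Γ
  len_pos : 0 < len
  length_code : ∀ a, (code a).length = len
  dec_code : ∀ a, dec (code a) = a

theorem exists_code (Γ : Type) [Finite Γ] [Nonempty Γ] : Nonempty (Code Γ) := by
  classical
  have := Fintype.ofFinite Γ
  -- One-hot words: all have the same length, positive since the alphabet is inhabited.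
  let f : Γ → List Bool := fun a => List.ofFn fun j => decide (Fintype.equivFin Γ a = j)
  have hf : Injective f := by
    intro a b hab
    have := congrFun (List.ofFn_injective hab) (Fintype.equivFin Γ a)
    simpa [eq_comm] using this
  exact ⟨⟨Fintype.card Γ, f, invFun f, Fintype.card_pos, by simp [f],
    leftInverse_invFun hf⟩⟩

section Sym

variable {ι Γ : Type} [DecidableEq ι] [Inhabited Γ] (C : Code Γ)

/-- The code of a string. -/
def Code.enc (l : List Γ) : List Bool := l.flatMap C.code

@[simp] theorem Code.enc_nil : C.enc [] = [] := rfl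

@[simp] theorem Code.enc_cons (a : Γ) (l : List Γ) : C.enc (a :: l) = C.code a ++ C.enc l := by
  simp [Code.enc]

namespace Prog

/-- Pop `n` bits; if the stack is empty, carry out `p`. -/
def popBits {ι : Type} (r : ι) (p : Prog ι) : ℕ → (List Bool → Prog ι) → Prog ι
  | 0, k => k []
  | n + 1, k => .cases r p fun b => popBits r p n fun l => k (b :: l)

/-- Pop a symbol; an empty stack counts as a blank. -/
def popSym (r : ι) (k : Γ → Prog ι) : Prog ι :=
  popBits r (k default) C.len fun l => k (C.dec l)

/-- Push a symbol. -/
def pushSym (r : ι) (a : Γ) : Prog ι := pushAll r (C.code a)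

/-- Inspect the topmost symbol. -/
def peek (r : ι) (k : Γ → Prog ι) : Prog ι :=
  popSym C r fun a => .seq (pushSym C r a) (k a)

/-- Write a symbol and move the head, on a tape that is represented by the two stacks `l` and
`r`. -/
def tapeOp (l r : ι) (w : Γ) (d : Option Turing.Dir) : Prog ι :=
  popSym C r fun _ => match d with
    | none => pushSym C r w
    | some .right => .seq (pushSym C l w) (popSym C r (pushSym C r))
    | some .left => popSym C l fun a => .seq (pushSym C r w) (pushSym C r a)

theorem det_popBits {r : ι} {p : Prog ι} (hp : p.Det) (n : ℕ) {k : List Bool → Prog ι}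
    (hk : ∀ l, (k l).Det) : (popBits r p n k).Det := by
  induction n generalizing k with
  | zero => exact hk _
  | succ n ih => exact ⟨hp, fun b => ih fun l => hk _⟩

theorem det_popSym {r : ι} {k : Γ → Prog ι} (hk : ∀ a, (k a).Det) : (popSym C r k).Det :=
  det_popBits (hk _) _ fun _ => hk _

theorem det_pushSym (r : ι) (a : Γ) : (pushSym C r a).Det := det_pushAll _ _

theorem det_peek {r : ι} {k : Γ → Prog ι} (hk : ∀ a, (k a).Det) : (peek C r k).Det :=
  det_popSym C fun _ => ⟨det_pushSym C _ _, hk _⟩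

theorem det_tapeOp (l r : ι) (w : Γ) (d : Option Turing.Dir) : (tapeOp C l r w d).Det := by
  refine det_popSym C fun _ => ?_
  rcases d with _ | _ | _
  · exact det_pushSym C _ _
  · exact det_popSym C fun _ => ⟨det_pushSym C _ _, det_pushSym C _ _⟩
  · exact ⟨det_pushSym C _ _, det_popSym C fun _ => det_pushSym C _ _⟩

end Prog

theorem runs_popBits {r : ι} {p : Prog ι} {k : List Bool → Prog ι} {S S' : Store ι}
    {bs rest : List Bool} {t : ℕ} (hS : S r = bs ++ rest)
    (h : Runs (k bs) (update S r rest) t S') :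
    Runs (.popBits r p bs.length k) S (t + bs.length) S' := by
  induction bs generalizing S k with
  | nil =>
    rw [List.nil_append] at hS
    rw [← hS, update_eq_self] at h
    exact h
  | cons b bs ih =>
    refine .cases_cons hS (ih (k := fun l => k (b :: l)) (by simp) ?_) (le_of_eq ?_)
    · rwa [update_idem]
    · rw [List.length_cons]; omega

/-- An exhausted stack acts as an infinite supply of blanks, so finite lists can stand for
half-tapes. Code words are not empty, hence exhaustion is noticed at the first bit. -/
theorem runs_popSym {r : ι} {k : Γ → Prog ι} {S S' : Store ι} {l : List Γ} {t : ℕ}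
    (hS : S r = C.enc l) (h : Runs (k l.headI) (update S r (C.enc l.tail)) t S') :
    Runs (.popSym C r k) S (t + C.len) S' := by
  cases l with
  | nil =>
    rw [List.tail_nil, C.enc_nil] at h
    rw [C.enc_nil] at hS
    rw [← hS, update_eq_self] at h
    obtain ⟨n, hn⟩ := Nat.exists_eq_succ_of_ne_zero C.len_pos.ne'
    rw [Prog.popSym, hn]
    exact .cases_nil hS h (by omega)
  | cons a l =>
    rw [C.enc_cons] at hS
    rw [Prog.popSym, ← C.length_code a]
    refine runs_popBits hS ?_
    rw [C.dec_code]
    exact h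

theorem runs_pushSym (r : ι) (a : Γ) (S : Store ι) :
    Runs (.pushSym C r a) S (3 * C.len + 1) (update S r (C.code a ++ S r)) :=
  (runs_pushAll r (C.code a) S).mono (by rw [C.length_code])

theorem runs_peek {r : ι} {k : Γ → Prog ι} {S S' : Store ι} {l : List Γ} {t : ℕ}
    (hS : S r = C.enc l) (hl : l ≠ []) (h : Runs (k l.headI) S t S') :
    Runs (.peek C r k) S (t + (4 * C.len + 2)) S' := by
  refine (runs_popSym C hS (t := t + 3 * C.len + 2) ?_).mono (by omega)
  refine .seq (runs_pushSym C _ _ _) ?_ (t₂ := t) (by omega)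
  obtain ⟨a, l, rfl⟩ := List.exists_cons_of_ne_nil hl
  convert h using 1
  simp only [update_idem, update_self, List.headI, List.tail_cons]
  rw [← C.enc_cons, ← hS, update_eq_self]

/-- The effect of an action on a tape that is given by two lists. -/
def tapeNext (w : Γ) (d : Option Turing.Dir) (A B : List Γ) : List Γ × List Γ :=
  match d with
  | none => (A, w :: B.tail)
  | some .right => (w :: A, B.tail.headI :: B.tail.tail)
  | some .left => (A.tail, A.headI :: w :: B.tail)

/-- Inspecting the scanned symbol pops it and pushes it back, which restores the stack only if the
symbol was really there. Therefore the half-tape with the head is kept nonempty. -/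
theorem tapeNext_ne_nil (w : Γ) (d : Option Turing.Dir) (A B : List Γ) :
    (tapeNext w d A B).2 ≠ [] := by
  rcases d with _ | _ | _ <;> simp [tapeNext]

theorem runs_tapeOp {l r : ι} (hlr : l ≠ r) (w : Γ) (d : Option Turing.Dir) {S : Store ι}
    {A B : List Γ} (hl : S l = C.enc A) (hr : S r = C.enc B) :
    Runs (.tapeOp C l r w d) S (10 * C.len + 10)
      (update (update S l (C.enc (tapeNext w d A B).1)) r (C.enc (tapeNext w d A B).2)) := by
  refine (runs_popSym C hr (t := 9 * C.len + 10) ?_).mono (by omega)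
  rcases d with _ | _ | _
  · refine ((runs_pushSym C _ _ _).mono (by omega)).congr ?_
    simp only [tapeNext, ← hl, update_eq_self, update_self, update_idem, C.enc_cons]
  · refine (runs_popSym C (l := A) (t := 8 * C.len + 10) (by simp [hlr, hl]) ?_).mono (by omega)
    refine (Runs.seq (runs_pushSym C _ _ _) (runs_pushSym C _ _ _) (by omega)).congr ?_
    funext j
    by_cases h1 : j = r
    · subst h1; simp [tapeNext, hlr.symm]
    by_cases h2 : j = l
    · subst h2; simp [tapeNext, hlr]
    simp [h1, h2]
  · refine (Runs.seq (runs_pushSym C _ _ _) (runs_popSym C (l := B.tail) (by simp [hlr.symm])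
      (runs_pushSym C _ _ _)) (by omega)).congr ?_
    funext j
    by_cases h1 : j = r
    · subst h1; simp [tapeNext]
    by_cases h2 : j = l
    · subst h2; simp [tapeNext, hlr, hl]
    simp [h1, h2]

/-- The tape that is given by the list of the symbols to the left of the head, starting with the
nearest, and the list of the remaining symbols. -/
def tapeOf (A B : List Γ) : Turing.Tape Γ :=
  Turing.Tape.mk' (Turing.ListBlank.mk A) (Turing.ListBlank.mk B)

theorem head_tapeOf (A B : List Γ) : (tapeOf A B).head = B.headI := by
  simp [tapeOf]

theorem ListBlank.mk_headI_cons_tail (B : List Γ) :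
    Turing.ListBlank.mk (B.headI :: B.tail) = Turing.ListBlank.mk B := by
  cases B with
  | nil => exact ListBlank.cons_default_nil
  | cons b B => rfl

theorem moveHead_write_tapeOf (w : Γ) (d : Option Turing.Dir) (A : List Γ) {B : List Γ} :
    moveHead d ((tapeOf A B).write w) = tapeOf (tapeNext w d A B).1 (tapeNext w d A B).2 := by
  have h : (tapeOf A B).write w = tapeOf A (w :: B.tail) := by
    rw [tapeOf, ← ListBlank.mk_headI_cons_tail B, ← Turing.ListBlank.cons_mk,
      Turing.Tape.write_mk']
    rfl
  rw [h]
  rcases d with _ | _ | _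
  · rfl
  · simp only [moveHead, tapeNext, tapeOf]
    rw [Turing.Tape.move_left_mk']
    simp
  · simp only [moveHead, tapeNext, tapeOf]
    rw [Turing.Tape.move_right_mk', ListBlank.mk_headI_cons_tail]
    simp

end Sym

/-! ## From machines to programs -/

/-- The stacks for the simulation of a machine with `T` work tapes. -/
abbrev SimReg (T : ℕ) : Type := Fin 6 ⊕ (Fin T ⊕ Fin T)

/-- The contents of the stacks: the input, the two halves of the input tape, the state, the
output, the result, and the halves of the work tapes. -/
def simStore {T : ℕ} (x l r q o z : List Bool) (A B : Fin T → List Bool) : Store (SimReg T) :=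
  Sum.elim ![x, l, r, q, o, z] (Sum.elim A B)

section SimStore

variable {T : ℕ} (x l r q o z v : List Bool) (A B : Fin T → List Bool)

theorem update_simStore_0 : update (simStore x l r q o z A B) (.inl 0) v =
    simStore v l r q o z A B := by
  rw [simStore, Sum.update_elim_inl]
  congr 1
  funext j
  fin_cases j <;> simp

theorem update_simStore_1 : update (simStore x l r q o z A B) (.inl 1) v =
    simStore x v r q o z A B := by
  rw [simStore, Sum.update_elim_inl]
  congr 1
  funext j
  fin_cases j <;> simp

theorem update_simStore_2 : update (simStore x l r q o z A B) (.inl 2) v =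
    simStore x l v q o z A B := by
  rw [simStore, Sum.update_elim_inl]
  congr 1
  funext j
  fin_cases j <;> simp

theorem update_simStore_3 : update (simStore x l r q o z A B) (.inl 3) v =
    simStore x l r v o z A B := by
  rw [simStore, Sum.update_elim_inl]
  congr 1
  funext j
  fin_cases j <;> simp

theorem update_simStore_4 : update (simStore x l r q o z A B) (.inl 4) v =
    simStore x l r q v z A B := by
  rw [simStore, Sum.update_elim_inl]
  congr 1
  funext j
  fin_cases j <;> simp

theorem update_simStore_5 : update (simStore x l r q o z A B) (.inl 5) v =
    simStore x l r q o v A B := by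
  rw [simStore, Sum.update_elim_inl]
  congr 1
  funext j
  fin_cases j <;> simp

theorem update_simStore_left (i : Fin T) :
    update (simStore x l r q o z A B) (.inr (.inl i)) v =
      simStore x l r q o z (update A i v) B := by
  simp only [simStore, Sum.update_elim_inr, Sum.update_elim_inl]

theorem update_simStore_right (i : Fin T) :
    update (simStore x l r q o z A B) (.inr (.inr i)) v =
      simStore x l r q o z A (update B i v) := by
  simp only [simStore, Sum.update_elim_inr]

end SimStore

section Sim

variable (M : Machine) (CQ : Code M.State) (CI : Code (Option Bool)) (CS : Code M.Symbol)

/-- Some action that is allowed in the given situation. -/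
noncomputable def Machine.pick (q : M.State) (a : Option Bool) (g : Fin M.tapes → M.Symbol) :
    Option (MoveData M.State M.Symbol M.tapes) :=
  open Classical in if h : (M.trans q a g).Nonempty then some h.some else none

/-- Inspect the heads of the given tapes. -/
def readHeads : List (Fin M.tapes) → (Fin M.tapes → M.Symbol) →
    ((Fin M.tapes → M.Symbol) → Prog (SimReg M.tapes)) → Prog (SimReg M.tapes)
  | [], g, k => k g
  | i :: l, g, k => .peek CS (.inr (.inr i)) fun a => readHeads l (update g i a) k

/-- Carry out an action. -/
def doMove (a : Option Bool) (m : MoveData M.State M.Symbol M.tapes) : Prog (SimReg M.tapes) :=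
  .seq (.tapeOp CI (.inl 1) (.inl 2) a m.inMove)
    (.seq (.seqList (fun i => .tapeOp CS (.inr (.inl i)) (.inr (.inr i)) (m.write i) (m.move i))
        (List.finRange M.tapes))
      (.seq (match m.out with
          | none => .skip
          | some b => .push (.inl 4) b)
        (.pushSym CQ (.inl 3) m.next)))

instance : Inhabited M.State := ⟨M.start⟩

/-- Simulate one step; `fin` is carried out when the machine halts. -/
noncomputable def simStep (fin : M.State → Prog (SimReg M.tapes)) : Prog (SimReg M.tapes) :=
  .popSym CQ (.inl 3) fun q => .peek CI (.inl 2) fun a =>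
    readHeads M CS (List.finRange M.tapes) default fun g => match M.pick q a g with
      | none => fin q
      | some m => doMove M CQ CI CS a m

variable {M}

theorem det_readHeads (l : List (Fin M.tapes)) (g : Fin M.tapes → M.Symbol)
    {k : (Fin M.tapes → M.Symbol) → Prog (SimReg M.tapes)} (hk : ∀ g, (k g).Det) :
    (readHeads M CS l g k).Det := by
  induction l generalizing g with
  | nil => exact hk _
  | cons i l ih => exact Prog.det_peek _ fun _ => ih _

theorem det_simStep {fin : M.State → Prog (SimReg M.tapes)} (hf : ∀ q, (fin q).Det) :
    (simStep M CQ CI CS fin).Det := by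
  refine Prog.det_popSym _ fun q => Prog.det_peek _ fun a => det_readHeads _ _ _ fun g => ?_
  split
  · exact hf _
  · refine ⟨Prog.det_tapeOp _ _ _ _ _, Prog.det_seqList (fun i => Prog.det_tapeOp _ _ _ _ _) _,
      ?_, Prog.det_pushSym _ _ _⟩
    split <;> trivial

theorem runs_readHeads {k : (Fin M.tapes → M.Symbol) → Prog (SimReg M.tapes)}
    {S S' : Store (SimReg M.tapes)} {B : Fin M.tapes → List M.Symbol}
    (hB : ∀ i, B i ≠ []) (hS : ∀ i, S (.inr (.inr i)) = CS.enc (B i)) {t : ℕ}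
    (l : List (Fin M.tapes)) (g : Fin M.tapes → M.Symbol)
    (h : Runs (k fun i => if i ∈ l then (B i).headI else g i) S t S') :
    Runs (readHeads M CS l g k) S (t + l.length * (4 * CS.len + 2)) S' := by
  induction l generalizing g with
  | nil => exact (show Runs (k g) S t S' by simpa using h).mono (by simp)
  | cons i l ih =>
    refine (runs_peek CS (hS i) (hB i) (ih (update g i (B i).headI) ?_)).mono (le_of_eq ?_)
    · convert h using 2
      funext j
      by_cases hj : j ∈ l
      · simp [hj]
      · by_cases hji : j = i
        · subst hji; simp [hj]
        · simp [hj, hji]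
    · rw [List.length_cons]; ring

/-- The stacks represent the configuration. -/
def Represents (c : M.Cfg) (q z : List Bool) (S : Store (SimReg M.tapes)) : Prop :=
  ∃ (A B : List (Option Bool)) (As Bs : Fin M.tapes → List M.Symbol), B ≠ [] ∧
    (∀ i, Bs i ≠ []) ∧ c.input = tapeOf A B ∧ (∀ i, c.work i = tapeOf (As i) (Bs i)) ∧
    S = simStore [] (CI.enc A) (CI.enc B) q c.output.reverse z
      (fun i => CS.enc (As i)) (fun i => CS.enc (Bs i))

/-- The constant `K` depends on the machine alone, not on the configuration: one machine step costs
boundedly many program steps. Hence the simulation preserves linear time. -/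
theorem exists_runs_simStep (hM : M.Deterministic) (fin : M.State → Prog (SimReg M.tapes)) :
    ∃ K, ∀ (c d : M.Cfg) (S : Store (SimReg M.tapes)) (z : List Bool),
      Represents CI CS c (CQ.code c.state) z S → M.Step c d →
      ∃ S', Represents CI CS d (CQ.code d.state) z S' ∧
        Runs (simStep M CQ CI CS fin) S K S' := by
  refine ⟨(10 * CI.len + 10) + (((10 * CS.len + 10) + 1) * M.tapes + 1) + 2 +
    (3 * CQ.len + 1) + 3 + M.tapes * (4 * CS.len + 2) + (4 * CI.len + 2) + CQ.len, ?_⟩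
  rintro c d S z ⟨A, B, As, Bs, hB, hBs, hin, hwork, rfl⟩ ⟨m, hm, rfl⟩
  have hpick : M.pick c.state B.headI (fun i => (Bs i).headI) = some m := by
    have hm' : m ∈ M.trans c.state B.headI (fun i => (Bs i).headI) := by
      have := hm
      rw [Machine.actions, hin, head_tapeOf] at this
      simpa only [hwork, head_tapeOf] using this
    have hne : (M.trans c.state B.headI (fun i => (Bs i).headI)).Nonempty := ⟨m, hm'⟩
    rw [Machine.pick, dif_pos hne]
    exact congrArg some (hM _ _ _ hne.some_mem hm')
  refine ⟨_, ⟨(tapeNext B.headI m.inMove A B).1, (tapeNext B.headI m.inMove A B).2,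
    fun i => (tapeNext (m.write i) (m.move i) (As i) (Bs i)).1,
    fun i => (tapeNext (m.write i) (m.move i) (As i) (Bs i)).2, tapeNext_ne_nil _ _ _ _,
    fun i => tapeNext_ne_nil _ _ _ _, ?_, ?_, rfl⟩, ?_⟩
  · rw [← moveHead_write_tapeOf, ← hin]
    have : c.input.write B.headI = c.input := by
      rw [hin, ← head_tapeOf A B]
      exact Turing.Tape.write_self _
    rw [this]
    rfl
  · intro i
    rw [← moveHead_write_tapeOf, ← hwork]
    rfl
  refine runs_popSym CQ (l := [c.state])
    (by rw [CQ.enc_cons, CQ.enc_nil, List.append_nil]; rfl) ?_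
  refine runs_peek CI (l := B) rfl hB ?_
  have := (runs_readHeads (CS := CS) (B := Bs) hBs (S := update (simStore [] (CI.enc A) (CI.enc B)
      (CQ.code c.state) c.output.reverse z (fun i => CS.enc (As i)) (fun i => CS.enc (Bs i)))
      (.inl 3) (CQ.enc [c.state].tail)) (fun i => rfl) (List.finRange M.tapes)
      default (k := fun g => match M.pick c.state B.headI g with
      | none => fin c.state
      | some m => doMove M CQ CI CS B.headI m) (t := (10 * CI.len + 10) +
        (((10 * CS.len + 10) + 1) * M.tapes + 1) + 2 + (3 * CQ.len + 1) + 3)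
      (S' := simStore [] (CI.enc (tapeNext B.headI m.inMove A B).1)
        (CI.enc (tapeNext B.headI m.inMove A B).2) (CQ.code m.next)
        (c.output ++ m.out.toList).reverse z
        (fun i => CS.enc (tapeNext (m.write i) (m.move i) (As i) (Bs i)).1)
        (fun i => CS.enc (tapeNext (m.write i) (m.move i) (As i) (Bs i)).2)) ?_)
  · rw [List.length_finRange] at this
    exact this
  simp only [List.mem_finRange, if_true, hpick]
  rw [update_simStore_3, List.tail_cons, CQ.enc_nil]
  have h₁ := runs_tapeOp CI (l := (.inl 1 : SimReg M.tapes)) (r := .inl 2) (by simp) B.headI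
    m.inMove (A := A) (B := B) (S := simStore [] (CI.enc A) (CI.enc B) [] c.output.reverse z
      (fun i => CS.enc (As i)) (fun i => CS.enc (Bs i))) rfl rfl
  rw [update_simStore_1, update_simStore_2] at h₁
  set A' := CI.enc (tapeNext B.headI m.inMove A B).1
  set B' := CI.enc (tapeNext B.headI m.inMove A B).2
  -- Tapes whose number is still in `l` have their old contents, the others the new ones.
  have h₂ := runs_seqList (p := fun i => Prog.tapeOp CS (.inr (.inl i) : SimReg M.tapes)
      (.inr (.inr i)) (m.write i) (m.move i)) (k := 10 * CS.len + 10)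
    (fun l => simStore [] A' B' [] c.output.reverse z
      (fun i => CS.enc (if i ∈ l then As i else
        (tapeNext (m.write i) (m.move i) (As i) (Bs i)).1))
      (fun i => CS.enc (if i ∈ l then Bs i else
        (tapeNext (m.write i) (m.move i) (As i) (Bs i)).2))) (List.finRange M.tapes) (by
      intro i l hl
      have hi : i ∉ l :=
        (List.nodup_cons.1 (List.Nodup.sublist hl.sublist (List.nodup_finRange _))).1
      refine (runs_tapeOp CS (Sum.inr_injective.ne Sum.inl_ne_inr) _ _ (A := As i) (B := Bs i)
        (congrArg CS.enc (if_pos (List.mem_cons_self (a := i) (l := l))))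
        (congrArg CS.enc (if_pos (List.mem_cons_self (a := i) (l := l))))).congr ?_
      rw [update_simStore_left, update_simStore_right]
      congr 1
      · funext j
        by_cases hj : j = i
        · subst hj; simp [hi]
        · simp [hj]
      · funext j
        by_cases hj : j = i
        · subst hj; simp [hi]
        · simp [hj])
  simp only [List.mem_finRange, if_true, List.not_mem_nil, if_false, List.length_finRange] at h₂
  refine (Runs.seq h₁ (.seq h₂ (.seq (s' := simStore [] A' B' [] (c.output ++ m.out.toList).reverse z
    (fun i => CS.enc (tapeNext (m.write i) (m.move i) (As i) (Bs i)).1)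
    (fun i => CS.enc (tapeNext (m.write i) (m.move i) (As i) (Bs i)).2)) (t₁ := 2) ?_
    (runs_pushSym CQ _ _ _) le_rfl) le_rfl) (by omega)).congr ?_
  · cases m.out with
    | none => exact (Runs.skip (by omega)).congr (by simp)
    | some b =>
      refine (Runs.push le_rfl).congr ?_
      rw [update_simStore_4]
      change simStore [] A' B' [] (b :: c.output.reverse) z _ _ = _
      rw [Option.toList_some, List.reverse_append]
      rfl
  · rw [update_simStore_3]
    change simStore [] A' B' (CQ.code m.next ++ []) _ _ _ _ = _
    rw [List.append_nil]

variable {CQ CI CS} {fin : M.State → Prog (SimReg M.tapes)} {zf : M.State → List Bool}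

/-- The program `fin` writes the string that `zf` assigns to the state. -/
def Finishes (fin : M.State → Prog (SimReg M.tapes)) (zf : M.State → List Bool) : Prop :=
  ∀ q l r o A B, Runs (fin q) (simStore [] l r [] o [] A B) 2 (simStore [] l r [] o (zf q) A B)

/-- Popping the state without pushing a successor leaves the state stack empty, and this terminates
the simulation loop. -/
theorem runs_simStep_halted (hfin : Finishes fin zf) {d : M.Cfg} {S : Store (SimReg M.tapes)}
    (hS : Represents CI CS d (CQ.code d.state) [] S) (hd : M.Halted d) :
    ∃ S', Represents CI CS d [] (zf d.state) S' ∧ Runs (simStep M CQ CI CS fin) S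
      (2 + M.tapes * (4 * CS.len + 2) + (4 * CI.len + 2) + CQ.len) S' := by
  obtain ⟨A, B, As, Bs, hB, hBs, hin, hwork, rfl⟩ := hS
  have hpick : M.pick d.state B.headI (fun i => (Bs i).headI) = none := by
    rw [Machine.pick, dif_neg]
    intro hne
    rw [Machine.Halted, Machine.actions, hin, head_tapeOf] at hd
    simp only [hwork, head_tapeOf] at hd
    rw [hd] at hne
    simp at hne
  refine ⟨_, ⟨A, B, As, Bs, hB, hBs, hin, hwork, rfl⟩, ?_⟩
  refine runs_popSym CQ (l := [d.state])
    (by rw [CQ.enc_cons, CQ.enc_nil, List.append_nil]; rfl) ?_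
  refine runs_peek CI (l := B) rfl hB ?_
  have := (runs_readHeads (CS := CS) (B := Bs) hBs (S := update (simStore [] (CI.enc A) (CI.enc B)
      (CQ.code d.state) d.output.reverse [] (fun i => CS.enc (As i)) (fun i => CS.enc (Bs i)))
      (.inl 3) (CQ.enc [d.state].tail)) (fun i => rfl) (List.finRange M.tapes)
      default (k := fun g => match M.pick d.state B.headI g with
      | none => fin d.state
      | some m => doMove M CQ CI CS B.headI m) (t := 2)
      (S' := simStore [] (CI.enc A) (CI.enc B) [] d.output.reverse (zf d.state)
        (fun i => CS.enc (As i)) (fun i => CS.enc (Bs i))) ?_)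
  · rw [List.length_finRange] at this
    exact this
  simp only [List.mem_finRange, if_true, hpick]
  rw [update_simStore_3, List.tail_cons, CQ.enc_nil]
  exact hfin _ _ _ _ _ _

theorem exists_runs_simLoop (hM : M.Deterministic) (hfin : Finishes fin zf) :
    ∃ K, ∀ (n : ℕ) (c d : M.Cfg) (S : Store (SimReg M.tapes)),
      Represents CI CS c (CQ.code c.state) [] S → M.Reaches n c d → M.Halted d →
      ∃ S', Represents CI CS d [] (zf d.state) S' ∧
        Runs (.loop (.inl 3) (simStep M CQ CI CS fin)) S (K * (n + 1)) S' := by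
  obtain ⟨K, hK⟩ := exists_runs_simStep CQ CI CS hM fin
  have hne : ∀ (c : M.Cfg) (S : Store (SimReg M.tapes)),
      Represents CI CS c (CQ.code c.state) [] S → S (.inl 3) ≠ [] := by
    rintro c S ⟨A, B, As, Bs, -, -, -, -, rfl⟩ h
    have h' : CQ.code c.state = [] := h
    have := CQ.length_code c.state
    rw [h', List.length_nil] at this
    exact CQ.len_pos.ne this
  refine ⟨K + (2 + M.tapes * (4 * CS.len + 2) + (4 * CI.len + 2) + CQ.len) + 2, ?_⟩
  intro n
  induction n with
  | zero =>
    intro c d S hS hn hd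
    obtain rfl : c = d := hn
    obtain ⟨S', hS', h⟩ := runs_simStep_halted hfin hS hd
    refine ⟨S', hS', .loop_cons (hne c S hS) h (.loop_nil ?_ le_rfl) (by omega)⟩
    obtain ⟨A, B, As, Bs, -, -, -, -, rfl⟩ := hS'
    rfl
  | succ n ih =>
    rintro c d S hS ⟨e, he, hn⟩ hd
    obtain ⟨S₁, hS₁, h₁⟩ := hK c e S [] hS he
    obtain ⟨S', hS', h⟩ := ih e d S₁ hS₁ hn hd
    refine ⟨S', hS', .loop_cons (hne c S hS) h₁ h ?_⟩
    rw [Nat.mul_add _ (n + 1) 1]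
    omega

/-- Load the tapes. -/
def simInit (M : Machine) (CQ : Code M.State) (CI : Code (Option Bool)) (CS : Code M.Symbol) :
    Prog (SimReg M.tapes) :=
  .seq (.mv (.inl 0) (.inl 5)) (.seq (.pushSym CI (.inl 2) none)
    (.seq (.forEach (.inl 5) fun b => .pushSym CI (.inl 2) (some b))
    (.seq (.seqList (fun i => .pushSym CS (.inr (.inr i)) default) (List.finRange M.tapes))
      (.pushSym CQ (.inl 3) M.start))))

theorem ListBlank.mk_append_default {Γ : Type} [Inhabited Γ] (l : List Γ) :
    Turing.ListBlank.mk (l ++ [default]) = Turing.ListBlank.mk l := by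
  induction l with
  | nil => exact ListBlank.cons_default_nil
  | cons a l ih => rw [List.cons_append, ← Turing.ListBlank.cons_mk, ih, Turing.ListBlank.cons_mk]

theorem runs_simInit (x : List Bool) :
    ∃ S, Represents CI CS (M.init x) (CQ.code M.start) [] S ∧
      Runs (simInit M CQ CI CS) (single (.inl 0) x)
        ((4 * x.length + 1) + (3 * CI.len + 1) + ((3 * CI.len + 1 + 2) * x.length + 1) +
          ((3 * CS.len + 1 + 1) * M.tapes + 1) + (3 * CQ.len + 1) + 4) S := by
  -- A blank is placed after the input, and one on each work tape, to make the right halves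
  -- nonempty.
  refine ⟨_, ⟨[], x.map some ++ [none], fun _ => [], fun _ => [default], by simp, by simp, ?_,
    fun i => ?_, rfl⟩, ?_⟩
  · rw [tapeOf]
    exact (congrArg (Turing.Tape.mk' _) (ListBlank.mk_append_default (x.map some)).symm)
  · exact (congrArg (Turing.Tape.mk' _) ListBlank.cons_default_nil.symm)
  have h₀ : (single (.inl 0) x : Store (SimReg M.tapes)) =
      simStore x [] [] [] [] [] (fun _ => []) (fun _ => []) := by
    rw [← update_simStore_0 []]
    funext j
    rcases j with j | j | j
    · fin_cases j <;> rfl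
    · rfl
    · rfl
  rw [h₀]
  have h₁ := runs_mv (a := (.inl 0 : SimReg M.tapes)) (b := .inl 5) (by simp)
    (simStore x [] [] [] [] [] (fun _ => []) (fun _ => []))
  rw [update_simStore_0, update_simStore_5] at h₁
  have e₁ : (simStore x [] [] [] [] [] (fun _ => []) (fun _ => []) : Store (SimReg M.tapes))
    (.inl 0) = x := rfl
  have e₂ : (simStore x [] [] [] [] [] (fun _ => []) (fun _ => []) : Store (SimReg M.tapes))
    (.inl 5) = [] := rfl
  rw [e₁, e₂, List.append_nil] at h₁
  have h₂ := runs_pushSym CI (.inl 2 : SimReg M.tapes) none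
    (simStore [] [] [] [] [] x.reverse (fun _ => []) (fun _ => []))
  rw [update_simStore_2] at h₂
  have e₃ : CI.code none ++ (simStore [] [] [] [] [] x.reverse (fun _ => []) (fun _ => []) :
    Store (SimReg M.tapes)) (.inl 2) = CI.enc [none] := by
    rw [CI.enc_cons]; rfl
  rw [e₃] at h₂
  have h₃ := runs_forEach (a := (.inl 5 : SimReg M.tapes))
    (p := fun b => .pushSym CI (.inl 2) (some b)) (k := 3 * CI.len + 1)
    (fun l acc => simStore [] [] (CI.enc acc) [] [] l (fun _ => []) (fun _ => []))
    (fun acc b => some b :: acc) (fun _ _ => rfl) (by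
      intro b l acc
      refine (runs_pushSym _ _ _ _).congr ?_
      rw [update_simStore_5, update_simStore_2, CI.enc_cons]
      rfl) x.reverse [none]
  have e₄ : ∀ (l : List Bool) (m : List (Option Bool)),
      l.foldl (fun acc b => some b :: acc) m = l.reverse.map some ++ m := by
    intro l
    induction l with
    | nil => intro m; rfl
    | cons a l ih => intro m; simp [ih]
  rw [e₄, List.reverse_reverse, List.length_reverse] at h₃
  have h₄ := runs_seqList (p := fun i => .pushSym CS (.inr (.inr i)) default)
    (fun l => simStore [] [] (CI.enc (x.map some ++ [none])) [] [] [] (fun _ => [])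
      fun i => if i ∈ l then [] else CS.enc [default]) (List.finRange M.tapes)
    (k := 3 * CS.len + 1) (by
      intro i l hl
      have hi : i ∉ l :=
        (List.nodup_cons.1 (List.Nodup.sublist hl.sublist (List.nodup_finRange _))).1
      refine (runs_pushSym _ _ _ _).congr ?_
      rw [update_simStore_right]
      congr 1
      funext j
      by_cases hj : j = i
      · subst hj; simp [hi, simStore]
      · simp [hj])
  simp only [List.mem_finRange, if_true, List.not_mem_nil, if_false, List.length_finRange] at h₄
  refine (Runs.seq h₁ (.seq h₂ (.seq h₃ (.seq h₄ (runs_pushSym _ _ _ _) le_rfl) le_rfl) le_rfl)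
    (by omega)).congr ?_
  rw [update_simStore_3]
  change simStore _ _ _ (CQ.code M.start ++ []) _ _ _ _ = _
  rw [List.append_nil]
  rfl

/-- Empty the stacks that represent the tapes. -/
def simClear (T : ℕ) : Prog (SimReg T) :=
  .seq (.clear (.inl 1)) (.seq (.clear (.inl 2))
    (.seq (.seqList (fun i => .clear (.inr (.inl i))) (List.finRange T))
      (.seqList (fun i => .clear (.inr (.inr i))) (List.finRange T))))

theorem runs_simClear {T N : ℕ} {l r o z : List Bool} {A B : Fin T → List Bool}
    (hl : l.length ≤ N) (hr : r.length ≤ N) (hA : ∀ i, (A i).length ≤ N)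
    (hB : ∀ i, (B i).length ≤ N) :
    Runs (simClear T) (simStore [] l r [] o z A B)
      ((3 * N + 1) + (3 * N + 1) + (((3 * N + 1) + 1) * T + 1) + (((3 * N + 1) + 1) * T + 1) + 3)
      (simStore [] [] [] [] o z (fun _ => []) (fun _ => [])) := by
  have h₁ := runs_clear (a := (.inl 1 : SimReg T)) (simStore [] l r [] o z A B)
  rw [update_simStore_1] at h₁
  have h₂ := runs_clear (a := (.inl 2 : SimReg T)) (simStore [] [] r [] o z A B)
  rw [update_simStore_2] at h₂
  have h₃ := runs_seqList (p := fun i => .clear (.inr (.inl i)))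
    (fun l => simStore [] [] [] [] o z (fun i => if i ∈ l then A i else []) B)
    (List.finRange T) (k := 3 * N + 1) (by
      intro i l hl
      have hi : i ∉ l :=
        (List.nodup_cons.1 (List.Nodup.sublist hl.sublist (List.nodup_finRange _))).1
      refine ((runs_clear _).mono ?_).congr ?_
      · have := hA i
        simp only [simStore, Sum.elim_inr, Sum.elim_inl, List.mem_cons_self, if_true]
        omega
      · rw [update_simStore_left]
        congr 1
        funext j
        by_cases hj : j = i
        · subst hj; simp [hi]
        · simp [hj])
  have h₄ := runs_seqList (p := fun i => .clear (.inr (.inr i)))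
    (fun l => simStore [] [] [] [] o z (fun _ => []) (fun i => if i ∈ l then B i else []))
    (List.finRange T) (k := 3 * N + 1) (by
      intro i l hl
      have hi : i ∉ l :=
        (List.nodup_cons.1 (List.Nodup.sublist hl.sublist (List.nodup_finRange _))).1
      refine ((runs_clear _).mono ?_).congr ?_
      · have := hB i
        simp only [simStore, Sum.elim_inr, List.mem_cons_self, if_true]
        omega
      · rw [update_simStore_right]
        congr 1
        funext j
        by_cases hj : j = i
        · subst hj; simp [hi]
        · simp [hj])
  simp only [List.mem_finRange, if_true, List.not_mem_nil, if_false, List.length_finRange]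
    at h₃ h₄
  refine .seq (h₁.mono (t' := 3 * N + 1) ?_) (.seq (h₂.mono (t' := 3 * N + 1) ?_)
    (.seq h₃ h₄ le_rfl) le_rfl) (by omega)
  · change 3 * l.length + 1 ≤ _; omega
  · change 3 * r.length + 1 ≤ _; omega

/-- Besides simulating, the program must leave all stacks but the output empty, so that it can be
composed. By `Runs.length_le` the stacks are at most linear in the time spent so far, so clearing
them costs only another constant factor. -/
theorem exists_runs_sim (hM : M.Deterministic) (hfin : Finishes fin zf)
    {last : Prog (SimReg M.tapes)} {res : M.State → List Bool → List Bool}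
    (hlast : ∀ q o, Runs last (simStore [] [] [] [] o (zf q) (fun _ => []) (fun _ => []))
      (4 * o.length + 10) (single (.inl 5) (res q o.reverse))) :
    ∃ K, ∀ (x : List Bool) (n : ℕ) (d : M.Cfg), M.Reaches n (M.init x) d → M.Halted d →
      Runs (.seq (simInit M CQ CI CS) (.seq (.loop (.inl 3) (simStep M CQ CI CS fin))
        (.seq (simClear M.tapes) last))) (single (.inl 0) x) (K * (n + x.length + 1))
        (single (.inl 5) (res d.state d.output)) := by
  obtain ⟨K, hK⟩ := exists_runs_simLoop (CQ := CQ) (CI := CI) (CS := CS) hM hfin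
  obtain ⟨k, hk⟩ : ∃ k, k = K + (4 + 1 + (3 * CI.len + 1) + (3 * CI.len + 3) + 1 +
      ((3 * CS.len + 1 + 1) * M.tapes + 1) + (3 * CQ.len + 1) + 4) + 1 := ⟨_, rfl⟩
  refine ⟨k + (3 * (k + 1) + 1 + (3 * (k + 1) + 1) + ((3 * (k + 1) + 2) * M.tapes + 1) +
    ((3 * (k + 1) + 2) * M.tapes + 1) + 3) + (4 * (k + 1) + 10) + 3, fun x n d hn hd => ?_⟩
  obtain ⟨S₀, hS₀, h₀⟩ := runs_simInit (M := M) (CQ := CQ) (CI := CI) (CS := CS) x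
  obtain ⟨S₁, hS₁, h₁⟩ := hK n _ d S₀ hS₀ hn hd
  -- All costs are compared with `N`, which also dominates 1 and thereby the additive constants.
  obtain ⟨N, hN⟩ : ∃ N, N = n + x.length + 1 := ⟨_, rfl⟩
  have h₆ : ((4 * x.length + 1) + (3 * CI.len + 1) + ((3 * CI.len + 1 + 2) * x.length + 1) +
      ((3 * CS.len + 1 + 1) * M.tapes + 1) + (3 * CQ.len + 1) + 4) + K * (n + 1) + 1 ≤ k * N := by
    have i₁ : K * (n + 1) ≤ K * N := Nat.mul_le_mul_left _ (by omega)
    have i₂ : (3 * CI.len + 1 + 2) * x.length ≤ (3 * CI.len + 3) * N :=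
      Nat.mul_le_mul le_rfl (by omega)
    have i₃ : ((3 * CI.len + 1) + ((3 * CS.len + 1 + 1) * M.tapes + 1) + (3 * CQ.len + 1)) * 1 ≤
        ((3 * CI.len + 1) + ((3 * CS.len + 1 + 1) * M.tapes + 1) + (3 * CQ.len + 1)) * N :=
      Nat.mul_le_mul_left _ (by omega)
    rw [hk]
    nlinarith
  have h₂ : Runs (.seq (simInit M CQ CI CS) (.loop (.inl 3) (simStep M CQ CI CS fin)))
      (single (.inl 0) x) (k * N) S₁ := .seq h₀ h₁ h₆
  have hlen := h₂.length_le
  have hx : ∀ r, ((single (.inl 0) x : Store (SimReg M.tapes)) r).length ≤ N := by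
    intro r
    by_cases hr : r = .inl 0
    · subst hr; simp [single]; omega
    · simp [single, hr]
  have hlen' : ∀ r, (S₁ r).length ≤ (k + 1) * N := fun r => by
    have := hlen r
    have := hx r
    rw [add_mul]
    omega
  obtain ⟨A, B, As, Bs, -, -, -, -, rfl⟩ := hS₁
  have h₃ := runs_simClear (z := zf d.state) (o := d.output.reverse) (hlen' (.inl 1))
    (hlen' (.inl 2)) (fun i => hlen' (.inr (.inl i))) (fun i => hlen' (.inr (.inr i)))
  have h₄ := hlast d.state d.output.reverse
  rw [List.reverse_reverse] at h₄
  have h₅ : d.output.reverse.length ≤ (k + 1) * N := hlen' (.inl 4)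
  refine .seq h₀ (.seq h₁ (.seq h₃ h₄ le_rfl) le_rfl) ?_
  have i₁ : M.tapes * 1 ≤ M.tapes * N := Nat.mul_le_mul_left _ (by omega)
  have i₂ : 1 ≤ N := by omega
  rw [← hN]
  have e₁ : (3 * ((k + 1) * N) + 1 + 1) * M.tapes =
    3 * ((k + 1) * N * M.tapes) + 2 * (M.tapes * 1) := by ring
  have e₂ : (k + (3 * (k + 1) + 1 + (3 * (k + 1) + 1) + ((3 * (k + 1) + 2) * M.tapes + 1) +
      ((3 * (k + 1) + 2) * M.tapes + 1) + 3) + (4 * (k + 1) + 10) + 3) * N =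
      k * N + 10 * ((k + 1) * N) + 6 * ((k + 1) * N * M.tapes) + 4 * (M.tapes * N) + 20 * N := by
    ring
  rw [e₁, e₂]
  omega

end Sim

theorem simDet {M : Machine} {CQ : Code M.State} {CI : Code (Option Bool)} {CS : Code M.Symbol}
    {fin : M.State → Prog (SimReg M.tapes)} {last : Prog (SimReg M.tapes)}
    (hf : ∀ q, (fin q).Det) (hl : last.Det) :
    (Prog.seq (simInit M CQ CI CS) (.seq (.loop (.inl 3) (simStep M CQ CI CS fin))
      (.seq (simClear M.tapes) last))).Det := by
  refine ⟨⟨Prog.det_mv _ _, Prog.det_pushSym _ _ _, ?_, ?_, Prog.det_pushSym _ _ _⟩,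
    det_simStep _ _ _ hf, ⟨Prog.det_clear _, Prog.det_clear _, ?_, ?_⟩, hl⟩
  · exact Prog.det_forEach.2 fun _ => Prog.det_pushSym _ _ _
  · exact Prog.det_seqList (fun _ => Prog.det_pushSym _ _ _) _
  · exact Prog.det_seqList (fun _ => Prog.det_clear _) _
  · exact Prog.det_seqList (fun _ => Prog.det_clear _) _

theorem simStore_single {T : ℕ} (z : List Bool) :
    (simStore [] [] [] [] [] z (fun _ => []) (fun _ => []) : Store (SimReg T)) =
      single (.inl 5) z := by
  rw [← update_simStore_5 [] [] [] [] [] []]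
  congr 1
  funext j
  rcases j with j | j | j
  · fin_cases j <;> rfl
  · rfl
  · rfl

/-- A deterministic machine can be simulated by a program that computes the output. -/
theorem exists_prog_output {M : Machine} (hM : M.Deterministic) :
    ∃ (p : Prog (SimReg M.tapes)) (K : ℕ), p.Det ∧ ∀ (x : List Bool) (n : ℕ) (d : M.Cfg),
      M.Reaches n (M.init x) d → M.Halted d →
        Runs p (single (.inl 0) x) (K * (n + x.length + 1)) (single (.inl 5) d.output) := by
  obtain ⟨CQ⟩ := exists_code M.State
  obtain ⟨CI⟩ := exists_code (Option Bool)
  obtain ⟨CS⟩ := exists_code M.Symbol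
  obtain ⟨K, hK⟩ := exists_runs_sim (CQ := CQ) (CI := CI) (CS := CS) hM
    (fin := fun _ => .skip) (zf := fun _ => []) (res := fun _ o => o)
    (last := .mv (.inl 4) (.inl 5)) (fun q l r o A B => .skip (by omega)) (by
      intro q o
      have := runs_mv (a := (.inl 4 : SimReg M.tapes)) (b := .inl 5) (by simp)
        (simStore [] [] [] [] o [] (fun _ => []) (fun _ => []))
      rw [update_simStore_4, update_simStore_5] at this
      refine (this.mono ?_).congr ?_
      · change 4 * o.length + 1 ≤ _; omega
      · change simStore [] [] [] [] [] (o.reverse ++ []) _ _ = _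
        rw [List.append_nil, simStore_single])
  exact ⟨_, K, simDet (fin := fun _ => .skip) (fun _ => trivial) (Prog.det_mv _ _), hK⟩

open Classical in
/-- A deterministic machine can be simulated by a program that computes the answer. -/
theorem exists_prog_accept {M : Machine} (hM : M.Deterministic) :
    ∃ (p : Prog (SimReg M.tapes)) (K : ℕ), p.Det ∧ ∀ (x : List Bool) (n : ℕ) (d : M.Cfg),
      M.Reaches n (M.init x) d → M.Halted d →
        Runs p (single (.inl 0) x) (K * (n + x.length + 1))
          (single (.inl 5) (if d.state ∈ M.accepting then [true] else [])) := by
  obtain ⟨CQ⟩ := exists_code M.State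
  obtain ⟨CI⟩ := exists_code (Option Bool)
  obtain ⟨CS⟩ := exists_code M.Symbol
  obtain ⟨K, hK⟩ := exists_runs_sim (CQ := CQ) (CI := CI) (CS := CS) hM
    (fin := fun q => if q ∈ M.accepting then .push (.inl 5) true else .skip)
    (zf := fun q => if q ∈ M.accepting then [true] else [])
    (res := fun q o => if q ∈ M.accepting then [true] else [])
    (last := .clear (.inl 4)) (by
      intro q l r o A B
      by_cases hq : q ∈ M.accepting
      · simp only [hq, if_true]
        refine (Runs.push le_rfl).congr ?_
        rw [update_simStore_5]
        rfl
      · simp only [hq, if_false]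
        exact .skip (by omega)) (by
      intro q o
      have := runs_clear (a := (.inl 4 : SimReg M.tapes))
        (simStore [] [] [] [] o (if q ∈ M.accepting then [true] else []) (fun _ => [])
          (fun _ => []))
      rw [update_simStore_4, simStore_single] at this
      refine this.mono ?_
      change 3 * o.length + 1 ≤ _; omega)
  refine ⟨_, K, simDet (fun q => ?_) (Prog.det_clear _), hK⟩
  split <;> trivial

/-! ## Classes of bounds -/

/-- Linear bounds. -/
def LinB (t : ℕ → ℕ) : Prop := ∃ c, ∀ n, t n ≤ c * n + c

/-- Polynomial bounds. -/
def PolyB (t : ℕ → ℕ) : Prop := ∃ c, ∀ n, t n ≤ (n + 2) ^ c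

/-- Classes of bounds that are good for the composition of functions. -/
class Growth (B : (ℕ → ℕ) → Prop) : Prop where
  le : ∀ {s t}, B t → (∀ n, s n ≤ t n) → B s
  lin : ∀ c, B fun n => c * n + c
  add : ∀ {s t}, B s → B t → B fun n => s n + t n
  comp : ∀ {s t}, B s → B t → B fun n => s (t n)
  mono : ∀ {t}, B t → ∃ t', B t' ∧ Monotone t' ∧ ∀ n, t n ≤ t' n

instance : Growth LinB where
  le := fun ⟨c, h⟩ hs => ⟨c, fun n => (hs n).trans (h n)⟩
  lin c := ⟨c, fun _ => le_rfl⟩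
  add := fun ⟨c, h⟩ ⟨c', h'⟩ => ⟨c + c', fun n => by
    have := h n
    have := h' n
    beta_reduce
    rw [add_mul]
    omega⟩
  comp := fun {s t} ⟨c, h⟩ ⟨c', h'⟩ => ⟨c * c' + c, fun n => by
    refine (h _).trans ?_
    have := Nat.mul_le_mul_left c (h' n)
    nlinarith⟩
  mono := fun ⟨c, h⟩ => ⟨fun n => c * n + c, ⟨c, fun _ => le_rfl⟩,
    fun a b hab => Nat.add_le_add_right (Nat.mul_le_mul_left _ hab) _, h⟩

theorem PolyB.mul {s t : ℕ → ℕ} (hs : PolyB s) (ht : PolyB t) : PolyB fun n => s n * t n := by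
  obtain ⟨a, ha⟩ := hs
  obtain ⟨b, hb⟩ := ht
  refine ⟨a + b, fun n => ?_⟩
  rw [pow_add]
  exact Nat.mul_le_mul (ha n) (hb n)

instance : Growth PolyB where
  le := fun ⟨c, h⟩ hs => ⟨c, fun n => (hs n).trans (h n)⟩
  lin c := ⟨c + 1, fun n => by
    have h₁ : c ≤ (n + 2) ^ c :=
      (Nat.lt_two_pow_self).le.trans (Nat.pow_le_pow_left (by omega) _)
    rw [pow_succ]
    nlinarith⟩
  add := fun {s t} ⟨a, h⟩ ⟨b, h'⟩ => ⟨max a b + 1, fun n => by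
    have h₁ : (n + 2) ^ a ≤ (n + 2) ^ max a b := Nat.pow_le_pow_right (by omega) (le_max_left _ _)
    have h₂ : (n + 2) ^ b ≤ (n + 2) ^ max a b := Nat.pow_le_pow_right (by omega) (le_max_right _ _)
    have := h n
    have := h' n
    rw [pow_succ]
    nlinarith⟩
  -- The exponent comes from `(n + 2) ^ b + 2 ≤ (n + 2) ^ (b + 2)`.
  comp := fun {s t} ⟨a, h⟩ ⟨b, h'⟩ => ⟨(b + 2) * a, fun n => by
    refine (h _).trans ?_
    rw [pow_mul]
    refine Nat.pow_le_pow_left ?_ _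
    have := h' n
    have : 1 ≤ (n + 2) ^ b := Nat.one_le_pow _ _ (by omega)
    have h₂ : (n + 2) ^ b * (n + 2) ^ 2 = (n + 2) ^ b * (n * n + 4 * n) + 4 * (n + 2) ^ b := by
      ring
    rw [pow_add, h₂]
    omega⟩
  mono := fun ⟨c, h⟩ => ⟨fun n => (n + 2) ^ c, ⟨c, fun _ => le_rfl⟩,
    fun a b hab => Nat.pow_le_pow_left (by omega) _, h⟩

/-! ## Computable functions -/

variable {B : (ℕ → ℕ) → Prop}

/-- The function is computed on the strings in `D` by a program whose running time has a bound
in `B`. -/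
def ComputOn (B : (ℕ → ℕ) → Prop) (D : Set (List Bool)) (f : List Bool → List Bool) : Prop :=
  ∃ (ι : Type) (_ : Finite ι) (_ : DecidableEq ι) (i o : ι) (p : Prog ι) (t : ℕ → ℕ),
    p.Det ∧ B t ∧ ∀ x ∈ D, Runs p (single i x) (t x.length) (single o (f x))

/-- The function is computed by a program whose running time has a bound in `B`. -/
def Comput (B : (ℕ → ℕ) → Prop) (f : List Bool → List Bool) : Prop := ComputOn B Set.univ f

/-- The function of two strings is computed by a program whose running time has a bound in `B`,
in terms of the sum of the lengths. -/
def Comput₂ (B : (ℕ → ℕ) → Prop) (f : List Bool → List Bool → List Bool) : Prop :=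
  ∃ (ι : Type) (_ : Finite ι) (_ : DecidableEq ι) (i j o : ι) (p : Prog ι) (t : ℕ → ℕ),
    p.Det ∧ i ≠ j ∧ B t ∧ ∀ a b, Runs p (update (single i a) j b) (t (a.length + b.length))
      (single o (f a b))

theorem Runs.embed {ι κ : Type} [DecidableEq ι] [DecidableEq κ] {σ : ι → κ}
    (hσ : Injective σ) {p : Prog ι} {s s' : Store ι} {t : ℕ} (h : Runs p s t s')
    {S S' : Store κ} (hS : ∀ i, S (σ i) = s i) (hS' : ∀ i, S' (σ i) = s' i)
    (hr : ∀ r, (∀ i, σ i ≠ r) → S' r = S r) : Runs (p.map σ) S t S' := by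
  refine (h.map hσ S hS).congr ?_
  funext r
  by_cases hi : ∃ i, σ i = r
  · obtain ⟨i, rfl⟩ := hi
    rw [hσ.extend_apply, hS']
  · rw [extend_apply' _ _ _ hi, hr]
    exact fun i h => hi ⟨i, h⟩

/-- The functions are bounded in length. -/
theorem ComputOn.length_le [Growth B] {D : Set (List Bool)} {f : List Bool → List Bool}
    (h : ComputOn B D f) : ∃ t, B t ∧ Monotone t ∧ ∀ x ∈ D, (f x).length ≤ t x.length := by
  obtain ⟨ι, _, _, i, o, p, t, -, ht, h⟩ := h
  obtain ⟨t', ht', hm, hle⟩ := Growth.mono (Growth.add ht (Growth.lin 1))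
  refine ⟨t', ht', hm, fun x hx => ?_⟩
  have h₁ := (h x hx).length_le o
  have h₂ : (single i x o).length ≤ x.length := by
    by_cases ho : o = i
    · subst ho; simp [single]
    · simp [single, ho]
  have := hle x.length
  simp only [single, update_self] at h₁ h₂
  omega

theorem Comput.length_le [Growth B] {f : List Bool → List Bool} (h : Comput B f) :
    ∃ t, B t ∧ Monotone t ∧ ∀ x, (f x).length ≤ t x.length := by
  obtain ⟨t, h₁, h₂, h₃⟩ := ComputOn.length_le h
  exact ⟨t, h₁, h₂, fun x => h₃ x trivial⟩

theorem ComputOn.mono [Growth B] {D : Set (List Bool)} {f : List Bool → List Bool}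
    (h : ComputOn B D f) : ∃ (ι : Type) (_ : Finite ι) (_ : DecidableEq ι) (i o : ι)
      (p : Prog ι) (t : ℕ → ℕ), p.Det ∧ B t ∧ Monotone t ∧
      ∀ x ∈ D, Runs p (single i x) (t x.length) (single o (f x)) := by
  obtain ⟨ι, h₁, h₂, i, o, p, t, hp, ht, h⟩ := h
  obtain ⟨t', ht', hm, hle⟩ := Growth.mono ht
  exact ⟨ι, h₁, h₂, i, o, p, t', hp, ht', hm, fun x hx => (h x hx).mono (hle _)⟩

theorem update_single_comm {ι : Type} [DecidableEq ι] {a b : ι} (hab : a ≠ b)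
    (x y : List Bool) : update (single a x) b y = update (single b y) a x :=
  update_comm hab _ _ _

theorem update_single_nil {ι : Type} [DecidableEq ι] {a b : ι} (hab : a ≠ b) (x : List Bool) :
    update (single a x) b [] = single a x := by
  rw [update_eq_self_iff]
  simp [single, hab.symm]

theorem runs_xfer_single {ι : Type} [DecidableEq ι] {a b c d : ι} (hab : a ≠ b) (hac : a ≠ c)
    (had : a ≠ d) (hbc : b ≠ c) (hbd : b ≠ d) (hcd : c ≠ d) (x y : List Bool) :
    Runs (.xfer a c b) (update (single a x) d y) (8 * x.length + 3)
      (update (single b x) d y) := by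
  have := runs_xfer hab hac hbc (update (single a x) d y) (by simp [single, hcd, hac.symm])
  refine (this.mono (by simp [single, had])).congr ?_
  funext r
  simp only [single, update_apply, if_neg had, if_neg hbd, if_neg hab.symm, if_true,
    List.append_nil]
  by_cases h₁ : r = b
  · subst h₁; simp [hbd]
  by_cases h₂ : r = a
  · subst h₂; simp [hab, had]
  simp [h₁, h₂]

theorem runs_xfer₂_single {ι : Type} [DecidableEq ι] {a b c d : ι} (hab : a ≠ b) (hac : a ≠ c)
    (had : a ≠ d) (hbc : b ≠ c) (hbd : b ≠ d) (hcd : c ≠ d) (x : List Bool) :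
    Runs (.xfer₂ a c b d) (single a x) (11 * x.length + 3) (update (single b x) d x) := by
  have := runs_xfer₂ hab hac had hbc hbd hcd (single a x) (by simp [single, hac.symm])
  refine (this.mono (by simp [single])).congr ?_
  funext r
  simp only [single, update_apply, if_neg had.symm, if_neg hab.symm, if_true, List.append_nil]
  by_cases h₁ : r = d
  · subst h₁; simp
  by_cases h₂ : r = b
  · subst h₂; simp [h₁]
  by_cases h₃ : r = a
  · subst h₃; simp [h₁, h₂]
  simp [h₁, h₂, h₃]

theorem Runs.embed_single {ι κ : Type} [DecidableEq ι] [DecidableEq κ] {σ : ι → κ}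
    (hσ : Injective σ) {p : Prog ι} {i o : ι} {x y : List Bool} {t : ℕ}
    (h : Runs p (single i x) t (single o y)) {r : κ} (hr : ∀ i, σ i ≠ r) (z : List Bool) :
    Runs (p.map σ) (update (single (σ i) x) r z) t (update (single (σ o) y) r z) := by
  refine h.embed hσ ?_ ?_ ?_
  · intro j; simp [single, update_apply, hσ.eq_iff, hr]
  · intro j; simp [single, update_apply, hσ.eq_iff, hr]
  · intro j hj; simp [single, update_apply, (hj _).symm]

/-- Stacks for three programs and two more. -/
theorem exists_stacks (ι κ μ : Type) [Finite ι] [Finite κ] [Finite μ] :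
    ∃ (ω : Type) (_ : Finite ω) (_ : DecidableEq ω) (f : ι → ω) (g : κ → ω) (h : μ → ω) (X T : ω),
      Injective f ∧ Injective g ∧ Injective h ∧ (∀ a b, f a ≠ g b) ∧ (∀ a b, f a ≠ h b) ∧
      (∀ a b, g a ≠ h b) ∧ (∀ a, f a ≠ X) ∧ (∀ a, f a ≠ T) ∧ (∀ a, g a ≠ X) ∧ (∀ a, g a ≠ T) ∧
      (∀ a, h a ≠ X) ∧ (∀ a, h a ≠ T) ∧ X ≠ T := by
  classical
  refine ⟨ι ⊕ κ ⊕ μ ⊕ Bool, inferInstance, inferInstance, .inl, fun r => .inr (.inl r),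
    fun r => .inr (.inr (.inl r)), .inr (.inr (.inr false)), .inr (.inr (.inr true)),
    Sum.inl_injective, Sum.inr_injective.comp Sum.inl_injective,
    Sum.inr_injective.comp (Sum.inr_injective.comp Sum.inl_injective), ?_⟩
  simp

/-- The two programs work on disjoint stacks, and the intermediate result is transferred. Its length
is bounded by the running time of the first program, so the total time is a sum and a composition of
bounds. -/
theorem ComputOn.comp [Growth B] {D : Set (List Bool)} {f g : List Bool → List Bool}
    (hg : ComputOn B D g) (hf : Comput B f) (hD : ∀ x, f x ∈ D) :
    Comput B fun x => g (f x) := by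
  obtain ⟨u, hu, -, hfu⟩ := hf.length_le
  obtain ⟨ι, _, _, fi, fo, p, t, hp, ht, hf⟩ := hf
  obtain ⟨κ, _, _, gi, go, q, t', hq, ht', hm, hg⟩ := hg.mono
  obtain ⟨ω, _, _, sf, sg, so, X, T, isf, isg, -, hfg, -, -, hfX, hfT, hgX, hgT, -, -, hXT⟩ :=
    exists_stacks ι κ Unit
  refine ⟨ω, inferInstance, inferInstance, sf fi, sg go,
    .seq (p.map sf) (.seq (.xfer (sf fo) T (sg gi)) (q.map sg)),
    fun n => t n + (8 * u n + 8) + t' (u n),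
    ⟨hp.map _, Prog.det_xfer _ _ _, hq.map _⟩,
    Growth.add (Growth.add ht (Growth.comp (s := fun n => 8 * n + 8) (Growth.lin 8) hu))
      (Growth.comp ht' hu), ?_⟩
  intro x _
  have h₁ := (hf x trivial).embed_single isf hfX []
  have h₂ := runs_xfer_single (hfg fo gi) (hfT fo) (hfX fo) (hgT gi) (hgX gi) hXT.symm (f x) []
  have h₃ := (hg (f x) (hD x)).embed_single isg hgX []
  rw [update_single_nil (hfX _), update_single_nil (hfX _)] at h₁
  rw [update_single_nil (hfX _), update_single_nil (hgX _)] at h₂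
  rw [update_single_nil (hgX _), update_single_nil (hgX _)] at h₃
  refine .seq h₁ (.seq h₂ h₃ le_rfl) ?_
  have := hm (hfu x)
  have := hfu x
  beta_reduce
  omega

theorem Comput.comp [Growth B] {f g : List Bool → List Bool}
    (hg : Comput B g) (hf : Comput B f) : Comput B fun x => g (f x) :=
  ComputOn.comp hg hf fun _ => trivial

theorem Comput₂.comp [Growth B] {f g : List Bool → List Bool}
    {op : List Bool → List Bool → List Bool} (hop : Comput₂ B op) (hf : Comput B f)
    (hg : Comput B g) : Comput B fun x => op (f x) (g x) := by
  obtain ⟨u, hu, -, hfu⟩ := hf.length_le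
  obtain ⟨v, hv, -, hgv⟩ := hg.length_le
  obtain ⟨ι, _, _, fi, fo, p, t, hp, ht, hf⟩ := hf
  obtain ⟨κ, _, _, gi, go, q, t', hq, ht', hg⟩ := hg
  obtain ⟨μ, _, _, i, j, o, r, t₀, hr, hij, ht₀, hop⟩ := hop
  obtain ⟨t₁, ht₁, hm, hle⟩ := Growth.mono ht₀
  obtain ⟨ω, _, _, sf, sg, so, X, T, isf, isg, iso, hfg, hfo, hgo, hfX, hfT, hgX, hgT, hoX, hoT,
    hXT⟩ := exists_stacks ι κ μ
  refine ⟨ω, inferInstance, inferInstance, X, so o,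
    .seq (.xfer₂ X T (sf fi) (sg gi)) (.seq (p.map sf) (.seq (q.map sg)
      (.seq (.xfer (sf fo) T (so i)) (.seq (.xfer (sg go) T (so j)) (r.map so))))),
    fun n => (11 * n + 11) + t n + t' n + (8 * u n + 8) + (8 * v n + 8) + t₁ (u n + v n),
    ⟨Prog.det_xfer₂ _ _ _ _, hp.map _, hq.map _, Prog.det_xfer _ _ _, Prog.det_xfer _ _ _,
      hr.map _⟩, ?_, ?_⟩
  · exact Growth.add (Growth.add (Growth.add (Growth.add (Growth.add (Growth.lin 11) ht) ht')
      (Growth.comp (s := fun n => 8 * n + 8) (Growth.lin 8) hu))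
      (Growth.comp (s := fun n => 8 * n + 8) (Growth.lin 8) hv))
      (Growth.comp ht₁ (Growth.add hu hv))
  intro x _
  have h₁ := runs_xfer₂_single (hfX fi).symm hXT (hgX gi).symm (hfT fi) (hfg fi gi) (hgT gi).symm x
  have h₂ := (hf x trivial).embed_single isf (fun a => hfg a gi) x
  have h₃ := (hg x trivial).embed_single isg (fun a => (hfg fo a).symm) (f x)
  rw [update_single_comm (hfg _ _).symm, update_single_comm (hfg _ _).symm] at h₃
  have h₄ := runs_xfer_single (hfo fo i) (hfT fo) (hfg fo go) (hoT i) (hgo go i).symm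
    (hgT go).symm (f x) (g x)
  have h₅ := runs_xfer_single (hgo go j) (hgT go) (hgo go i) (hoT j) (iso.ne hij.symm)
    (hoT i).symm (g x) (f x)
  rw [update_single_comm (hgo _ _), update_single_comm (iso.ne hij.symm)] at h₅
  have h₆ : Runs (r.map so) (update (single (so i) (f x)) (so j) (g x))
      (t₀ ((f x).length + (g x).length)) (single (so o) (op (f x) (g x))) := by
    refine (hop _ _).embed iso ?_ ?_ ?_
    · intro r; simp [single, update_apply, iso.eq_iff]
    · intro r; simp [single, update_apply, iso.eq_iff]
    · intro r hr; simp [single, (hr _).symm]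
  refine .seq h₁ (.seq h₂ (.seq h₃ (.seq h₄ (.seq h₅ h₆ le_rfl) le_rfl) le_rfl) le_rfl) ?_
  have := hm (Nat.add_le_add (hfu x) (hgv x))
  have := hle ((f x).length + (g x).length)
  have := hfu x
  have := hgv x
  beta_reduce
  omega

/-- The number of rounds multiplies the time per round, which is harmless for polynomial bounds but
not for linear ones. The lengths of all iterates must be bounded in advance, since a polynomial-time
function may square lengths. -/
theorem Comput.iterate {f g h : List Bool → List Bool} (hf : Comput PolyB f)
    (hg : Comput PolyB g) (hh : Comput PolyB h) {b : ℕ → ℕ} (hb : PolyB b)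
    (hgb : ∀ x, ∀ k ≤ (h x).length, (g^[k] (f x)).length ≤ b x.length) :
    Comput PolyB fun x => g^[(h x).length] (f x) := by
  obtain ⟨u, hu, -, hfu⟩ := hf.length_le
  obtain ⟨v, hv, -, hhv⟩ := hh.length_le
  obtain ⟨ι, _, _, fi, fo, p, t, hp, ht, hf⟩ := hf
  obtain ⟨κ, _, _, gi, go, q, t', hq, ht', hm, hg⟩ := ComputOn.mono hg
  obtain ⟨μ, _, _, hi, ho, r, t₁, hr, ht₁, hh⟩ := hh
  obtain ⟨ω, _, _, sf, sg, sh, X, T, isf, isg, ish, hfg, hfh, hgh, hfX, hfT, hgX, hgT, hhX, hhT,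
    hXT⟩ := exists_stacks ι κ μ
  refine ⟨ω, inferInstance, inferInstance, X, sg gi,
    .seq (.xfer₂ X T (sf fi) (sh hi)) (.seq (p.map sf) (.seq (r.map sh)
      (.seq (.xfer (sf fo) T (sg gi)) (.forEach (sh ho) fun _ =>
        .seq (q.map sg) (.seq (.xfer (sg go) T X) (.xfer X T (sg gi))))))),
    fun n => (11 * n + 11) + t n + t₁ n + (8 * u n + 8) + (t' (b n) + (16 * b n + 16)) * v n,
    ⟨Prog.det_xfer₂ _ _ _ _, hp.map _, hr.map _, Prog.det_xfer _ _ _,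
      Prog.det_forEach.2 fun _ => ⟨hq.map _, Prog.det_xfer _ _ _, Prog.det_xfer _ _ _⟩⟩, ?_, ?_⟩
  · exact Growth.add (Growth.add (Growth.add (Growth.add (Growth.lin 11) ht) ht₁)
      (Growth.comp (s := fun n => 8 * n + 8) (Growth.lin 8) hu))
      (PolyB.mul (Growth.add (Growth.comp ht' hb)
        (Growth.comp (s := fun n => 16 * n + 16) (Growth.lin 16) hb)) hv)
  intro x _
  have h₁ := runs_xfer₂_single (hfX fi).symm hXT (hhX hi).symm (hfT fi) (hfh fi hi) (hhT hi).symm x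
  have h₂ := (hf x trivial).embed_single isf (fun a => hfh a hi) x
  have h₃ := (hh x trivial).embed_single ish (fun a => (hfh fo a).symm) (f x)
  rw [update_single_comm (hfh _ _).symm, update_single_comm (hfh _ _).symm] at h₃
  have h₄ := runs_xfer_single (hfg fo gi) (hfT fo) (hfh fo ho) (hgT gi) (hgh gi ho)
    (hhT ho).symm (f x) (h x)
  -- The stack `sh ho` is a unary counter: one bit is popped per application of `g`.
  have h₅ : ∀ (l y : List Bool) (N : ℕ), (∀ k ≤ l.length, (g^[k] y).length ≤ N) →
      Runs (.forEach (sh ho) fun _ => .seq (q.map sg)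
        (.seq (.xfer (sg go) T X) (.xfer X T (sg gi))))
        (update (single (sg gi) y) (sh ho) l) ((t' N + (16 * N + 16)) * l.length + 1)
        (single (sg gi) (g^[l.length] y)) := by
    intro l
    induction l with
    | nil =>
      intro y N _
      exact (Runs.loop_nil (by simp) (by simp)).congr (update_single_nil (hgh _ _) _)
    | cons c l ih =>
      intro y N hN
      have j₁ := ((hg y trivial).embed_single isg (fun a => hgh a ho) l).mono
        (hm (by simpa using hN 0 (by simp)))
      have hgy : (g y).length ≤ N := by simpa using hN 1 (by simp)
      have j₂ := runs_xfer_single (hgX go) (hgT go) (hgh go ho) hXT (hhX ho).symm (hhT ho).symm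
        (g y) l
      have j₃ := runs_xfer_single (hgX gi).symm hXT (hhX ho).symm (hgT gi) (hgh gi ho)
        (hhT ho).symm (g y) l
      refine .loop_cons (by simp) (.cases_cons (b := c) (l := l)
        (t₁ := t' N + (16 * N + 11)) (by simp) ?_ (by omega))
        (ih (g y) N fun k hk => ?_) ?_ (t₁ := t' N + (16 * N + 12))
      · rw [update_idem]
        exact (Runs.seq j₁ (.seq j₂ j₃ le_rfl) le_rfl).mono (by omega)
      · rw [← iterate_succ_apply]
        exact hN _ (by simp; omega)
      · rw [List.length_cons]
        ring_nf
        omega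
  refine .seq h₁ (.seq h₂ (.seq h₃ (.seq h₄ (h₅ _ _ _ (hgb x)) le_rfl) le_rfl) le_rfl) ?_
  have := hfu x
  have := Nat.mul_le_mul_left (t' (b x.length) + (16 * b x.length + 16)) (hhv x)
  beta_reduce
  omega

/-! ## Elementary functions -/

/-- The contents of five stacks. -/
def st (a b c d e : List Bool) : Store (Fin 5) := ![a, b, c, d, e]

section

variable (a b c d e v : List Bool)

theorem update_st_0 : update (st a b c d e) 0 v = st v b c d e := by
  funext j; fin_cases j <;> simp [st]
theorem update_st_1 : update (st a b c d e) 1 v = st a v c d e := by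
  funext j; fin_cases j <;> simp [st]
theorem update_st_2 : update (st a b c d e) 2 v = st a b v d e := by
  funext j; fin_cases j <;> simp [st]
theorem update_st_3 : update (st a b c d e) 3 v = st a b c v e := by
  funext j; fin_cases j <;> simp [st]
theorem update_st_4 : update (st a b c d e) 4 v = st a b c d v := by
  funext j; fin_cases j <;> simp [st]
@[simp] theorem st_0 : st a b c d e 0 = a := rfl
@[simp] theorem st_1 : st a b c d e 1 = b := rfl
@[simp] theorem st_2 : st a b c d e 2 = c := rfl
@[simp] theorem st_3 : st a b c d e 3 = d := rfl
@[simp] theorem st_4 : st a b c d e 4 = e := rfl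

theorem single_zero : (single 0 a : Store (Fin 5)) = st a [] [] [] [] := by
  funext j; fin_cases j <;> simp [st, single]
theorem single_one : (single 1 a : Store (Fin 5)) = st [] a [] [] [] := by
  funext j; fin_cases j <;> simp [st, single]

end

attribute [simp] update_st_0 update_st_1 update_st_2 update_st_3 update_st_4

theorem comput_of_runs {B : (ℕ → ℕ) → Prop} [Growth B] {f : List Bool → List Bool}
    {p : Prog (Fin 5)} (hp : p.Det) (c : ℕ)
    (h : ∀ x, Runs p (st x [] [] [] []) (c * x.length + c) (st [] (f x) [] [] [])) :
    Comput B f := by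
  refine ⟨Fin 5, inferInstance, inferInstance, 0, 1, p, _, hp, Growth.lin c, fun x _ => ?_⟩
  rw [single_zero, single_one]
  exact h x

theorem comput₂_of_runs {B : (ℕ → ℕ) → Prop} [Growth B] {f : List Bool → List Bool → List Bool}
    {p : Prog (Fin 5)} (hp : p.Det) (c : ℕ)
    (h : ∀ x y, Runs p (st x [] y [] []) (c * (x.length + y.length) + c)
      (st [] (f x y) [] [] [])) :
    Comput₂ B f := by
  refine ⟨Fin 5, inferInstance, inferInstance, 0, 2, 1, p, _, hp, by decide, Growth.lin c,
    fun x y => ?_⟩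
  rw [single_zero, single_one, update_st_2]
  exact h x y

section

variable (a b c d e : List Bool)

theorem runs_mv_st_0_3 : Runs (.mv 0 3) (st a b c d e) (4 * a.length + 1)
    (st [] b c (a.reverse ++ d) e) := by
  simpa using runs_mv (a := (0 : Fin 5)) (b := 3) (by decide) (st a b c d e)

theorem runs_mv_st_0_1 : Runs (.mv 0 1) (st a b c d e) (4 * a.length + 1)
    (st [] (a.reverse ++ b) c d e) := by
  simpa using runs_mv (a := (0 : Fin 5)) (b := 1) (by decide) (st a b c d e)

theorem runs_mv_st_3_0 : Runs (.mv 3 0) (st a b c d e) (4 * d.length + 1)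
    (st (d.reverse ++ a) b c [] e) := by
  simpa using runs_mv (a := (3 : Fin 5)) (b := 0) (by decide) (st a b c d e)

theorem runs_mv_st_3_1 : Runs (.mv 3 1) (st a b c d e) (4 * d.length + 1)
    (st a (d.reverse ++ b) c [] e) := by
  simpa using runs_mv (a := (3 : Fin 5)) (b := 1) (by decide) (st a b c d e)

theorem runs_xfer_st_0 : Runs (.xfer 0 3 1) (st a b c [] e) (8 * a.length + 3)
    (st [] (a ++ b) c [] e) := by
  simpa using runs_xfer (a := (0 : Fin 5)) (b := 1) (c := 3) (by decide) (by decide) (by decide)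
    (st a b c [] e) rfl

theorem runs_xfer_st_2 : Runs (.xfer 2 3 1) (st a b c [] e) (8 * c.length + 3)
    (st a (c ++ b) [] [] e) := by
  simpa using runs_xfer (a := (2 : Fin 5)) (b := 1) (c := 3) (by decide) (by decide) (by decide)
    (st a b c [] e) rfl

theorem runs_clear_st_0 : Runs (.clear 0) (st a b c d e) (3 * a.length + 1)
    (st [] b c d e) := by
  simpa using runs_clear (a := (0 : Fin 5)) (st a b c d e)

theorem runs_clear_st_1 : Runs (.clear 1) (st a b c d e) (3 * b.length + 1)
    (st a [] c d e) := by
  simpa using runs_clear (a := (1 : Fin 5)) (st a b c d e)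

theorem runs_clear_st_2 : Runs (.clear 2) (st a b c d e) (3 * c.length + 1)
    (st a b [] d e) := by
  simpa using runs_clear (a := (2 : Fin 5)) (st a b c d e)

theorem runs_clear_st_3 : Runs (.clear 3) (st a b c d e) (3 * d.length + 1)
    (st a b c [] e) := by
  simpa using runs_clear (a := (3 : Fin 5)) (st a b c d e)

theorem runs_clear_st_4 : Runs (.clear 4) (st a b c d e) (3 * e.length + 1)
    (st a b c d []) := by
  simpa using runs_clear (a := (4 : Fin 5)) (st a b c d e)

theorem runs_push_st_0 (x : Bool) : Runs (.push 0 x) (st a b c d e) 2 (st (x :: a) b c d e) := by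
  simpa using Runs.push (r := (0 : Fin 5)) (b := x) (s := st a b c d e) le_rfl

theorem runs_push_st_1 (x : Bool) : Runs (.push 1 x) (st a b c d e) 2 (st a (x :: b) c d e) := by
  simpa using Runs.push (r := (1 : Fin 5)) (b := x) (s := st a b c d e) le_rfl

theorem runs_push_st_3 (x : Bool) : Runs (.push 3 x) (st a b c d e) 2 (st a b c (x :: d) e) := by
  simpa using Runs.push (r := (3 : Fin 5)) (b := x) (s := st a b c d e) le_rfl

theorem runs_push_st_4 (x : Bool) : Runs (.push 4 x) (st a b c d e) 2 (st a b c d (x :: e)) := by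
  simpa using Runs.push (r := (4 : Fin 5)) (b := x) (s := st a b c d e) le_rfl

variable {a b c d e}
variable {p : Prog (Fin 5)} {q : Bool → Prog (Fin 5)} {s : Store (Fin 5)} {t : ℕ} {x : Bool}

theorem runs_cases_st_0 (h : Runs (q x) (st a b c d e) t s) :
    Runs (.cases 0 p q) (st (x :: a) b c d e) (t + 1) s :=
  .cases_cons rfl (by simpa using h) le_rfl

theorem runs_cases_st_2 (h : Runs (q x) (st a b c d e) t s) :
    Runs (.cases 2 p q) (st a b (x :: c) d e) (t + 1) s :=
  .cases_cons rfl (by simpa using h) le_rfl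

theorem runs_cases_st_3 (h : Runs (q x) (st a b c d e) t s) :
    Runs (.cases 3 p q) (st a b c (x :: d) e) (t + 1) s :=
  .cases_cons rfl (by simpa using h) le_rfl

theorem runs_cases_st_4 (h : Runs (q x) (st a b c d e) t s) :
    Runs (.cases 4 p q) (st a b c d (x :: e)) (t + 1) s :=
  .cases_cons rfl (by simpa using h) le_rfl

end

section Elementary

variable {B : (ℕ → ℕ) → Prop} [Growth B]

theorem comput_const (c : List Bool) : Comput B fun _ => c := by
  refine comput_of_runs (p := .seq (.clear 0) (.pushAll 1 c)) (by simp [Prog.Det])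
    (3 * c.length + 10) fun x => ?_
  have h₂ := runs_pushAll 1 c (st [] [] [] [] [])
  rw [st_1, update_st_1, List.append_nil] at h₂
  refine .seq (runs_clear_st_0 _ _ _ _ _) h₂ ?_
  have : 10 * x.length ≤ (3 * c.length + 10) * x.length := Nat.mul_le_mul_right _ (by omega)
  omega

theorem comput_id : Comput B fun x => x := by
  refine comput_of_runs (p := .xfer 0 3 1) (by simp) 8 fun x => ?_
  exact ((runs_xfer_st_0 x [] [] []).mono (by omega)).congr (by simp)

theorem comput_reverse : Comput B List.reverse := by
  refine comput_of_runs (p := .mv 0 1) (by simp) 4 fun x => ?_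
  exact ((runs_mv_st_0_1 x [] [] [] []).mono (by omega)).congr (by simp)

theorem comput_tail : Comput B List.tail := by
  refine comput_of_runs (p := .seq (.cases 0 .skip fun _ => .skip) (.xfer 0 3 1))
    (by simp [Prog.Det]) 9 fun x => ?_
  cases x with
  | nil =>
    exact (Runs.seq (.cases_nil rfl (.skip le_rfl) le_rfl) (runs_xfer_st_0 _ _ _ _)
      (by simp)).congr (by simp)
  | cons a x =>
    exact (Runs.seq (runs_cases_st_0 (.skip le_rfl)) (runs_xfer_st_0 _ _ _ _)
      (by simp; omega)).congr (by simp)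

theorem comput_doubleBits : Comput B doubleBits := by
  refine comput_of_runs (p := .seq (.mv 0 3) (.forEach 3 fun b => .seq (.push 1 false) (.push 1 b)))
    (by simp [Prog.Det, Prog.det_forEach]) 11 fun x => ?_
  have := runs_forEach (a := (3 : Fin 5)) (p := fun b => .seq (.push 1 false) (.push 1 b))
    (fun l acc => st [] (doubleBits acc) [] l []) (fun acc b => b :: acc) (k := 5)
    (fun _ _ => rfl) (fun b l c => by
      rw [update_st_3]
      exact .seq (runs_push_st_1 _ _ _ _ _ _) (runs_push_st_1 _ _ _ _ _ _) le_rfl) x.reverse []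
  rw [foldl_cons_eq, List.reverse_reverse, List.append_nil] at this
  refine .seq ((runs_mv_st_0_3 x [] [] [] []).congr (by simp; rfl)) this (by simp; omega)

theorem comput_ones : Comput B fun x => List.replicate x.length true := by
  refine comput_of_runs (p := .forEach 0 fun _ => .push 1 true)
    (by simp [Prog.Det, Prog.det_forEach]) 4 fun x => ?_
  have := runs_forEach (a := (0 : Fin 5)) (p := fun _ => .push 1 true)
    (fun l (acc : ℕ) => st l (List.replicate acc true) [] [] []) (fun acc _ => acc + 1) (k := 2)
    (fun _ _ => rfl) (fun b l c => by
      rw [update_st_0]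
      exact runs_push_st_1 _ _ _ _ _ _) x 0
  have h : ∀ (l : List Bool) (n : ℕ), l.foldl (fun acc _ => acc + 1) n = n + l.length := by
    intro l
    induction l with
    | nil => intro n; rfl
    | cons a l ih => intro n; rw [List.foldl_cons, ih, List.length_cons]; omega
  rw [h, zero_add] at this
  exact this.mono (by omega)

/-- Split a coded sequence after its first component. -/
def splitCode : List Bool → List Bool × List Bool
  | a :: false :: l => (a :: (splitCode l).1, (splitCode l).2)
  | _ :: true :: l => ([], l)
  | [_] => ([], [])
  | [] => ([], [])

/-- The first component of a sequence. -/
def hd (x : List Bool) : List Bool := (splitCode x).1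

/-- A sequence without the first component. -/
def tl (x : List Bool) : List Bool := (splitCode x).2

/-- Move the first component from stack 0 to stack 3. -/
def splitProg : Prog (Fin 5) :=
  .seq (.push 4 true) (.loop 4 (.cases 4 .skip fun _ => .cases 0 .skip fun a => .cases 0 .skip
    fun b => if b then .skip else .seq (.push 3 a) (.push 4 true)))

theorem det_splitProg : splitProg.Det := by
  simp [splitProg, Prog.Det]

/-- Stack 4 holds a flag that keeps the loop going; it is renewed after each doubled bit and dropped
at the separator or at the end of the string. -/
theorem runs_splitProg (x : List Bool) : Runs splitProg (st x [] [] [] []) (10 * x.length + 10)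
    (st (tl x) [] [] (hd x).reverse []) := by
  have : ∀ (x : List Bool) (d : List Bool), Runs (.loop 4 (.cases 4 .skip fun _ =>
      .cases 0 .skip fun a => .cases 0 .skip
      fun b => if b then .skip else .seq (.push 3 a) (.push 4 true))) (st x [] [] d [true])
      (10 * x.length + 7) (st (tl x) [] [] ((hd x).reverse ++ d) []) := by
    intro x
    induction x using splitCode.induct with
    | case1 a l ih =>
      intro d
      refine .loop_cons (by simp) (runs_cases_st_4 (runs_cases_st_0 (runs_cases_st_0
        (.seq (runs_push_st_3 _ _ _ _ _ _) (runs_push_st_4 _ _ _ _ _ _) le_rfl))))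
        ((ih (a :: d)).congr ?_) (by simp; omega)
      simp [hd, tl, splitCode]
    | case2 a l =>
      intro d
      exact .loop_cons (by simp) (runs_cases_st_4 (runs_cases_st_0 (runs_cases_st_0
        (.skip le_rfl)))) (.loop_nil rfl le_rfl) (by simp)
    | case3 a =>
      intro d
      exact .loop_cons (by simp) (runs_cases_st_4 (runs_cases_st_0 (.cases_nil rfl
        (.skip le_rfl) le_rfl))) (.loop_nil rfl le_rfl) (by simp)
    | case4 =>
      intro d
      exact .loop_cons (by simp) (runs_cases_st_4 (.cases_nil rfl
        (.skip le_rfl) le_rfl)) (.loop_nil rfl le_rfl) (by simp)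
  have h := this x []
  rw [List.append_nil] at h
  exact .seq (runs_push_st_4 _ _ _ _ _ _) h (by omega)

theorem length_splitCode_le (x : List Bool) : (hd x).length + (tl x).length ≤ x.length := by
  rw [hd, tl]
  induction x using splitCode.induct <;> simp_all [splitCode] <;> omega

theorem comput_hd : Comput B hd := by
  refine comput_of_runs (p := .seq splitProg (.seq (.mv 3 1) (.clear 0)))
    (by simp [Prog.Det, det_splitProg]) 17 fun x => ?_
  refine (Runs.seq (runs_splitProg x) (.seq (runs_mv_st_3_1 _ _ _ _ _)
    (runs_clear_st_0 _ _ _ _ _) le_rfl) ?_).congr (by simp)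
  have := length_splitCode_le x
  simp
  omega

theorem comput_tl : Comput B tl := by
  refine comput_of_runs (p := .seq splitProg (.seq (.clear 3) (.xfer 0 3 1)))
    (by simp [Prog.Det, det_splitProg]) 30 fun x => ?_
  refine (Runs.seq (runs_splitProg x) (.seq (runs_clear_st_3 _ _ _ _ _)
    (runs_xfer_st_0 _ _ _ _) le_rfl) ?_).congr (by simp)
  have := length_splitCode_le x
  simp
  omega

/-- The digits of the successor. -/
def incr : List Bool → List Bool
  | [] => [true]
  | false :: l => true :: l
  | true :: l => false :: incr l

theorem comput_incr : Comput B incr := by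
  let p : Prog (Fin 5) := .loop 4 (.cases 4 .skip fun _ => .cases 0 (.push 0 true)
    fun b => if b then .seq (.push 3 false) (.push 4 true) else .push 0 true)
  have h : ∀ (x d : List Bool), ∃ y e, y.length ≤ x.length + 1 ∧ e.length ≤ x.length + d.length ∧
      Runs p (st x [] [] d [true]) (10 * x.length + 6) (st y [] [] e []) ∧
      e.reverse ++ y = d.reverse ++ incr x := by
    intro x
    induction x with
    | nil =>
      intro d
      exact ⟨[true], d, by simp, by simp, .loop_cons (by simp) (runs_cases_st_4 (.cases_nil rfl
        (runs_push_st_0 _ _ _ _ _ _) le_rfl)) (.loop_nil rfl le_rfl) (by simp), rfl⟩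
    | cons b x ih =>
      intro d
      cases b with
      | false =>
        exact ⟨true :: x, d, by simp, by simp, .loop_cons (by simp)
          (runs_cases_st_4 (runs_cases_st_0
          (runs_push_st_0 _ _ _ _ _ _))) (.loop_nil rfl le_rfl) (by simp), rfl⟩
      | true =>
        obtain ⟨y, e, hy, he, h, hye⟩ := ih (false :: d)
        refine ⟨y, e, by simp; omega, by simp at he ⊢; omega, .loop_cons (by simp)
          (runs_cases_st_4 (runs_cases_st_0
          (.seq (runs_push_st_3 _ _ _ _ _ _) (runs_push_st_4 _ _ _ _ _ _) le_rfl))) h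
          (by simp; omega), ?_⟩
        rw [hye]
        simp [incr]
  refine comput_of_runs (p := .seq (.push 4 true) (.seq p (.seq (.mv 3 0) (.xfer 0 3 1))))
    (by simp [p, Prog.Det]) 50 fun x => ?_
  obtain ⟨y, e, hy, he, h, hye⟩ := h x []
  refine (Runs.seq (runs_push_st_4 _ _ _ _ _ _) (.seq h (.seq (runs_mv_st_3_0 _ _ _ _ _)
    (runs_xfer_st_0 _ _ _ _) le_rfl) le_rfl) ?_).congr (by simp at hye; simp [hye])
  simp at he ⊢
  omega

/-- Drop the leading zeros (the last digits). -/
def canon (x : List Bool) : List Bool := (x.reverse.dropWhile fun b => !b).reverse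

theorem comput_canon : Comput B canon := by
  let p : Prog (Fin 5) := .loop 4 (.cases 4 .skip fun _ => .cases 3 .skip
    fun b => if b then .push 3 true else .push 4 true)
  have h : ∀ d : List Bool, Runs p (st [] [] [] d [true]) (10 * d.length + 6)
      (st [] [] [] (d.dropWhile fun b => !b) []) := by
    intro d
    induction d with
    | nil =>
      exact .loop_cons (by simp) (runs_cases_st_4 (.cases_nil rfl
        (.skip le_rfl) le_rfl)) (.loop_nil rfl le_rfl) (by simp)
    | cons b x ih =>
      cases b with
      | true =>
        exact .loop_cons (by simp) (runs_cases_st_4 (runs_cases_st_3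
          (runs_push_st_3 _ _ _ _ _ _))) (.loop_nil rfl le_rfl) (by simp)
      | false =>
        exact .loop_cons (by simp) (runs_cases_st_4 (runs_cases_st_3
          (runs_push_st_4 _ _ _ _ _ _))) ih (by simp; omega)
  refine comput_of_runs (p := .seq (.mv 0 3) (.seq (.push 4 true) (.seq p (.mv 3 1))))
    (by simp [p, Prog.Det]) 50 fun x => ?_
  refine (Runs.seq (runs_mv_st_0_3 _ _ _ _ _) (.seq (runs_push_st_4 _ _ _ _ _ _) (.seq
    (h _) (runs_mv_st_3_1 _ _ _ _ _) le_rfl) le_rfl) ?_).congr (by simp [canon])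
  have := (List.dropWhile_suffix (l := x.reverse) fun b => !b).length_le
  simp at this ⊢
  omega

theorem comput_append : Comput₂ B fun x y => x ++ y := by
  refine comput₂_of_runs (p := .seq (.xfer 2 3 1) (.xfer 0 3 1)) (by simp [Prog.Det]) 10
    fun x y => ?_
  exact (Runs.seq (runs_xfer_st_2 _ _ _ _) (runs_xfer_st_0 _ _ _ _) (by omega)).congr (by simp)

/-- The string `y` if `x` is not empty, otherwise the empty string. -/
def sel (x y : List Bool) : List Bool := if x = [] then [] else y

theorem comput_sel : Comput₂ B sel := by
  refine comput₂_of_runs (p := .cases 0 (.clear 2) fun _ => .seq (.clear 0) (.xfer 2 3 1))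
    (by simp [Prog.Det]) 10 fun x y => ?_
  cases x with
  | nil => exact .cases_nil rfl (runs_clear_st_2 _ _ _ _ _) (by simp; omega)
  | cons a x =>
    exact ((runs_cases_st_0 (.seq (runs_clear_st_0 _ _ _ _ _) (runs_xfer_st_2 _ _ _ _)
      le_rfl)).mono (by simp; omega)).congr (by simp [sel])

/-- The test for equality. -/
def eqT (x y : List Bool) : List Bool := if x = y then [true] else []

theorem comput_eqT : Comput₂ B eqT := by
  let q : Bool → Prog (Fin 5) := fun a => .cases 2 (.push 4 true) fun b =>
    if a = b then .skip else .push 4 true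
  -- The accumulator consists of the unread part of the second string and a mark for every mismatch.
  -- The strings are equal if and only if both end up empty.
  let f : List Bool × List Bool → Bool → List Bool × List Bool := fun c a =>
    match c.1 with
    | [] => ([], true :: c.2)
    | b :: y => (y, if a = b then c.2 else true :: c.2)
  have h₁ := runs_forEach (a := (0 : Fin 5)) (p := q) (fun l c => st l [] c.1 [] c.2) f (k := 3)
    (fun _ _ => rfl) (by
      intro a l c
      rw [update_st_0]
      obtain ⟨_ | ⟨b, y⟩, e⟩ := c
      · exact .cases_nil rfl (runs_push_st_4 _ _ _ _ _ _) le_rfl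
      · by_cases hab : a = b
        · refine ((runs_cases_st_2 (t := 1) ?_).mono (by omega))
          simp only [f, if_pos hab]
          exact .skip le_rfl
        · refine ((runs_cases_st_2 (t := 2) ?_).mono (by omega))
          simp only [f, if_neg hab]
          exact runs_push_st_4 _ _ _ _ _ _)
  have h₂ : ∀ (x y e : List Bool), (x.foldl f (y, e)).1.length ≤ y.length ∧
      (x.foldl f (y, e)).2.length ≤ x.length + e.length ∧
      ((x.foldl f (y, e)).1 = [] ∧ (x.foldl f (y, e)).2 = [] ↔ e = [] ∧ x = y) := by
    intro x
    induction x with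
    | nil => intro y e; simp [and_comm, eq_comm]
    | cons a x ih =>
      intro y e
      cases y with
      | nil =>
        have := ih [] (true :: e)
        simp only [List.foldl_cons, f, List.length_cons] at this ⊢
        refine ⟨this.1, by omega, this.2.2.trans (by simp)⟩
      | cons b y =>
        have := ih y (if a = b then e else true :: e)
        simp only [List.foldl_cons, f, List.length_cons] at this ⊢
        refine ⟨by omega, this.2.1.trans ?_, this.2.2.trans ?_⟩
        · split <;> simp <;> omega
        · split <;> simp_all
  refine comput₂_of_runs (p := .seq (.forEach 0 q) (.seq (.cases 2 .skip fun _ => .push 4 true)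
    (.seq (.clear 2) (.cases 4 (.push 1 true) fun _ => .clear 4)))) ?_ 20 fun x y => ?_
  · simp only [Prog.Det, Prog.det_forEach, q, Prog.det_clear]
    simp only [true_and, and_true, implies_true]
    intro b c
    split <;> trivial
  have h₃ := h₁ x (y, [])
  obtain ⟨h₄, h₅, h₆⟩ := h₂ x y []
  generalize x.foldl f (y, []) = c at h₃ h₄ h₅ h₆
  obtain ⟨_ | ⟨b, y'⟩, e⟩ := c
  · simp only [List.length_nil, add_zero, true_and] at h₄ h₅ h₆
    refine .seq h₃ (.seq (.cases_nil rfl (.skip le_rfl) le_rfl) (.seq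
      (runs_clear_st_2 _ _ _ _ _) ?_ (t₂ := 3 * x.length + 4) le_rfl) le_rfl) (by simp; omega)
    cases e with
    | nil =>
      rw [eqT, if_pos (by simpa using h₆)]
      exact .cases_nil rfl (runs_push_st_1 _ _ _ _ _ _) (by omega)
    | cons a e =>
      rw [eqT, if_neg (by simpa using h₆)]
      refine (runs_cases_st_4 (runs_clear_st_4 _ _ _ _ _)).mono ?_
      simp at h₅
      omega
  · simp only [List.length_nil, add_zero, true_and, List.length_cons] at h₄ h₅ h₆
    refine .seq h₃ (.seq (runs_cases_st_2 (runs_push_st_4 _ _ _ _ _ _)) (.seq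
      (runs_clear_st_2 _ _ _ _ _) ?_ (t₂ := 3 * x.length + 4) le_rfl) le_rfl) (by simp; omega)
    rw [eqT, if_neg (by simpa using h₆)]
    refine (runs_cases_st_4 (runs_clear_st_4 _ _ _ _ _)).mono ?_
    have h₇ : e.length ≤ x.length := h₅
    dsimp only
    omega

theorem comput_drop : Comput₂ B fun x y => y.drop x.length := by
  refine comput₂_of_runs (p := .seq (.forEach 0 fun _ => .cases 2 .skip fun _ => .skip)
    (.xfer 2 3 1)) (by simp [Prog.Det, Prog.det_forEach]) 10 fun x y => ?_
  have h₁ := runs_forEach (a := (0 : Fin 5)) (p := fun _ => .cases 2 .skip fun _ => .skip)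
    (fun l c => st l [] c [] []) (fun c _ => c.tail) (k := 2)
    (fun _ _ => rfl) (by
      intro a l c
      rw [update_st_0]
      cases c with
      | nil => exact .cases_nil rfl (.skip le_rfl) le_rfl
      | cons b c => exact runs_cases_st_2 (.skip le_rfl)) x y
  have h₂ : ∀ x y : List Bool, x.foldl (fun c _ => c.tail) y = y.drop x.length := by
    intro x
    induction x with
    | nil => intro y; simp
    | cons a x ih => intro y; cases y <;> simp [ih]
  rw [h₂] at h₁
  refine (Runs.seq h₁ (runs_xfer_st_2 _ _ _ _) ?_).congr (by simp)
  simp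
  omega

theorem comput_take : Comput₂ B fun x y => y.take x.length := by
  refine comput₂_of_runs (p := .seq (.forEach 0 fun _ => .cases 2 .skip fun b => .push 3 b)
    (.seq (.clear 2) (.mv 3 1))) (by simp [Prog.Det, Prog.det_forEach]) 20 fun x y => ?_
  have h₁ := runs_forEach (a := (0 : Fin 5)) (p := fun _ => .cases 2 .skip fun b => .push 3 b)
    (fun l c => st l [] c.1 c.2 [])
    (fun c _ => match c.1 with
      | [] => c
      | b :: y => (y, b :: c.2)) (k := 3)
    (fun _ _ => rfl) (by
      intro a l c
      rw [update_st_0]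
      obtain ⟨_ | ⟨b, y⟩, e⟩ := c
      · exact .cases_nil rfl (.skip (t := 2) (by omega)) le_rfl
      · exact runs_cases_st_2 (runs_push_st_3 _ _ _ _ _ _)) x (y, [])
  have h₂ : ∀ x y z : List Bool, x.foldl (fun c _ => match c.1 with
      | [] => c
      | b :: y => (y, b :: c.2)) (y, z) = (y.drop x.length, (y.take x.length).reverse ++ z) := by
    intro x
    induction x with
    | nil => intro y z; simp
    | cons a x ih =>
      intro y z
      cases y with
      | nil => simpa using ih [] z
      | cons b y => simpa using ih y (b :: z)
  rw [h₂] at h₁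
  refine (Runs.seq h₁ (.seq (runs_clear_st_2 _ _ _ _ _) (runs_mv_st_3_1 _ _ _ _ _) le_rfl)
    ?_).congr (by simp)
  simp
  omega

/-- A string of length `|y| / |x|` if `|x|` divides `|y|`, otherwise the empty string. -/
def quot (x y : List Bool) : List Bool :=
  if x.length ∣ y.length then List.replicate (y.length / x.length) true else []

/-- Repeated subtraction. A pass takes time proportional to `|x|` and removes `|x|` symbols from
`y`, apart from a possibly incomplete last pass, so the total is linear. Missing symbols in the last
pass are recorded on stack 4 and show that the division is not exact. -/
theorem comput_quot : Comput₂ B quot := by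
  let r : Prog (Fin 5) := .seq (.forEach 0 fun b => .seq (.push 3 b)
    (.cases 2 (.push 4 true) fun _ => .skip)) (.seq (.mv 3 0) (.push 1 true))
  have hr : ∀ x o y e : List Bool, Runs r (st x o y [] e) (13 * x.length + 10)
      (st x (true :: o) (y.drop x.length) []
        (List.replicate (x.length - y.length) true ++ e)) := by
    intro x o y e
    have h₁ := runs_forEach (a := (0 : Fin 5)) (p := fun b => .seq (.push 3 b)
      (.cases 2 (.push 4 true) fun _ => .skip))
      (fun l (c : List Bool × List Bool × List Bool) => st l o c.1 c.2.1 c.2.2)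
      (fun c b => match c.1 with
        | [] => ([], b :: c.2.1, true :: c.2.2)
        | _ :: y => (y, b :: c.2.1, c.2.2)) (k := 6)
      (fun _ _ => rfl) (by
        intro a l c
        rw [update_st_0]
        obtain ⟨_ | ⟨b, y⟩, z, e⟩ := c
        · exact .seq (runs_push_st_3 _ _ _ _ _ _)
            (.cases_nil rfl (runs_push_st_4 _ _ _ _ _ _) le_rfl) le_rfl
        · exact .seq (runs_push_st_3 _ _ _ _ _ _) (runs_cases_st_2 (.skip le_rfl)) (by omega))
      x (y, [], e)
    have h₂ : ∀ x y z e : List Bool, x.foldl (fun (c : List Bool × List Bool × List Bool) b =>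
        match c.1 with
        | [] => ([], b :: c.2.1, true :: c.2.2)
        | _ :: y => (y, b :: c.2.1, c.2.2)) (y, z, e) = (y.drop x.length, x.reverse ++ z,
          List.replicate (x.length - y.length) true ++ e) := by
      intro x
      induction x with
      | nil => intro y z e; simp
      | cons a x ih =>
        intro y z e
        cases y with
        | nil =>
          rw [List.foldl_cons]
          simp only []
          rw [ih]
          simp [List.replicate_succ']
        | cons b y =>
          rw [List.foldl_cons]
          simp only []
          rw [ih]
          simp
    rw [h₂] at h₁
    refine (Runs.seq h₁ (.seq (runs_mv_st_3_0 _ _ _ _ _) (runs_push_st_1 _ _ _ _ _ _) le_rfl)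
      ?_).congr (by simp)
    simp
    omega
  have hl : ∀ x : List Bool, x ≠ [] → ∀ (n : ℕ) (y o : List Bool), y.length ≤ n →
      -- A full pass costs `13 * |x| + 11`, which is at most `24 * |x|` since `x` is not empty.
      ∃ q e, Runs (.loop 2 r) (st x o y [] []) (24 * (y.length + x.length) + 1)
        (st x (List.replicate q true ++ o) [] [] e) ∧ (e = [] ↔ x.length ∣ y.length) ∧
        (e = [] → q = y.length / x.length) ∧ q ≤ y.length ∧ e.length ≤ x.length := by
    intro x hx n
    have hx' : 0 < x.length := List.length_pos_iff.2 hx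
    induction n with
    | zero =>
      intro y o hy
      obtain rfl : y = [] := List.eq_nil_of_length_eq_zero (by omega)
      exact ⟨0, [], .loop_nil rfl (by omega), by simp, by simp, by simp, by simp⟩
    | succ n ih =>
      intro y o hy
      rcases y.eq_nil_or_concat with rfl | hy0
      · exact ⟨0, [], .loop_nil rfl (by omega), by simp, by simp, by simp, by simp⟩
      have hy' : y ≠ [] := by rintro rfl; simp at hy0
      have hy'' : 0 < y.length := List.length_pos_iff.2 hy'
      rcases le_or_gt x.length y.length with hle | hlt
      · have h₁ := hr x o y []
        rw [Nat.sub_eq_zero_of_le hle, List.replicate_zero, List.append_nil] at h₁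
        obtain ⟨q, e, h, hd, hq, hq', he⟩ := ih (y.drop x.length) (true :: o) (by simp; omega)
        rw [List.length_drop] at h hd hq hq'
        refine ⟨q + 1, e, (Runs.loop_cons hy' h₁ h (by omega)).congr ?_, ?_, ?_, by omega, he⟩
        · rw [List.replicate_succ']; simp
        · rw [hd, Nat.dvd_sub_iff_left hle dvd_rfl]
        · intro h
          rw [hq h, Nat.div_eq_sub_div hx' hle]
      · have h₁ := hr x o y []
        rw [List.drop_eq_nil_of_le hlt.le] at h₁
        refine ⟨1, _, .loop_cons hy' h₁ (.loop_nil rfl le_rfl) (by omega), ?_, ?_, hy'', ?_⟩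
        · simp only [List.append_nil, List.replicate_eq_nil_iff]
          constructor
          · intro h; omega
          · intro h; have := Nat.le_of_dvd hy'' h; omega
        · simp only [List.append_nil, List.replicate_eq_nil_iff]
          intro h; omega
        · simp
  refine comput₂_of_runs (p := .cases 0 (.clear 2) fun b => .seq (.push 0 b) (.seq (.loop 2 r)
    (.seq (.clear 0) (.cases 4 .skip fun _ => .seq (.clear 4) (.clear 1))))) ?_ 40 fun x y => ?_
  · simp [Prog.Det, Prog.det_forEach, r]
  cases x with
  | nil =>
    refine .cases_nil rfl ((runs_clear_st_2 _ _ _ _ _).congr ?_) (by simp; omega)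
    -- Zero divides only zero, and the quotient `0 / 0` is `0`, so the result is empty in either
    -- case.
    by_cases h : y.length = 0 <;> simp [quot, h]
  | cons a x =>
    obtain ⟨q, e, h, hd, hq, hq', he⟩ := hl (a :: x) (by simp) _ y [] le_rfl
    refine (runs_cases_st_0 (.seq (runs_push_st_0 _ _ _ _ _ _) (.seq h (.seq
      (runs_clear_st_0 _ _ _ _ _) ?_ (t₂ := 3 * x.length + 3 * y.length + 6)
      le_rfl) le_rfl) le_rfl)).mono (by simp; omega)
    cases e with
    | nil =>
      rw [quot, if_pos (hd.1 rfl), hq rfl]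
      exact (Runs.cases_nil rfl (.skip le_rfl) (by omega)).congr (by simp)
    | cons b e =>
      rw [quot, if_neg (by simpa using hd)]
      refine (runs_cases_st_4 (.seq (runs_clear_st_4 _ _ _ _ _) (runs_clear_st_1 _ _ _ _ _)
        le_rfl)).mono ?_
      simp at he ⊢
      omega

end Elementary

/-! ## Machines and computable functions -/

namespace Machine

variable {M : Machine}

theorem Bounded.exists_halted {c : M.Cfg} {t : ℕ} (h : M.Bounded c t) :
    ∃ n ≤ t, ∃ d, M.Reaches n c d ∧ M.Halted d := by
  induction t generalizing c with
  | zero =>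
    refine ⟨0, le_rfl, c, rfl, Set.eq_empty_iff_forall_notMem.2 fun a ha => ?_⟩
    have := h 1 _ ⟨_, ⟨a, ha, rfl⟩, rfl⟩
    omega
  | succ t ih =>
    by_cases hc : M.Halted c
    · exact ⟨0, by omega, c, rfl, hc⟩
    obtain ⟨a, ha⟩ := Set.nonempty_iff_ne_empty.2 hc
    obtain ⟨n, hn, d, hd, hh⟩ := ih (c := M.act c a) fun n d hd => by
      have := h (n + 1) d ⟨_, ⟨a, ha, rfl⟩, hd⟩
      omega
    exact ⟨n + 1, by omega, d, ⟨_, ⟨a, ha, rfl⟩, hd⟩, hh⟩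

theorem Deterministic.halted_unique (hM : M.Deterministic) {c d d' : M.Cfg} {n m : ℕ}
    (h : M.Reaches n c d) (hd : M.Halted d) (h' : M.Reaches m c d') (hd' : M.Halted d') :
    d = d' := by
  induction n generalizing c m with
  | zero =>
    obtain rfl : c = d := h
    exact ((ends_of_halted (P := fun e => e = d') hd).1 ⟨m, d', h', hd', rfl⟩)
  | succ n ih =>
    cases m with
    | zero =>
      obtain rfl : c = d' := h'
      have := bounded_of_halted hd' _ _ h
      omega
    | succ m =>
      obtain ⟨e, ⟨a, ha, rfl⟩, he⟩ := h
      obtain ⟨e', ⟨a', ha', rfl⟩, he'⟩ := h'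
      rw [hM _ _ _ ha ha'] at he
      exact ih he he'

end Machine

section

variable {B : (ℕ → ℕ) → Prop} [Growth B]

theorem Comput.exists_machine {f : List Bool → List Bool} (hf : Comput B f) :
    ∃ (M : Machine) (t : ℕ → ℕ), B t ∧ M.Deterministic ∧ ∀ x, M.RunsIn x (t x.length) ∧
      M.Outputs x (f x) ∧ (M.Accepts x ↔ (f x).getLastD false = true) := by
  obtain ⟨u, hu, -, hfu⟩ := hf.length_le
  -- The compiled machine loads its input in reverse order, which this composition undoes.
  obtain ⟨ι, _, _, i, o, p, t, hp, ht, h⟩ := hf.comp comput_reverse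
  obtain ⟨k, ⟨e⟩⟩ := Finite.exists_equiv_fin ι
  refine ⟨compile e p i o, fun n => (2 * n + 2) + t n + u n,
    Growth.add (Growth.add (Growth.lin 2) ht) hu, compile_deterministic e hp i o, fun x => ?_⟩
  have h₁ := h x.reverse trivial
  simp only [List.reverse_reverse] at h₁
  obtain ⟨h₂, h₃, h₄⟩ := compile_spec (e := e) (o := o) h₁
  simp only [single, update_self] at h₂ h₃ h₄
  refine ⟨Machine.Bounded.mono h₂ ?_, h₃, h₄⟩
  have := hfu x
  rw [List.length_reverse]
  beta_reduce
  omega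

theorem growth_sim {t : ℕ → ℕ} (ht : B t) (K : ℕ) : B fun n => K * (t n + n + 1) := by
  refine Growth.le (Growth.comp (Growth.lin K) (Growth.add ht (Growth.lin 1))) fun n => ?_
  have : K * (t n + n + 1) ≤ K * (t n + (1 * n + 1)) := Nat.mul_le_mul_left _ (by omega)
  omega

theorem computOn_of_outputs {M : Machine} (hM : M.Deterministic) {t : ℕ → ℕ} (ht : B t)
    {D : Set (List Bool)} {f : List Bool → List Bool}
    (h : ∀ x ∈ D, M.RunsIn x (t x.length) ∧ M.Outputs x (f x)) : ComputOn B D f := by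
  obtain ⟨p, K, hp, hK⟩ := exists_prog_output hM
  classical
  refine ⟨SimReg M.tapes, inferInstance, inferInstance, .inl 0, .inl 5, p,
    fun n => K * (t n + n + 1), hp, growth_sim ht K, fun x hx => ?_⟩
  obtain ⟨h₁, n, d, hd, hh, hy⟩ := h x hx
  rw [← hy]
  refine ((hK x n d hd hh).mono ?_)
  exact Nat.mul_le_mul_left _ (by have := h₁ n d hd; omega)

open Classical in
/-- The characteristic function of a language. -/
noncomputable def chi (L : Language Bool) (x : List Bool) : List Bool :=
  if x ∈ L then [true] else []

theorem comput_chi_of_accepts {M : Machine} (hM : M.Deterministic) {t : ℕ → ℕ} (ht : B t)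
    {L : Language Bool} (h : ∀ x, M.RunsIn x (t x.length) ∧ (x ∈ L ↔ M.Accepts x)) :
    Comput B (chi L) := by
  obtain ⟨p, K, hp, hK⟩ := exists_prog_accept hM
  classical
  refine ⟨SimReg M.tapes, inferInstance, inferInstance, .inl 0, .inl 5, p,
    fun n => K * (t n + n + 1), hp, growth_sim ht K, fun x _ => ?_⟩
  obtain ⟨h₁, h₂⟩ := h x
  obtain ⟨n, hn, d, hd, hh⟩ := Machine.Bounded.exists_halted h₁
  have : chi L x = if d.state ∈ M.accepting then [true] else [] := by
    refine if_congr (h₂.trans ⟨?_, fun h => ⟨n, d, hd, hh, h⟩⟩) rfl rfl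
    rintro ⟨m, d', hd', hh', h'⟩
    rwa [hM.halted_unique hd hh hd' hh']
  rw [this]
  refine ((hK x n d hd hh).mono ?_).congr ?_
  · exact Nat.mul_le_mul_left _ (by omega)
  · congr 1

end

theorem chi_eq_true {L : Language Bool} {x : List Bool} : chi L x = [true] ↔ x ∈ L := by
  simp [chi]

open Classical in
-- Both translations, from machines to programs and back, lose only a constant factor. From here on,
-- linear time is handled through `Comput LinB`.
theorem mem_DLIN_iff {L : Language Bool} : L ∈ DLIN ↔ Comput LinB (chi L) := by
  constructor
  · rintro ⟨M, c, hM, h⟩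
    exact comput_chi_of_accepts hM (t := fun n => c * n + c) ⟨c, fun _ => le_rfl⟩ h
  · intro h
    obtain ⟨M, t, ⟨c, hc⟩, hM, h⟩ := h.exists_machine
    refine ⟨M, c, hM, fun x => ?_⟩
    obtain ⟨h₁, -, h₂⟩ := h x
    refine ⟨Machine.Bounded.mono h₁ (hc _), ?_⟩
    rw [h₂]
    unfold chi
    split <;> simp_all

theorem linTimeComputable_iff {r : List Bool → List Bool} :
    LinTimeComputable r ↔ Comput LinB r := by
  constructor
  · rintro ⟨M, c, hM, h⟩
    exact computOn_of_outputs hM (t := fun n => c * n + c) ⟨c, fun _ => le_rfl⟩ fun x _ => h x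
  · intro h
    obtain ⟨M, t, ⟨c, hc⟩, hM, h⟩ := h.exists_machine
    exact ⟨M, c, hM, fun x => ⟨Machine.Bounded.mono (h x).1 (hc _), (h x).2.1⟩⟩

open Classical in
theorem closed_DLIN : ClosedUnderLinTimeReductions DLIN := by
  intro r L L' hr hL' h
  rw [mem_DLIN_iff] at hL' ⊢
  convert hL'.comp (linTimeComputable_iff.1 hr) using 2 with x
  exact if_congr (h x) rfl rfl

theorem LinB.polyB {t : ℕ → ℕ} (h : LinB t) : PolyB t := by
  obtain ⟨c, hc⟩ := h
  exact Growth.le (Growth.lin c) hc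

theorem Comput.poly {f : List Bool → List Bool} (h : Comput LinB f) : Comput PolyB f := by
  obtain ⟨ι, h₁, h₂, i, o, p, t, hp, ht, h⟩ := h
  exact ⟨ι, h₁, h₂, i, o, p, t, hp, ht.polyB, h⟩

/-- Brings polynomial bounds into the form used in `NTIME`; the additive constant serves `n = 0`,
and `n + 2 ≤ 3 * n` otherwise. -/
theorem add_two_pow_le (n c : ℕ) : (n + 2) ^ c ≤ 3 ^ c * n ^ c + 3 ^ c := by
  rcases Nat.eq_zero_or_pos n with rfl | hn
  · have : 2 ^ c ≤ 3 ^ c := Nat.pow_le_pow_left (by omega) _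
    rw [zero_add]
    omega
  · rw [← mul_pow]
    exact (Nat.pow_le_pow_left (by omega) _).trans (Nat.le_add_right _ _)

/-! ## Guessing -/

/-- The machine has three phases. A deterministic one prepares `u x`, whose length says how much to
guess, and the reversed code of `x`; the guess loop pushes `w` on top of this code; a deterministic
verifier is run on the result. The outer phases are covered by `leads_run`, the middle one by
`guessLoop_spec`. As the verdict is `[true]` or `[]`, it agrees with the acceptance convention of
compiled machines. -/
theorem mem_NP_of_comput {u V : List Bool → List Bool} (hu : Comput PolyB u)
    (hV : Comput PolyB V) {L : Language Bool}
    (hL : ∀ x, x ∈ L ↔ ∃ w : List Bool, w.length = (u x).length ∧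
      V (w ++ (doubleBits x ++ [false, true]).reverse) = [true])
    (hV' : ∀ z, V z = [true] ∨ V z = []) : L ∈ NP := by
  have hc : Comput PolyB fun x => (doubleBits x ++ [false, true]).reverse :=
    comput_reverse.comp (comput_append.comp comput_doubleBits (comput_const _))
  obtain ⟨U, hU, -, hfU⟩ := hu.length_le
  obtain ⟨C, hC, -, hfC⟩ := hc.length_le
  obtain ⟨ι, _, _, fi, fo, p, t, hp, ht, hf⟩ := hu.comp comput_reverse
  obtain ⟨κ, _, _, gi, go, q, t', hq, ht', hg⟩ := hc.comp comput_reverse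
  obtain ⟨μ, _, _, hi, ho, r, t₁, hr, ht₁, hm, hh⟩ := ComputOn.mono hV
  obtain ⟨ω, _, _, sf, sg, sh, X, T, isf, isg, ish, hfg, hfh, hgh, hfX, hfT, hgX, hgT, hhX, hhT,
    hXT⟩ := exists_stacks ι κ μ
  obtain ⟨k, ⟨e⟩⟩ := Finite.exists_equiv_fin ω
  obtain ⟨P₁, hP₁⟩ : ∃ P₁ : Prog ω, P₁ =
    .seq (.xfer₂ X T (sf fi) (sg gi)) (.seq (p.map sf) (q.map sg)) := ⟨_, rfl⟩
  obtain ⟨P₂, hP₂⟩ : ∃ P₂ : Prog ω, P₂ = .seq (.xfer (sg go) T (sh hi)) (r.map sh) := ⟨_, rfl⟩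
  obtain ⟨P, hP⟩ : ∃ P : Prog ω, P = .seq P₁ (.seq (guessLoop (sf fo) (sg go)) P₂) := ⟨_, rfl⟩
  have hB : PolyB fun n => (11 * n + 11) + t n + t' n + (4 * U n + 4) +
      (8 * (U n + C n) + 8) + t₁ (U n + C n) + 1 := by
    refine Growth.add (Growth.add (Growth.add (Growth.add (Growth.add (Growth.add
      (Growth.lin 11) ht) ht') (Growth.comp (s := fun n => 4 * n + 4) (Growth.lin 4) hU))
      (Growth.comp (s := fun n => 8 * n + 8) (Growth.lin 8) (Growth.add hU hC)))
      (Growth.comp ht₁ (Growth.add hU hC))) ⟨0, fun n => by simp⟩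
  obtain ⟨b, hb⟩ := Growth.add hB (Growth.lin (B := PolyB) 20)
  have key : ∀ x, (compile e P X (sh ho)).RunsIn x ((x.length + 2) ^ b) ∧
      ((compile e P X (sh ho)).Accepts x ↔ x ∈ L) := by
    intro x
    have h₁ := runs_xfer₂_single (hfX fi).symm hXT (hgX gi).symm (hfT fi) (hfg fi gi)
      (hgT gi).symm x.reverse
    have h₂ := (hf x.reverse trivial).embed_single isf (fun a => hfg a gi) x.reverse
    have h₃ := (hg x.reverse trivial).embed_single isg (fun a => (hfg fo a).symm) (u x)
    simp only [List.reverse_reverse] at h₂ h₃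
    rw [update_single_comm (hfg _ _).symm, update_single_comm (hfg _ _).symm] at h₃
    have hR₁ := Runs.seq h₁ (.seq h₂ h₃ le_rfl) le_rfl
    rw [← hP₁] at hR₁
    obtain ⟨w₀, hw₀⟩ : ∃ w₀, (doubleBits x ++ [false, true]).reverse = w₀ := ⟨_, rfl⟩
    have hw₀C : w₀.length ≤ C x.length := hw₀ ▸ hfC x
    rw [hw₀] at hR₁
    have hR₂ : ∀ w : List Bool, w.length = (u x).length → Runs P₂ (single (sg go) (w ++ w₀))
        ((8 * (U x.length + C x.length) + 8) + t₁ (U x.length + C x.length) + 1)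
        (single (sh ho) (V (w ++ w₀))) := by
      intro w hw
      have hl : (w ++ w₀).length ≤ U x.length + C x.length := by
        have := hfU x
        rw [List.length_append]
        omega
      have h₄ := runs_xfer_single (hgh go hi) (hgT go) (hgX go) (hhT hi) (hhX hi) hXT.symm
        (w ++ w₀) []
      rw [update_single_nil (hgX _), update_single_nil (hhX _)] at h₄
      have h₅ := (hh (w ++ w₀) trivial).embed_single ish hhX []
      rw [update_single_nil (hhX _), update_single_nil (hhX _)] at h₅
      rw [hP₂]
      refine .seq h₄ (h₅.mono (hm hl)) ?_
      omega
    -- The control stacks of the whole program are listed by phase, so that each phase can be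
    -- followed within the same machine.
    have hPc : P.conts [] = {P :: []} ∪ (P₁.conts [.seq (guessLoop (sf fo) (sg go)) P₂] ∪
        ({[.seq (guessLoop (sf fo) (sg go)) P₂]} ∪ ((guessLoop (sf fo) (sg go)).conts [P₂] ∪
          P₂.conts []))) := by
      rw [hP]
      simp only [Prog.conts]
      ext K
      have := P₁.mem_conts [.seq (guessLoop (sf fo) (sg go)) P₂]
      have := P₂.mem_conts []
      simp only [Set.mem_union, Set.mem_insert_iff, Set.mem_singleton_iff]
      constructor
      · rintro ((h | rfl) | h | (h | rfl) | h | h) <;> simp_all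
      · rintro (h | h | h | h | h) <;> simp_all
    have hc₁ : P₁.conts [.seq (guessLoop (sf fo) (sg go)) P₂] ⊆ P.conts [] := by
      rw [hPc]; intro K hK; simp [hK]
    have hc₂ : (guessLoop (sf fo) (sg go)).conts [P₂] ⊆ P.conts [] := by
      rw [hPc]; intro K hK; simp [hK]
    have hc₃ : P₂.conts [] ⊆ P.conts [] := by
      rw [hPc]; intro K hK; simp [hK]
    obtain ⟨inp, l₁⟩ := leads_load (e := e) (p := P) (i := X) (o := sh ho) (s := fun _ => [])
      (out := []) x (Turing.ListBlank.mk [])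
    rw [← init_compile, List.append_nil] at l₁
    have l₂ : (compile e P X (sh ho)).Leads (stackCfg e P X (sh ho)
        ⟨.run [P], P.cons_mem_conts []⟩ inp (single X x.reverse) [])
        (stackCfg e P X (sh ho) ⟨.run (P₁ :: [.seq (guessLoop (sf fo) (sg go)) P₂]),
          hc₁ (P₁.cons_mem_conts _)⟩ inp (single X x.reverse) []) 1 :=
      leads_idle (c := stackCfg e P X (sh ho) ⟨.run [P], P.cons_mem_conts []⟩ inp
        (single X x.reverse) []) _ (by
          simp only [stackCfg]
          conv_lhs => enter [5, 1, 1]; rw [hP]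
          rfl)
    have l₃ := leads_run (e := e) (p := P) (i := X) (o := sh ho) (inp := inp) (out := []) hR₁ _ hc₁
    have l₄ : (compile e P X (sh ho)).Leads (stackCfg e P X (sh ho)
        ⟨.run [.seq (guessLoop (sf fo) (sg go)) P₂], hc₁ (P₁.mem_conts _)⟩ inp
          (update (single (sf fo) (u x)) (sg go) w₀) [])
        (stackCfg e P X (sh ho) ⟨.run (guessLoop (sf fo) (sg go) :: [P₂]),
          hc₂ (Prog.cons_mem_conts _ _)⟩ inp (update (single (sf fo) (u x)) (sg go) w₀) []) 1 :=
      leads_idle (c := stackCfg e P X (sh ho) ⟨.run [.seq (guessLoop (sf fo) (sg go)) P₂],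
        hc₁ (P₁.mem_conts _)⟩ inp (update (single (sf fo) (u x)) (sg go) w₀) []) _ rfl
    obtain ⟨g₁, g₂⟩ := guessLoop_spec (e := e) (p := P) (i := X) (o := sh ho) (inp := inp)
      (s := update (single (sf fo) (u x)) (sg go) w₀) (out := []) (hfg fo go) hc₂
    have hs : ∀ w : List Bool, update (update (update (update (fun _ => []) (sf fo) (u x)) (sg go)
        w₀) (sf fo) []) (sg go) (w ++ w₀) = update (fun _ => []) (sg go) (w ++ w₀) := by
      intro w
      funext j
      by_cases h₁ : j = sg go
      · subst h₁; simp
      by_cases h₂ : j = sf fo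
      · subst h₂; simp [hfg]
      simp [h₁, h₂]
    simp only [update_self, hs, update_of_ne (hfg fo go), single] at g₁ g₂
    have l₅ : ∀ w : List Bool, w.length = (u x).length → ∃ d, (compile e P X (sh ho)).Leads
        (stackCfg e P X (sh ho) ⟨.run [P₂], hc₂ (Prog.mem_conts _ _)⟩ inp
          (single (sg go) (w ++ w₀)) []) d ((8 * (U x.length + C x.length) + 8) +
          t₁ (U x.length + C x.length) + 1 + 2) ∧ (compile e P X (sh ho)).Halted d ∧
          (d.state ∈ (compile e P X (sh ho)).accepting ↔ V (w ++ w₀) = [true]) := by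
      intro w hw
      have l₆ := leads_run (e := e) (p := P) (i := X) (o := sh ho) (inp := inp) (out := [])
        (hR₂ w hw) [] hc₃
      obtain ⟨d, l₇, hd, -, hst⟩ := leads_halt (e := e) (p := P) (i := X) (o := sh ho) (inp := inp)
        (s := single (sh ho) (V (w ++ w₀))) (out := [])
      simp only [single, update_self] at l₇ hst
      refine ⟨d, (l₆.trans l₇).mono ?_, hd, ?_⟩
      · rcases hV' (w ++ w₀) with h | h <;> simp [h]
      · change d.state.1 = .unload true ↔ _
        rw [hst]
        rcases hV' (w ++ w₀) with h | h <;> simp [h]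
    have l := ((l₁.trans l₂).trans l₃).trans l₄
    refine ⟨?_, ?_⟩
    · have := l.1 _ (g₁ ((8 * (U x.length + C x.length) + 8) +
          t₁ (U x.length + C x.length) + 1 + 2) fun w hw => by
        obtain ⟨d, hd, hh, -⟩ := l₅ w hw
        exact (hd.1 0 (Machine.bounded_of_halted hh)).mono (by omega))
      refine Machine.Bounded.mono this ((?_ : _ ≤ _).trans (hb x.length))
      have := hfU x
      simp only [List.length_reverse]
      omega
    · refine (l.2 fun c => c.state ∈ (compile e P X (sh ho)).accepting).trans ?_
      rw [hL]
      refine (g₂ _).trans (exists_congr fun w => and_congr_right fun hw => ?_)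
      obtain ⟨d, hd, hh, ha⟩ := l₅ w hw
      rw [hw₀, ← ha]
      exact (hd.2 _).trans (Machine.ends_of_halted hh)
  refine Set.mem_iUnion.2 ⟨b, compile e P X (sh ho), 3 ^ b, fun x => ?_⟩
  obtain ⟨h₁, h₂⟩ := key x
  exact ⟨Machine.Bounded.mono h₁ (add_two_pow_le _ _), h₂.symm⟩

/-! ## Sequences and numbers -/

@[simp] theorem doubleBits_nil : doubleBits [] = [] := rfl

@[simp] theorem doubleBits_cons (b : Bool) (x : List Bool) :
    doubleBits (b :: x) = b :: false :: doubleBits x := rfl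

@[simp] theorem length_doubleBits (x : List Bool) : (doubleBits x).length = 2 * x.length := by
  induction x with
  | nil => rfl
  | cons b x ih => simp [ih]; omega

@[simp] theorem tuple_nil : tuple [] = [] := rfl

@[simp] theorem tuple_singleton (a : List Bool) : tuple [a] = doubleBits a := by
  simp [tuple, List.intercalate]

theorem tuple_cons_cons (a b : List Bool) (xs : List (List Bool)) :
    tuple (a :: b :: xs) = doubleBits a ++ ([false, true] ++ tuple (b :: xs)) := by
  simp [tuple, List.intercalate]

theorem splitCode_append (a r : List Bool) :
    splitCode (doubleBits a ++ (false :: true :: r)) = (a, r) := by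
  induction a with
  | nil => rfl
  | cons b a ih => simp [splitCode, ih]

theorem splitCode_doubleBits (a : List Bool) : splitCode (doubleBits a) = (a, []) := by
  induction a with
  | nil => rfl
  | cons b a ih => simp [splitCode, ih]

@[simp] theorem hd_append (a r : List Bool) : hd (doubleBits a ++ (false :: true :: r)) = a := by
  rw [hd, splitCode_append]

@[simp] theorem tl_append (a r : List Bool) : tl (doubleBits a ++ (false :: true :: r)) = r := by
  rw [tl, splitCode_append]

@[simp] theorem hd_tuple (a : List Bool) (xs : List (List Bool)) : hd (tuple (a :: xs)) = a := by
  cases xs with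
  | nil => rw [tuple_singleton, hd, splitCode_doubleBits]
  | cons b xs => rw [tuple_cons_cons]; exact hd_append _ _

@[simp] theorem tl_tuple (a : List Bool) (xs : List (List Bool)) :
    tl (tuple (a :: xs)) = tuple xs := by
  cases xs with
  | nil => rw [tuple_singleton, tl, splitCode_doubleBits]; rfl
  | cons b xs => rw [tuple_cons_cons]; exact tl_append _ _

/-- A component of a sequence, counted from `0`. -/
def nth (k : ℕ) (x : List Bool) : List Bool := hd (tl^[k] x)

theorem nth_zero (x : List Bool) : nth 0 x = hd x := rfl

theorem nth_succ (k : ℕ) (x : List Bool) : nth (k + 1) x = nth k (tl x) := rfl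

@[simp] theorem nth_tuple (k : ℕ) (xs : List (List Bool)) : nth k (tuple xs) = xs.getD k [] := by
  induction k generalizing xs with
  | zero =>
    cases xs with
    | nil => rfl
    | cons a xs => rw [nth_zero, hd_tuple]; rfl
  | succ k ih =>
    cases xs with
    | nil =>
      rw [nth_succ, show tl (tuple []) = tuple [] from rfl, ih]
      rfl
    | cons a xs => rw [nth_succ, tl_tuple, ih]; simp

theorem length_tuple_cons_cons (a b : List Bool) (xs : List (List Bool)) :
    (tuple (a :: b :: xs)).length = 2 * a.length + 2 + (tuple (b :: xs)).length := by
  rw [tuple_cons_cons]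
  simp
  omega

/-- The sequence `cs`, followed by `r`. -/
def enc (cs : List (List Bool)) (r : List Bool) : List Bool :=
  cs.foldr (fun c z => doubleBits c ++ (false :: true :: z)) r

/-- Every component is closed by a separator, so the trailing string `r` is not seen. It will serve
as padding up to the prescribed block size. -/
theorem nth_enc {k : ℕ} {cs : List (List Bool)} (hk : k < cs.length) (r : List Bool) :
    nth k (enc cs r) = cs.getD k [] := by
  induction k generalizing cs with
  | zero =>
    cases cs with
    | nil => simp at hk
    | cons c cs => simp [nth, enc]
  | succ k ih =>
    cases cs with
    | nil => simp at hk
    | cons c cs =>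
      have : tl (enc (c :: cs) r) = enc cs r := by simp [enc]
      rw [nth_succ, this, ih (by simpa using hk)]
      simp

theorem length_enc (cs : List (List Bool)) (r : List Bool) :
    (enc cs r).length = 2 * (cs.map List.length).sum + 2 * cs.length + r.length := by
  induction cs with
  | nil => simp [enc]
  | cons c cs ih =>
    have : enc (c :: cs) r = doubleBits c ++ (false :: true :: enc cs r) := rfl
    rw [this]
    simp [ih]
    omega

/-- The number with the given digits. -/
def val : List Bool → ℕ
  | [] => 0
  | b :: l => b.toNat + 2 * val l

theorem val_bits (n : ℕ) : val (Nat.bits n) = n := by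
  induction n using Nat.binaryRec' with
  | zero => simp [val]
  | bit b n h ih =>
    rw [Nat.bits_append_bit n b h, val, ih, Nat.bit_val]
    omega

theorem bits_injective : Injective Nat.bits := fun a b h => by
  rw [← val_bits a, h, val_bits]

theorem val_append (l l' : List Bool) : val (l ++ l') = val l + 2 ^ l.length * val l' := by
  induction l with
  | nil => simp [val]
  | cons b l ih => simp only [List.cons_append, val, ih, List.length_cons, pow_succ]; ring

theorem val_lt (l : List Bool) : val l < 2 ^ l.length := by
  induction l with
  | nil => simp [val]
  | cons b l ih =>
    have : b.toNat ≤ 1 := Bool.toNat_le b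
    simp only [val, List.length_cons, pow_succ]
    omega

/-- Nonzero numerals are exactly the strings that end with `1`. Appending this digit turns arbitrary
strings into numerals, so strings can serve as indices. -/
theorem bits_val_append_true (l : List Bool) : Nat.bits (val (l ++ [true])) = l ++ [true] := by
  induction l with
  | nil => simp [val]
  | cons b l ih =>
    have h : val (l ++ [true]) ≠ 0 := by
      intro h
      rw [h] at ih
      simp at ih
    rw [List.cons_append, val, ← ih, val_bits, ← Nat.bits_append_bit _ b fun h' => absurd h' h,
      Nat.bit_val, add_comm]

theorem exists_bits_eq {n : ℕ} (hn : n ≠ 0) : ∃ l, Nat.bits n = l ++ [true] := by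
  induction n using Nat.binaryRec' with
  | zero => exact absurd rfl hn
  | bit b n h ih =>
    rw [Nat.bits_append_bit n b h]
    by_cases h₀ : n = 0
    · subst h₀
      rw [h rfl]
      exact ⟨[], by simp⟩
    · obtain ⟨l, hl⟩ := ih h₀
      exact ⟨b :: l, by rw [hl]; rfl⟩

/-- Exponentials of numeral lengths stay linear; this keeps indices that are composed of numerals
within a polynomial range. -/
theorem two_pow_length_bits_le (n : ℕ) : 2 ^ (Nat.bits n).length ≤ 2 * n + 1 := by
  by_cases hn : n = 0
  · subst hn; simp
  · obtain ⟨l, hl⟩ := exists_bits_eq hn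
    have h := val_bits n
    rw [hl, val_append] at h
    have : val [true] = 1 := rfl
    rw [this] at h
    rw [hl, List.length_append, List.length_singleton, pow_succ]
    omega

theorem length_bits_le (n : ℕ) : (Nat.bits n).length ≤ 2 * n + 1 :=
  Nat.lt_two_pow_self.le.trans (two_pow_length_bits_le n)

theorem bits_succ (n : ℕ) : Nat.bits (n + 1) = incr (Nat.bits n) := by
  induction n using Nat.binaryRec' with
  | zero => simp [incr]
  | bit b n h ih =>
    rw [Nat.bits_append_bit n b h]
    cases b with
    | false =>
      have h₁ : Nat.bit false n + 1 = Nat.bit true n := by simp [Nat.bit_val]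
      rw [h₁, Nat.bits_append_bit n true (by simp), incr]
    | true =>
      have h₁ : Nat.bit true n + 1 = Nat.bit false (n + 1) := by simp [Nat.bit_val]; omega
      rw [h₁, Nat.bits_append_bit _ false (by omega), incr, ih]

theorem canon_append_true (l : List Bool) : canon (l ++ [true]) = l ++ [true] := by
  simp [canon]

theorem canon_append_false (l : List Bool) : canon (l ++ [false]) = canon l := by
  simp [canon]

theorem canon_eq (l : List Bool) : canon l = Nat.bits (val l) := by
  induction l using List.reverseRecOn with
  | nil => simp [canon, val]
  | append_singleton l b ih =>
    cases b with
    | false => rw [canon_append_false, ih, val_append]; simp [val]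
    | true => rw [canon_append_true, bits_val_append_true]

theorem canon_bits (n : ℕ) : canon (Nat.bits n) = Nat.bits n := by
  rw [canon_eq, val_bits]

/-- The number of a string, in the lexicographic order from the end. -/
def num (l : List Bool) : ℕ := val (l ++ [true])

theorem bits_num (l : List Bool) : Nat.bits (num l) = l ++ [true] := bits_val_append_true l

theorem num_cons (b : Bool) (l : List Bool) : num (b :: l) = b.toNat + 2 * num l := rfl

theorem num_pos (l : List Bool) : 0 < num l := by
  rw [Nat.pos_iff_ne_zero]
  intro h
  have := bits_num l
  rw [h] at this
  simp at this

theorem num_lt (l : List Bool) : num l < 2 * 2 ^ l.length := by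
  have := val_lt (l ++ [true])
  rw [List.length_append, List.length_singleton, pow_succ] at this
  rw [num]
  omega

/-! ## Combinations of functions and of properties -/

section

variable {B : (ℕ → ℕ) → Prop} [Growth B] {f g h : List Bool → List Bool}

theorem Comput.congr (hf : Comput B f) (h : ∀ x, f x = g x) : Comput B g := by
  obtain rfl : f = g := funext h
  exact hf

theorem comput_tuple (fs : List (List Bool → List Bool)) (h : ∀ f ∈ fs, Comput B f) :
    Comput B fun x => tuple (fs.map fun f => f x) := by
  induction fs with
  | nil => exact comput_const _
  | cons f fs ih =>
    have hf := h f (by simp)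
    have ih' := ih fun g hg => h g (by simp [hg])
    cases fs with
    | nil => simpa using comput_doubleBits.comp hf
    | cons g fs =>
      have := (comput_append.comp (comput_doubleBits.comp hf)
        (comput_append.comp (comput_const [false, true]) ih'))
      refine this.congr fun x => ?_
      simp only [List.map_cons]
      rw [tuple_cons_cons]

theorem Comput.tuple₂ (hf : Comput B f) (hg : Comput B g) :
    Comput B fun x => tuple [f x, g x] :=
  comput_tuple [f, g] (by simp [hf, hg])

theorem Comput.tuple₃ (hf : Comput B f) (hg : Comput B g) (hh : Comput B h) :
    Comput B fun x => tuple [f x, g x, h x] :=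
  comput_tuple [f, g, h] (by simp [hf, hg, hh])

theorem Comput.tuple₄ {k : List Bool → List Bool} (hf : Comput B f) (hg : Comput B g)
    (hh : Comput B h) (hk : Comput B k) : Comput B fun x => tuple [f x, g x, h x, k x] :=
  comput_tuple [f, g, h, k] (by simp [hf, hg, hh, hk])

theorem comput_nth (k : ℕ) : Comput B (nth k) := by
  induction k with
  | zero => exact comput_hd
  | succ k ih => exact ih.comp comput_tl

theorem Comput.component (hf : Comput B f) (k : ℕ) : Comput B fun x => nth k (f x) :=
  (comput_nth k).comp hf

theorem Comput.append (hf : Comput B f) (hg : Comput B g) : Comput B fun x => f x ++ g x :=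
  comput_append.comp hf hg

theorem Comput.dropLast (hf : Comput B f) : Comput B fun x => (f x).dropLast := by
  refine (comput_reverse.comp (comput_tail.comp (comput_reverse.comp hf))).congr fun x => ?_
  simp [List.tail_reverse]

theorem Comput.drop (hf : Comput B f) (k : ℕ) : Comput B fun x => (f x).drop k := by
  simpa using comput_drop.comp (comput_const (List.replicate k true)) hf

theorem Comput.take (hf : Comput B f) (k : ℕ) : Comput B fun x => (f x).take k := by
  simpa using comput_take.comp (comput_const (List.replicate k true)) hf

theorem Comput.ones (hf : Comput B f) : Comput B fun x => List.replicate (f x).length true :=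
  comput_ones.comp hf

/-- The property is decided by a program whose running time has a bound in `B`. -/
def Dec (B : (ℕ → ℕ) → Prop) (P : List Bool → Prop) : Prop := Comput B (chi {x | P x})

theorem chi_eq {P : List Bool → Prop} [DecidablePred P] (x : List Bool) :
    chi {x | P x} x = if P x then [true] else [] := by
  classical
  exact if_congr Iff.rfl rfl rfl

variable {P Q : List Bool → Prop}

theorem Dec.congr (hP : Dec B P) (h : ∀ x, P x ↔ Q x) : Dec B Q := by
  obtain rfl : P = Q := funext fun x => propext (h x)
  exact hP

theorem Dec.comp (hP : Dec B P) (hf : Comput B f) : Dec B fun x => P (f x) :=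
  Comput.comp (g := chi {x | P x}) hP hf

/-- Both branches are computed, the rejected one is replaced by the empty string, and the results
are concatenated. -/
theorem Comput.ite [DecidablePred P] (hP : Dec B P) (hf : Comput B f) (hg : Comput B g) :
    Comput B fun x => if P x then f x else g x := by
  have := (comput_sel.comp hP hf).append
    (comput_sel.comp (comput_eqT.comp hP (comput_const [])) hg)
  refine this.congr fun x => ?_
  rw [chi_eq]
  by_cases h : P x <;> simp [h, sel, eqT]

theorem dec_of_comput [DecidablePred P] (h : Comput B fun x => if P x then [true] else []) :
    Dec B P :=
  h.congr fun x => (chi_eq x).symm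

open Classical in
theorem Dec.eq (hf : Comput B f) (hg : Comput B g) : Dec B fun x => f x = g x :=
  dec_of_comput ((comput_eqT.comp hf hg).congr fun _ => rfl)

open Classical in
theorem Dec.not (hP : Dec B P) : Dec B fun x => ¬ P x := by
  refine dec_of_comput ((Comput.ite hP (comput_const []) (comput_const [true])).congr fun x => ?_)
  by_cases h : P x <;> simp [h]

open Classical in
theorem Dec.and (hP : Dec B P) (hQ : Dec B Q) : Dec B fun x => P x ∧ Q x := by
  refine dec_of_comput ((Comput.ite hP hQ (comput_const [])).congr fun x => ?_)
  rw [chi_eq]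
  by_cases h : P x <;> simp [h]

theorem Dec.or (hP : Dec B P) (hQ : Dec B Q) : Dec B fun x => P x ∨ Q x :=
  (hP.not.and hQ.not).not.congr fun x => by tauto

theorem Dec.imp (hP : Dec B P) (hQ : Dec B Q) : Dec B fun x => P x → Q x :=
  (hP.not.or hQ).congr fun x => by tauto

open Classical in
theorem Dec.const (p : Prop) : Dec B fun _ => p :=
  dec_of_comput (comput_const _)

theorem Dec.length_eq (hf : Comput B f) (hg : Comput B g) :
    Dec B fun x => (f x).length = (g x).length :=
  (Dec.eq hf.ones hg.ones).congr fun x => by simp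

/-- Comparison of a length with a power of a length. -/
theorem Dec.length_eq_pow (hf : Comput B f) (hg : Comput B g) (e : ℕ) :
    Dec B fun x => g x ≠ [] ∧ (f x).length = (g x).length ^ e := by
  have h₀ : Dec B fun x => g x ≠ [] := (Dec.eq hg (comput_const [])).not
  induction e generalizing f with
  | zero =>
    exact (h₀.and (Dec.length_eq hf (comput_const [true]))).congr fun x => by simp
  | succ e ih =>
    -- The length is divided by `|g x|` once per factor. Computing the power instead could exceed
    -- linear time.
    refine (ih (comput_quot.comp hg hf)).congr fun x => and_congr_right fun hx => ?_
    have hx' : 0 < (g x).length := List.length_pos_iff.2 hx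
    have hp : 0 < (g x).length ^ e := Nat.pow_pos hx'
    rw [quot]
    split
    · next h =>
      obtain ⟨q, hq⟩ := h
      rw [List.length_replicate, hq, Nat.mul_div_cancel_left _ hx', pow_succ', Nat.mul_right_inj
        hx'.ne']
    · next h =>
      simp only [List.length_nil]
      constructor
      · intro h'; omega
      · intro h'; exact absurd ⟨_, h'.trans (pow_succ' _ _)⟩ h

theorem LinB.dec_poly (h : Dec LinB P) : Dec PolyB P := Comput.poly h

end

/-! ## Polynomial time -/

section

variable {f g U : List Bool → List Bool}

theorem PolyB.exists_pow {t : ℕ → ℕ} (ht : PolyB t) : ∃ c, ∀ n, 2 ≤ n → t n ≤ n ^ c := by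
  obtain ⟨c, hc⟩ := ht
  refine ⟨2 * c, fun n hn => (hc n).trans ?_⟩
  rw [pow_mul]
  exact Nat.pow_le_pow_left (by nlinarith) _

theorem PolyB.const (c : ℕ) : PolyB fun _ => c :=
  Growth.le (Growth.lin c) fun n => by simp

theorem PolyB.id : PolyB fun n => n := ⟨1, fun n => by simp⟩

theorem PolyB.pow {t : ℕ → ℕ} (ht : PolyB t) (e : ℕ) : PolyB fun n => t n ^ e := by
  obtain ⟨c, hc⟩ := ht
  exact ⟨c * e, fun n => by rw [pow_mul]; exact Nat.pow_le_pow_left (hc n) _⟩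

/-- Unary multiplication. -/
theorem Comput.mulLen (hf : Comput PolyB f) (hg : Comput PolyB g) :
    Comput PolyB fun x => List.replicate ((f x).length * (g x).length) true := by
  obtain ⟨u, hu, -, hfu⟩ := hf.length_le
  obtain ⟨v, hv, -, hgv⟩ := hg.length_le
  -- The product is accumulated by adding one factor repeatedly; the state carries that factor
  -- along.
  have key : ∀ (k : ℕ) (y : List Bool), (fun z => tuple [nth 0 z, nth 0 z ++ nth 1 z])^[k]
      (tuple [List.replicate y.length true, []]) =
      tuple [List.replicate y.length true, List.replicate (k * y.length) true] := by
    intro k y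
    induction k with
    | zero => simp
    | succ k ih =>
      rw [iterate_succ_apply', ih]
      simp only [nth_tuple, List.getD_cons_zero, List.getD_cons_succ, List.replicate_append_replicate]
      rw [Nat.succ_mul, Nat.add_comm]
  have := Comput.iterate (f := fun x => tuple [List.replicate (g x).length true, []])
    (g := fun z => tuple [nth 0 z, nth 0 z ++ nth 1 z]) (h := f)
    (b := fun n => 2 * v n + 2 + 2 * (u n * v n))
    (hg.ones.tuple₂ (comput_const []))
    ((comput_nth 0).tuple₂ ((comput_nth 0).append (comput_nth 1))) hf ?_ ?_
  · refine (this.component 1).congr fun x => ?_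
    rw [key]
    simp
  · exact Growth.add (Growth.add ((PolyB.const 2).mul hv) (PolyB.const 2))
      ((PolyB.const 2).mul (hu.mul hv))
  · intro x k hk
    rw [key, length_tuple_cons_cons]
    simp only [tuple_singleton, length_doubleBits, List.length_replicate]
    have := hfu x
    have := hgv x
    have : k * (g x).length ≤ u x.length * v x.length := Nat.mul_le_mul (by omega) this
    omega

theorem Comput.powLen (hf : Comput PolyB f) (e : ℕ) :
    Comput PolyB fun x => List.replicate ((f x).length ^ e) true := by
  induction e with
  | zero => exact comput_const _
  | succ e ih => simpa [pow_succ] using ih.mulLen hf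

/-- The binary digits of a length. -/
theorem Comput.bitsLen (hf : Comput PolyB f) : Comput PolyB fun x => Nat.bits (f x).length := by
  obtain ⟨u, hu, -, hfu⟩ := hf.length_le
  have key : ∀ k : ℕ, incr^[k] [] = Nat.bits k := by
    intro k
    induction k with
    | zero => simp
    | succ k ih => rw [iterate_succ_apply', ih, bits_succ]
  have := Comput.iterate (comput_const []) comput_incr hf (b := fun n => 2 * u n + 1)
    (Growth.add ((PolyB.const 2).mul hu) (PolyB.const 1)) (by
      intro x k hk
      rw [key]
      have := length_bits_le k
      have := hfu x
      omega)
  simpa only [key] using this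

/-- Bounded quantifiers. -/
theorem Dec.forall_lt {P : List Bool → Prop} (hP : Dec PolyB P) (hU : Comput PolyB U) :
    Dec PolyB fun x => ∀ k < (U x).length, P (tuple [x, List.replicate k true]) := by
  classical
  obtain ⟨u, hu, -, hfu⟩ := hU.length_le
  -- One round of the search: the state consists of `x`, a unary counter, and a flag that is set
  -- once `P` fails.
  obtain ⟨F, hF⟩ : ∃ F : List Bool → List Bool, F = fun z => tuple [nth 0 z, true :: nth 1 z,
    if P (tuple [nth 0 z, nth 1 z]) then nth 2 z else [true]] := ⟨_, rfl⟩
  have hFc : Comput PolyB F := by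
    rw [hF]
    exact (comput_nth 0).tuple₃ ((comput_const [true]).append (comput_nth 1))
      (Comput.ite (hP.comp ((comput_nth 0).tuple₂ (comput_nth 1))) (comput_nth 2)
        (comput_const _))
  have key : ∀ (k : ℕ) (x : List Bool), F^[k] (tuple [x, [], []]) =
      tuple [x, List.replicate k true,
        if ∀ i < k, P (tuple [x, List.replicate i true]) then [] else [true]] := by
    intro k x
    induction k with
    | zero => simp
    | succ k ih =>
      rw [iterate_succ_apply', ih, hF]
      simp only [nth_tuple, List.getD_cons_zero, List.getD_cons_succ]
      congr 4
      by_cases h : P (tuple [x, List.replicate k true])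
      · rw [if_pos h]
        refine if_congr ?_ rfl rfl
        simp only [Nat.lt_succ_iff_lt_or_eq]
        exact ⟨fun h' i hi => hi.elim (h' i) (fun e => e ▸ h), fun h' i hi => h' i (.inl hi)⟩
      · rw [if_neg h, if_neg]
        exact fun h' => h (h' k (Nat.lt_succ_self k))
  have := Comput.iterate (f := fun x => tuple [x, [], []]) (g := F) (h := U)
    (b := fun n => 2 * n + 2 * u n + 6)
    (comput_id.tuple₃ (comput_const []) (comput_const [])) hFc hU ?_ ?_
  · refine (Dec.eq (this.component 2) (comput_const [])).congr fun x => ?_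
    rw [key]
    simp
  · exact Growth.add (Growth.add ((PolyB.const 2).mul PolyB.id) ((PolyB.const 2).mul hu))
      (PolyB.const 6)
  · intro x k hk
    rw [key, length_tuple_cons_cons, length_tuple_cons_cons]
    have := hfu x
    split <;> simp <;> omega

/-- The property of being the code of a small number. -/
theorem Dec.exists_bits (hf : Comput PolyB f) (hU : Comput PolyB U) :
    Dec PolyB fun x => ∃ k < (U x).length, f x = Nat.bits k := by
  have h : Dec PolyB fun z => f (nth 0 z) ≠ Nat.bits (nth 1 z).length :=
    (Dec.eq (hf.comp (comput_nth 0)) (comput_nth 1).bitsLen).not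
  exact (h.forall_lt hU).not.congr fun x => by simp

/-- Functions of numbers as functions of strings. -/
theorem PolyTimeIndex.exists_comput {f : ℕ → ℕ → ℕ} (hf : PolyTimeIndex f) :
    ∃ φ, Comput PolyB φ ∧ ∀ n i, φ (tuple [List.replicate n true, Nat.bits i]) =
      Nat.bits (f n i) := by
  obtain ⟨M, c, k, hM, h⟩ := hf
  have hB : PolyB fun n => c * n ^ k + c :=
    Growth.add ((PolyB.const c).mul (PolyB.id.pow k)) (PolyB.const c)
  have h₁ := computOn_of_outputs hM hB
    (D := Set.range fun z : ℕ × ℕ => tuple [List.replicate z.1 true, Nat.bits z.2])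
    (f := fun y => Nat.bits (f (nth 0 y).length (val (nth 1 y)))) (by
      rintro _ ⟨⟨n, i⟩, rfl⟩
      have := h n i
      simp only [nth_tuple, List.getD_cons_zero, List.getD_cons_succ, List.length_replicate,
        val_bits]
      exact this)
  -- The machine is reliable only on proper codes of pairs of numbers. Every string is first
  -- normalized to such a code, which makes the function total.
  have h₂ : Comput PolyB fun x => tuple [List.replicate (nth 0 x).length true,
      canon (nth 1 x)] := (comput_nth 0).ones.tuple₂ (comput_canon.comp (comput_nth 1))
  refine ⟨_, h₁.comp h₂ ?_, fun n i => ?_⟩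
  · intro x
    exact ⟨((nth 0 x).length, val (nth 1 x)), by simp [canon_eq]⟩
  · simp [canon_bits, val_bits]

/-- Numerals must not have leading zeros; `canon` turns an arbitrary output into the numeral of its
value. -/
theorem polyTimeIndex_of_comput {φ : List Bool → List Bool} (hφ : Comput PolyB φ) :
    PolyTimeIndex fun n i => val (φ (tuple [List.replicate n true, Nat.bits i])) := by
  obtain ⟨M, t, ⟨c, hc⟩, hM, h⟩ := (comput_canon.comp hφ).exists_machine
  refine ⟨M, 3 ^ c, c, hM, fun n i => ?_⟩
  obtain ⟨h₁, h₂, -⟩ := h (tuple [List.replicate n true, numeral i])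
  refine ⟨Machine.Bounded.mono h₁ ((hc _).trans (add_two_pow_le _ _)), ?_⟩
  rw [canon_eq] at h₂
  exact h₂

end

/-! ## A sufficient condition for membership in `Xi C` -/

/-- The blocks of a guess can be prescribed independently of each other; this converts functions
into guesses. -/
theorem exists_blocks {cnt S : ℕ} {g : ℕ → List Bool} (hg : ∀ J < cnt, (g J).length = S) :
    ∃ w : List Bool, w.length = cnt * S ∧ ∀ J < cnt, block S w J = g J := by
  induction cnt with
  | zero => exact ⟨[], by simp, by simp⟩
  | succ cnt ih =>
    obtain ⟨w, hw, h⟩ := ih fun J hJ => hg J (by omega)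
    have hl := hg cnt (by omega)
    refine ⟨w ++ g cnt, by rw [List.length_append, hw, hl, Nat.succ_mul], fun J hJ => ?_⟩
    rcases Nat.lt_succ_iff_lt_or_eq.1 hJ with hJ | rfl
    · rw [← h J hJ, block, block]
      have h₁ : (J + 1) * S ≤ cnt * S := Nat.mul_le_mul_right _ hJ
      rw [Nat.succ_mul] at h₁
      rw [List.drop_append_of_le_length (by omega), List.take_append_of_le_length]
      rw [List.length_drop]
      omega
    · rw [block, ← hw, List.drop_left, List.take_of_length_le hl.le]

theorem length_block {S : ℕ} {w : List Bool} {J cnt : ℕ} (hw : w.length = cnt * S) (hJ : J < cnt) :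
    (block S w J).length = S := by
  have h₁ : (J + 1) * S ≤ cnt * S := Nat.mul_le_mul_right _ hJ
  rw [Nat.succ_mul] at h₁
  rw [block, List.length_take, List.length_drop]
  omega

/-! ### Linear-time use of a language in the class -/

/-- The language `L₂` can be used in the class `C` as a subroutine that is called once. -/
def Absorbs (C : Set (Language Bool)) (L₂ : Language Bool) : Prop :=
  ∀ (P Q : List Bool → Prop) (ρ : List Bool → List Bool), Dec LinB P → Dec LinB Q →
    Comput LinB ρ → ({z | P z ∨ Q z ∧ ρ z ∈ L₂} : Set (List Bool)) ∈ C

open Classical in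
-- A many-one reduction must ask a question even when the answer is already known; fixed strings
-- inside and outside `L₂` express the two verdicts.
theorem ClosedUnderLinTimeReductions.absorbs {C : Set (Language Bool)}
    (hC : ClosedUnderLinTimeReductions C) {L₂ : Language Bool} (hL₂ : L₂ ∈ C)
    {yes no : List Bool} (hyes : yes ∈ L₂) (hno : no ∉ L₂) : Absorbs C L₂ := by
  intro P Q ρ hP hQ hρ
  refine hC _ _ L₂ (linTimeComputable_iff.2 (Comput.ite hP (comput_const yes)
    (Comput.ite hQ hρ (comput_const no)))) hL₂ fun z => ?_
  change (P z ∨ Q z ∧ ρ z ∈ L₂) ↔ _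
  by_cases h₁ : P z
  · simp [h₁, hyes]
  by_cases h₂ : Q z <;> simp [h₁, h₂, hno]

theorem absorbs_DLIN {L₂ : Language Bool} (hL₂ : L₂ ∈ DLIN) : Absorbs DLIN L₂ := by
  intro P Q ρ hP hQ hρ
  have h₁ : Dec LinB fun z => z ∈ L₂ := mem_DLIN_iff.1 hL₂
  exact mem_DLIN_iff.2 (hP.or (hQ.and (h₁.comp hρ)))

section

variable {B : (ℕ → ℕ) → Prop} [Growth B]

theorem Dec.getD {f : List Bool → List Bool} (hf : Comput B f) (k : ℕ) :
    Dec B fun z => (f z).getD k false = true := by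
  refine (Dec.eq ((hf.drop k).take 1) (comput_const [true])).congr fun z => ?_
  generalize f z = l
  induction k generalizing l with
  | zero => cases l <;> simp
  | succ k ih => cases l with
    | nil => simp
    | cons a l => simpa using ih l

theorem Comput.pick {κ : List Bool → List Bool} (hκ : Comput B κ)
    {F : Bool → Bool → List Bool → List Bool} (hF : ∀ a b, Comput B (F a b)) (i j : ℕ) :
    Comput B fun z => F ((κ z).getD i false) ((κ z).getD j false) z := by
  refine (Comput.ite (Dec.getD hκ i) (Comput.ite (Dec.getD hκ j) (hF true true) (hF true false))
    (Comput.ite (Dec.getD hκ j) (hF false true) (hF false false))).congr fun z => ?_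
  cases (κ z).getD i false <;> cases (κ z).getD j false <;> rfl

/-- Only three strings are concerned, so a finite table decides this for an arbitrary language. -/
theorem dec_short_mem (L : Language Bool) : Dec B fun x => x.tail = [] ∧ x ∈ L := by
  refine (((Dec.eq comput_id (comput_const [])).and (Dec.const ([] ∈ L))).or
    (((Dec.eq comput_id (comput_const [true])).and (Dec.const ([true] ∈ L))).or
    ((Dec.eq comput_id (comput_const [false])).and (Dec.const ([false] ∈ L))))).congr fun x => ?_
  match x with
  | [] => simp
  | [true] => simp
  | [false] => simp
  | a :: b :: l => simp

end

/-! ### Indices of checks and the selection functions -/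

/-- The query with index `l` on input `x`, answered by `W`. -/
def query (σ : Bool → Bool → List Bool → List Bool) (W : List Bool → List Bool)
    (x l : List Bool) : List Bool :=
  let y := tuple [List.replicate x.length true, l]
  tuple [x, l, W (σ false false y), W (σ false true y), W (σ true false y), W (σ true true y)]

section Selection

variable (V : List Bool → Prop) (σ : Bool → Bool → List Bool → List Bool)

/-- An index without the leading digit. -/
def key (z : List Bool) : List Bool := (nth 1 z).dropLast

@[simp] theorem key_num (y κ : List Bool) (r : List (List Bool)) :
    key (tuple (y :: Nat.bits (num κ) :: r)) = κ := by
  simp [key, bits_num]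

theorem comput_key {B : (ℕ → ℕ) → Prop} [Growth B] : Comput B key := (comput_nth 1).dropLast

/-- The index is that of a check for a valid query. -/
def ValidKey (z : List Bool) : Prop :=
  (nth 0 z).tail ≠ [] ∧ (key z).drop 2 ≠ [] ∧ V (tuple [nth 0 z, (key z).drop 3])

open Classical in
/-- The index of the first block that is looked at. -/
noncomputable def first (z : List Bool) : List Bool :=
  if (nth 0 z).tail ≠ [] ∧ nth 1 z = [true] then [true] else
    if ValidKey V z then [false, false, false] ++ ((key z).drop 3 ++ [true]) else []

open Classical in
/-- The index of the second block that is looked at. -/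
noncomputable def second (z : List Bool) : List Bool :=
  if ValidKey V z then
    if (key z).getD 0 false = true then
      [false, false, false] ++ (σ ((key z).getD 1 false) ((key z).getD 2 false)
        (tuple [nth 0 z, (key z).drop 3]) ++ [true])
    else [true]
  else []

variable {V σ}

theorem dec_validKey (hV : Dec PolyB V) : Dec PolyB (ValidKey V) :=
  (Dec.eq (comput_tail.comp (comput_nth 0)) (comput_const [])).not.and
    ((Dec.eq (comput_key.drop 2) (comput_const [])).not.and
      (hV.comp ((comput_nth 0).tuple₂ (comput_key.drop 3))))

theorem comput_first (hV : Dec PolyB V) : Comput PolyB (first V) := by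
  classical
  exact Comput.ite ((Dec.eq (comput_tail.comp (comput_nth 0)) (comput_const [])).not.and
    (Dec.eq (comput_nth 1) (comput_const _))) (comput_const _)
    (Comput.ite (dec_validKey hV) ((comput_const _).append
      ((comput_key.drop 3).append (comput_const _))) (comput_const _))

theorem comput_second (hV : Dec PolyB V) (hσ : ∀ a b, Comput PolyB (σ a b)) :
    Comput PolyB (second V σ) := by
  classical
  exact Comput.ite (dec_validKey hV) (Comput.ite (Dec.getD comput_key 0)
    ((comput_const _).append ((Comput.pick comput_key (F := fun a b z =>
      σ a b (tuple [nth 0 z, (key z).drop 3])) (fun a b => (hσ a b).comp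
        ((comput_nth 0).tuple₂ (comput_key.drop 3))) 1 2).append (comput_const _)))
    (comput_const _)) (comput_const _)

variable (V σ) in
/-- `first` as a function of numbers. -/
noncomputable def firstNum (n i : ℕ) : ℕ :=
  val (first V (tuple [List.replicate n true, Nat.bits i]))

variable (V σ) in
/-- `second` as a function of numbers. -/
noncomputable def secondNum (n i : ℕ) : ℕ :=
  val (second V σ (tuple [List.replicate n true, Nat.bits i]))

variable {n : ℕ}

theorem validKey_num {a b c : Bool} {l : List Bool} (hn : 2 ≤ n) :
    ValidKey V (tuple [List.replicate n true, Nat.bits (num (a :: b :: c :: l))]) ↔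
      V (tuple [List.replicate n true, l]) := by
  simp only [ValidKey, key, nth_tuple, List.getD_cons_zero, List.getD_cons_succ, bits_num,
    List.dropLast_concat, List.drop_succ_cons, List.drop_zero]
  simp
  omega

theorem firstNum_num {a b c : Bool} {l : List Bool} (hn : 2 ≤ n)
    (h : V (tuple [List.replicate n true, l])) :
    firstNum V n (num (a :: b :: c :: l)) = num (false :: false :: false :: l) := by
  rw [firstNum, first, if_neg, if_pos ((validKey_num hn).2 h)]
  · simp only [key_num, List.drop_succ_cons, List.drop_zero]
    rfl
  · simp [bits_num]

theorem secondNum_num_true {b c : Bool} {l : List Bool} (hn : 2 ≤ n)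
    (h : V (tuple [List.replicate n true, l])) :
    secondNum V σ n (num (true :: b :: c :: l)) =
      num (false :: false :: false :: σ b c (tuple [List.replicate n true, l])) := by
  rw [secondNum, second, if_pos ((validKey_num hn).2 h), if_pos]
  · simp only [nth_tuple, key_num, List.drop_succ_cons, List.drop_zero, List.getD_cons_zero,
      List.getD_cons_succ]
    rfl
  · simp

theorem secondNum_num_false {b c : Bool} {l : List Bool} (hn : 2 ≤ n)
    (h : V (tuple [List.replicate n true, l])) :
    secondNum V σ n (num (false :: b :: c :: l)) = 1 := by
  rw [secondNum, second, if_pos ((validKey_num hn).2 h), if_neg]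
  · rfl
  · simp

theorem firstNum_one (hn : 2 ≤ n) : firstNum V n 1 = 1 := by
  rw [firstNum, first, if_pos]
  · rfl
  · simp
    omega

theorem numbers_eq_zero {i : ℕ} (hi : i ≠ 1)
    (h : ¬ ValidKey V (tuple [List.replicate n true, Nat.bits i])) :
    firstNum V n i = 0 ∧ secondNum V σ n i = 0 := by
  rw [firstNum, secondNum, first, second, if_neg, if_neg h, if_neg h]
  · exact ⟨rfl, rfl⟩
  · simp only [nth_tuple, List.getD_cons_zero, List.getD_cons_succ]
    rintro ⟨-, h'⟩
    exact hi (by rw [← val_bits i, h']; rfl)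

theorem firstNum_small {i : ℕ} (hn : n < 2) : firstNum V n i = 0 ∧ secondNum V σ n i = 0 := by
  have h₁ : (List.replicate n true).tail = [] := by simp; omega
  have h₂ : ¬ ValidKey V (tuple [List.replicate n true, Nat.bits i]) := by
    simp [ValidKey]
    omega
  rw [firstNum, secondNum, first, second, if_neg, if_neg h₂, if_neg h₂]
  · exact ⟨rfl, rfl⟩
  · simp
    omega

theorem exists_of_validKey {i : ℕ}
    (h : ValidKey V (tuple [List.replicate n true, Nat.bits i])) :
    ∃ a b c l, i = num (a :: b :: c :: l) ∧ V (tuple [List.replicate n true, l]) := by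
  obtain ⟨-, h₂, h₃⟩ := h
  simp only [key, nth_tuple, List.getD_cons_zero, List.getD_cons_succ] at h₂ h₃
  have hi : i ≠ 0 := by rintro rfl; simp at h₂
  obtain ⟨κ, hκ⟩ := exists_bits_eq hi
  rw [hκ, List.dropLast_concat] at h₂ h₃
  match κ, h₂ with
  | a :: b :: c :: l, _ =>
    refine ⟨a, b, c, l, ?_, h₃⟩
    rw [← val_bits i, hκ]
    rfl

theorem validKey_ge {i : ℕ} (h : ValidKey V (tuple [List.replicate n true, Nat.bits i])) :
    2 ≤ n := by
  have := h.1
  simp at this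
  omega

/-- Three more digits give a number below `8 * n ^ c`, and `8 ≤ n ^ 3`. The digits select the kind
of check and the copy concerned. -/
theorem num_cons₃_lt {c : ℕ} (hn : 2 ≤ n) {a b d : Bool} {l : List Bool} (h : num l < n ^ c) :
    num (a :: b :: d :: l) < n ^ (c + 3) := by
  have h₁ : a.toNat ≤ 1 := Bool.toNat_le a
  have h₂ : b.toNat ≤ 1 := Bool.toNat_le b
  have h₃ : d.toNat ≤ 1 := Bool.toNat_le d
  have h₄ : 2 ^ 3 ≤ n ^ 3 := Nat.pow_le_pow_left hn _
  rw [num_cons, num_cons, num_cons, pow_add]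
  nlinarith

/-- Both valid and invalid indices have to be treated, as the selection functions must map the whole
range of indices into itself. -/
theorem numbers_lt {c : ℕ} (hb : ∀ n l, 2 ≤ n → V (tuple [List.replicate n true, l]) →
      num l < n ^ c ∧ ∀ a b, num (σ a b (tuple [List.replicate n true, l])) < n ^ c)
    {i : ℕ} (hi : i < n ^ (c + 3)) :
    firstNum V n i < n ^ (c + 3) ∧ secondNum V σ n i < n ^ (c + 3) := by
  by_cases h : ValidKey V (tuple [List.replicate n true, Nat.bits i])
  · have hn := validKey_ge h
    obtain ⟨a, b, d, l, rfl, hl⟩ := exists_of_validKey h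
    obtain ⟨h₁, h₂⟩ := hb n l hn hl
    refine ⟨firstNum_num hn hl ▸ num_cons₃_lt hn h₁, ?_⟩
    cases a with
    | true => exact secondNum_num_true hn hl ▸ num_cons₃_lt hn (h₂ _ _)
    | false =>
      rw [secondNum_num_false hn hl]
      exact Nat.one_lt_pow (by omega) (by omega)
  · by_cases h₁ : i = 1
    · subst h₁
      rcases le_or_gt 2 n with hn | hn
      · rw [firstNum_one hn]
        refine ⟨Nat.one_lt_pow (by omega) (by omega), ?_⟩
        rw [secondNum, second, if_neg h]
        exact Nat.pow_pos (by omega)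
      · rw [(firstNum_small (σ := σ) hn).1, (firstNum_small (V := V) (σ := σ) hn).2]
        exact ⟨by omega, by omega⟩
    · obtain ⟨h₂, h₃⟩ := numbers_eq_zero (σ := σ) h₁ h
      rw [h₂, h₃]
      exact ⟨by omega, by omega⟩

end Selection

/-! ### The check carried out at one index -/

/-- The component of a block that holds a copy of an answer. -/
def slot (a b : Bool) : ℕ := 2 * a.toNat + b.toNat

/-- The argument of a query, according to a block that contains copies of the answers. -/
def blockQuery (z : List Bool) : List Bool :=
  tuple [nth 0 z, (key z).drop 3, nth 0 (nth 2 z), nth 1 (nth 2 z), nth 2 (nth 2 z),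
    nth 3 (nth 2 z)]

/-- The check is accepted without a query. -/
def Passes (L : Language Bool) (z : List Bool) : Prop :=
  ((nth 0 z).tail = [] ∧ nth 0 z ∈ L) ∨ ((nth 0 z).tail ≠ [] ∧
    (nth 1 z = [] ∨ (nth 1 z = [true] ∧ nth 0 (nth 2 z) ≠ []) ∨
    (nth 1 z ≠ [true] ∧ (key z).getD 0 false = true ∧
      nth (slot ((key z).getD 1 false) ((key z).getD 2 false)) (nth 2 z) = nth 4 (nth 3 z)) ∨
    (nth 1 z ≠ [true] ∧ ¬ (key z).getD 0 false = true ∧ nth 0 (nth 3 z) = [])))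

/-- The check depends on a query. -/
def Asks (Q : List Bool → Prop) (z : List Bool) : Prop :=
  (nth 0 z).tail ≠ [] ∧ nth 1 z ≠ [] ∧ nth 1 z ≠ [true] ∧ ¬ (key z).getD 0 false = true ∧
    Q (blockQuery z)

theorem comput_blockQuery {B : (ℕ → ℕ) → Prop} [Growth B] : Comput B blockQuery :=
  comput_tuple [nth 0, fun z => (key z).drop 3, fun z => nth 0 (nth 2 z), fun z => nth 1 (nth 2 z),
    fun z => nth 2 (nth 2 z), fun z => nth 3 (nth 2 z)] (by
      simp only [List.mem_cons, List.not_mem_nil, or_false, forall_eq_or_imp, forall_eq]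
      exact ⟨comput_nth 0, comput_key.drop 3, (comput_nth 2).component 0,
        (comput_nth 2).component 1, (comput_nth 2).component 2, (comput_nth 2).component 3⟩)

theorem dec_passes (L : Language Bool) : Dec LinB (Passes L) := by
  have h₁ : Dec LinB fun z => nth 1 z = [true] := Dec.eq (comput_nth 1) (comput_const _)
  have h₂ : Dec LinB fun z => (key z).getD 0 false = true := Dec.getD comput_key 0
  have h₃ : Dec LinB fun z => (nth 0 z).tail = [] := Dec.eq (comput_tail.comp (comput_nth 0))
    (comput_const _)
  have h₄ : Comput LinB fun z =>
      nth (slot ((key z).getD 1 false) ((key z).getD 2 false)) (nth 2 z) :=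
    Comput.pick comput_key (F := fun a b z => nth (slot a b) (nth 2 z))
      (fun a b => (comput_nth 2).component _) 1 2
  exact ((dec_short_mem L).comp (comput_nth 0)).or (h₃.not.and
    ((Dec.eq (comput_nth 1) (comput_const _)).or ((h₁.and
      (Dec.eq ((comput_nth 2).component 0) (comput_const _)).not).or
      ((h₁.not.and (h₂.and (Dec.eq h₄ ((comput_nth 3).component 4)))).or
      (h₁.not.and (h₂.not.and (Dec.eq ((comput_nth 3).component 0) (comput_const _))))))))

theorem dec_asks {Q : List Bool → Prop} (hQ : Dec LinB Q) : Dec LinB (Asks Q) :=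
  (Dec.eq (comput_tail.comp (comput_nth 0)) (comput_const _)).not.and
    ((Dec.eq (comput_nth 1) (comput_const _)).not.and
    ((Dec.eq (comput_nth 1) (comput_const _)).not.and
    ((Dec.getD comput_key 0).not.and (hQ.comp comput_blockQuery))))

/-- A language that is given by polynomially many queries to an unknown function is in `Xi C`. -/
theorem mem_Xi_of_queries {C : Set (Language Bool)} {L₂ L : Language Bool} (hC : Absorbs C L₂)
    {b : ℕ → ℕ} (hb : PolyB b) {V : List Bool → Prop} (hV : Dec PolyB V)
    {σ : Bool → Bool → List Bool → List Bool} (hσ : ∀ a b, Comput PolyB (σ a b))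
    {Q : List Bool → Prop} (hQ : Dec LinB Q) {ρ : List Bool → List Bool} (hρ : Comput LinB ρ)
    (hVb : ∀ n l, 2 ≤ n → V (tuple [List.replicate n true, l]) →
      num l < b n ∧ ∀ c d, num (σ c d (tuple [List.replicate n true, l])) < b n)
    (hsound : ∀ (x : List Bool) (W : List Bool → List Bool), 2 ≤ x.length →
      (∀ l, V (tuple [List.replicate x.length true, l]) →
        Q (query σ W x l) ∧ ρ (query σ W x l) ∈ L₂) → x ∈ L)
    (hcompl : ∀ x ∈ L, 2 ≤ x.length → ∃ W : List Bool → List Bool,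
      ∀ l, V (tuple [List.replicate x.length true, l]) →
        (∀ c d, (W (σ c d (tuple [List.replicate x.length true, l]))).length ≤ b x.length) ∧
        Q (query σ W x l) ∧ ρ (query σ W x l) ∈ L₂) : L ∈ Xi C := by
  obtain ⟨c, hc⟩ := hb.exists_pow
  have hVc : ∀ n l, 2 ≤ n → V (tuple [List.replicate n true, l]) →
      num l < n ^ c ∧ ∀ a b, num (σ a b (tuple [List.replicate n true, l])) < n ^ c :=
    fun n l hn hl => ⟨(hVb n l hn hl).1.trans_le (hc n hn),
      fun a b => ((hVb n l hn hl).2 a b).trans_le (hc n hn)⟩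
  -- There are `n ^ (c + 3)` blocks of size `n ^ (c + 5)`: three digits are added to the indices,
  -- and a block holds five strings of length at most `n ^ c`.
  refine ⟨(c + 3) + (c + 5), c + 3, firstNum V, secondNum V σ, _, by omega,
    hC _ _ _ (dec_passes L) (dec_asks hQ) (hρ.comp comput_blockQuery),
    polyTimeIndex_of_comput (comput_first hV), polyTimeIndex_of_comput (comput_second hV hσ),
    fun n i hi => numbers_lt hVc hi, fun x => ?_⟩
  rw [Nat.add_sub_cancel_left]
  -- For inputs of length at most one, powers of the size give no room. Then the only index is `0`,
  -- and the answer is taken from a finite table.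
  rcases lt_or_ge x.length 2 with hx | hx
  · have hs : size x = 1 := by rw [size]; omega
    have hd : x.tail = [] := List.eq_nil_of_length_eq_zero (by rw [List.length_tail]; omega)
    simp only [hs, one_pow, Nat.lt_one_iff, forall_eq, numeral, Nat.zero_bits]
    have : ∀ A B : List Bool, (Passes L (tuple [x, [], A, B]) ∨ Asks Q (tuple [x, [], A, B]) ∧
        ρ (blockQuery (tuple [x, [], A, B])) ∈ L₂) ↔ x ∈ L := by
      intro A B
      simp only [Passes, Asks, nth_tuple, List.getD_cons_zero, List.getD_cons_succ, hd]
      simp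
    constructor
    · intro h
      exact ⟨[true], rfl, (this _ _).2 h⟩
    · rintro ⟨w, -, h⟩
      exact (this _ _).1 h
  have hs : size x = x.length := by rw [size]; omega
  rw [hs]
  obtain ⟨n, hn⟩ : ∃ n, x.length = n := ⟨_, rfl⟩
  rw [hn]
  rw [hn] at hx
  have hd : x.tail ≠ [] := by
    rw [← List.length_pos_iff, List.length_tail]
    omega
  have h1 : 1 < n ^ (c + 3) := Nat.one_lt_pow (by omega) (by omega)
  constructor
  · intro hxL
    obtain ⟨W, hW⟩ := hcompl x hxL (hn ▸ hx)
    rw [hn] at hW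
    classical
    obtain ⟨cp, hcp⟩ : ∃ cp : List Bool → Bool → Bool → List Bool, cp = fun l a b =>
      if V (tuple [List.replicate n true, l]) then W (σ a b (tuple [List.replicate n true, l]))
        else [] := ⟨_, rfl⟩
    -- `W` may be long at places where it is never asked; there it may be replaced by the empty
    -- string.
    obtain ⟨ms, hms⟩ : ∃ ms : List Bool → List Bool, ms = fun l =>
      if (W l).length ≤ n ^ c then W l else [] := ⟨_, rfl⟩
    have hcpl : ∀ l a b, (cp l a b).length ≤ n ^ c := by
      intro l a b
      rw [hcp]
      beta_reduce
      split
      · next h => exact ((hW l h).1 a b).trans (hc n hx)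
      · simp
    have hmsl : ∀ l, (ms l).length ≤ n ^ c := by
      intro l
      rw [hms]
      beta_reduce
      split
      · assumption
      · simp
    -- The honest guess: block 0 is blank, block 1 carries the flag, and the block of `l` contains
    -- the four copies followed by the value of `W` at `l`.
    obtain ⟨cs, hcs⟩ : ∃ cs : ℕ → List (List Bool), cs = fun J =>
      if J = 0 then [[], [], [], [], []] else if J = 1 then [[true], [], [], [], []] else
        let l := (Nat.bits J).dropLast.drop 3
        [cp l false false, cp l false true, cp l true false, cp l true true, ms l] := ⟨_, rfl⟩
    have hcsl : ∀ J, (cs J).length = 5 := by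
      intro J
      rw [hcs]
      beta_reduce
      split
      · rfl
      split <;> rfl
    have hnc : 1 ≤ n ^ c := Nat.one_le_pow _ _ (by omega)
    have hcsl' : ∀ J, (enc (cs J) []).length ≤ n ^ (c + 5) := by
      intro J
      -- Doubling and separators included, the contents take at most `10 * n ^ c + 10` bits, which
      -- is below `32 * n ^ c`.
      have h5 : 2 ^ 5 ≤ n ^ 5 := Nat.pow_le_pow_left hx _
      have h6 : n ^ c * 32 ≤ n ^ (c + 5) := by
        rw [pow_add]
        exact Nat.mul_le_mul_left _ h5
      rw [length_enc, hcsl, hcs]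
      beta_reduce
      split
      · simp; omega
      split
      · simp; omega
      · have h₁ := hcpl ((Nat.bits J).dropLast.drop 3) false false
        have h₂ := hcpl ((Nat.bits J).dropLast.drop 3) false true
        have h₃ := hcpl ((Nat.bits J).dropLast.drop 3) true false
        have h₄ := hcpl ((Nat.bits J).dropLast.drop 3) true true
        have h₅ := hmsl ((Nat.bits J).dropLast.drop 3)
        simp only [List.map_cons, List.map_nil, List.sum_cons, List.sum_nil, List.length_nil]
        omega
    obtain ⟨w, hw, hwJ⟩ := exists_blocks (cnt := n ^ (c + 3)) (S := n ^ (c + 5))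
      (g := fun J => enc (cs J) (List.replicate (n ^ (c + 5) - (enc (cs J) []).length) false))
      (by
        intro J _
        have := hcsl' J
        rw [length_enc] at this ⊢
        simp only [List.length_nil, List.length_replicate, length_enc] at this ⊢
        omega)
    have hnth : ∀ J < n ^ (c + 3), ∀ k < 5, nth k (block (n ^ (c + 5)) w J) =
        (cs J).getD k [] := by
      intro J hJ k hk
      rw [hwJ J hJ, nth_enc]
      rwa [hcsl]
    have hcs0 : cs 0 = [[], [], [], [], []] := by rw [hcs]; rfl
    have hcs1 : cs 1 = [[true], [], [], [], []] := by rw [hcs]; rfl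
    have hcs2 : ∀ l, cs (num (false :: false :: false :: l)) =
        [cp l false false, cp l false true, cp l true false, cp l true true, ms l] := by
      intro l
      have := num_pos l
      rw [hcs]
      beta_reduce
      rw [if_neg, if_neg]
      · simp only [bits_num, List.dropLast_concat, List.drop_succ_cons, List.drop_zero]
      · simp only [num_cons, Bool.toNat_false]; omega
      · simp only [num_cons, Bool.toNat_false]; omega
    refine ⟨w, by rw [hw, ← pow_add], fun i hi => ?_⟩
    change Passes L _ ∨ Asks Q _ ∧ ρ (blockQuery _) ∈ L₂
    simp only [numeral]
    by_cases hi0 : i = 0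
    · subst hi0
      left; right
      simp [hd]
    by_cases hi1 : i = 1
    · subst hi1
      left; right
      rw [firstNum_one hx]
      simp [hd, hnth 1 h1, hcs1]
    by_cases hv : ValidKey V (tuple [List.replicate n true, Nat.bits i])
    · obtain ⟨k, a, b', l, rfl, hl⟩ := exists_of_validKey hv
      obtain ⟨h₁, h₂⟩ := hVc n l hx hl
      obtain ⟨h₃, h₄, h₅⟩ := hW l hl
      rw [firstNum_num hx hl]
      have hbl := fun k hk => hnth _ (num_cons₃_lt (a := false) (b := false) (d := false) hx h₁) k hk
      rw [hcs2] at hbl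
      have hcpW : ∀ a b, cp l a b = W (σ a b (tuple [List.replicate n true, l])) := by
        intro a b
        rw [hcp]
        exact if_pos hl
      cases k with
      | true =>
        left; right
        rw [secondNum_num_true hx hl]
        have hbl' := hnth _ (num_cons₃_lt (a := false) (b := false) (d := false) hx (h₂ a b')) 4
          (by omega)
        rw [hcs2] at hbl'
        have hmsW : ms (σ a b' (tuple [List.replicate n true, l])) =
            W (σ a b' (tuple [List.replicate n true, l])) := by
          rw [hms]
          exact if_pos ((h₃ a b').trans (hc n hx))
        refine ⟨by simpa using hd, .inr (.inr (.inl ⟨?_, ?_, ?_⟩))⟩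
        · simp [bits_num]
        · simp
        · simp only [key_num, nth_tuple, List.getD_cons_zero, List.getD_cons_succ]
          rw [hbl', hbl _ (by cases a <;> cases b' <;> simp [slot])]
          cases a <;> cases b' <;> simp [slot, hcpW, hmsW]
      | false =>
        right
        have hq : blockQuery (tuple [x, Nat.bits (num (false :: a :: b' :: l)),
            block (n ^ (c + 5)) w (num (false :: false :: false :: l)),
            block (n ^ (c + 5)) w (secondNum V σ n (num (false :: a :: b' :: l)))]) =
            query σ W x l := by
          simp [blockQuery, query, hbl, hcpW, hn]
        rw [hq]
        refine ⟨⟨by simpa using hd, ?_, ?_, ?_, ?_⟩, h₅⟩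
        · simp [bits_num]
        · simp [bits_num]
        · simp
        · rw [hq]; exact h₄
    · obtain ⟨h₂, h₃⟩ := numbers_eq_zero (σ := σ) hi1 hv
      rw [h₂, h₃]
      left; right
      -- An invalid index looks at the blank block 0 twice: a comparison of copies finds equal empty
      -- strings, and a test finds no flag and passes.
      have hb0 : ∀ k < 5, nth k (block (n ^ (c + 5)) w 0) = [] := by
        intro k hk
        rw [hnth 0 (by omega) k hk, hcs0]
        interval_cases k <;> rfl
      have hb1 : Nat.bits i ≠ [true] := fun h => hi1 (by rw [← val_bits i, h]; rfl)
      refine ⟨by simpa using hd, .inr (.inr ?_)⟩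
      simp only [nth_tuple, List.getD_cons_zero, List.getD_cons_succ]
      by_cases hk : (key (tuple [x, Nat.bits i, block (n ^ (c + 5)) w 0,
          block (n ^ (c + 5)) w 0])).getD 0 false = true
      · refine .inl ⟨hb1, hk, ?_⟩
        rw [hb0 _ _, hb0 4 (by omega)]
        rw [slot]
        have h₁ := Bool.toNat_le ((key (tuple [x, Nat.bits i, block (n ^ (c + 5)) w 0,
          block (n ^ (c + 5)) w 0])).getD 1 false)
        have h₂ := Bool.toNat_le ((key (tuple [x, Nat.bits i, block (n ^ (c + 5)) w 0,
          block (n ^ (c + 5)) w 0])).getD 2 false)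
        omega
      · exact .inr ⟨hb1, hk, hb0 0 (by omega)⟩
  · rintro ⟨w, -, h⟩
    obtain ⟨W, hW⟩ : ∃ W : List Bool → List Bool, W = fun l =>
      nth 4 (block (n ^ (c + 5)) w (num (false :: false :: false :: l))) := ⟨_, rfl⟩
    have h' : ∀ i < n ^ (c + 3), Passes L (tuple [x, Nat.bits i,
        block (n ^ (c + 5)) w (firstNum V n i), block (n ^ (c + 5)) w (secondNum V σ n i)]) ∨
        Asks Q (tuple [x, Nat.bits i, block (n ^ (c + 5)) w (firstNum V n i),
          block (n ^ (c + 5)) w (secondNum V σ n i)]) ∧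
        ρ (blockQuery (tuple [x, Nat.bits i, block (n ^ (c + 5)) w (firstNum V n i),
          block (n ^ (c + 5)) w (secondNum V σ n i)])) ∈ L₂ := h
    -- The check with index 1 forces the flag in block 1, whatever the guess is.
    have hone : nth 0 (block (n ^ (c + 5)) w 1) ≠ [] := by
      have := h' 1 h1
      rw [firstNum_one hx] at this
      simpa [Passes, Asks, hd] using this
    refine hsound x W (hn ▸ hx) fun l hl => ?_
    rw [hn] at hl
    obtain ⟨h₁, h₂⟩ := hVc n l hx hl
    -- The comparison checks tie the copies to the values stored in the blocks of the places asked,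
    -- so all blocks describe one and the same function `W`.
    have hcopy : ∀ a b, nth (slot a b) (block (n ^ (c + 5)) w
        (num (false :: false :: false :: l))) = W (σ a b (tuple [List.replicate n true, l])) := by
      intro a b
      have := h' _ (num_cons₃_lt (a := true) (b := a) (d := b) hx h₁)
      rw [firstNum_num hx hl, secondNum_num_true hx hl] at this
      rw [hW]
      simp only [Passes, Asks, key_num] at this
      simpa [hd, bits_num] using this
    have := h' _ (num_cons₃_lt (a := false) (b := false) (d := false) hx h₁)
    rw [firstNum_num hx hl, secondNum_num_false hx hl] at this
    have hq : blockQuery (tuple [x, Nat.bits (num (false :: false :: false :: l)),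
        block (n ^ (c + 5)) w (num (false :: false :: false :: l)),
        block (n ^ (c + 5)) w 1]) = query σ W x l := by
      have e₀ := hcopy false false
      have e₁ := hcopy false true
      have e₂ := hcopy true false
      have e₃ := hcopy true true
      simp only [slot, Bool.toNat_false, Bool.toNat_true, mul_zero, mul_one, zero_add,
        Nat.reduceAdd] at e₀ e₁ e₂ e₃
      simp [blockQuery, query, hn, e₀, e₁, e₂, e₃]
    rw [hq] at this
    -- A valid test cannot pass without asking, since its second block is the one with the flag.
    rcases this with h₃ | ⟨⟨-, -, -, -, h₄⟩, h₅⟩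
    · simp only [Passes, key_num] at h₃
      simp [hd, bits_num, hone] at h₃
    · rw [hq] at h₄
      exact ⟨h₄, h₅⟩

/-! ## Queries to a language in `Xi C` -/

theorem two_pow_length_le_num (l : List Bool) : 2 ^ l.length ≤ num l := by
  have : val [true] = 1 := rfl
  rw [num, val_append, this]
  omega

theorem length_lt_num (l : List Bool) : l.length < num l :=
  Nat.lt_two_pow_self.trans_le (two_pow_length_le_num l)

theorem num_tuple₂_lt {i : List Bool} {j p q : ℕ} (hi : num i < p) (hj : j < q) :
    num (tuple [i, Nat.bits j]) < 8 * p ^ 2 * (2 * q + 1) ^ 2 := by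
  refine (num_lt _).trans_le ?_
  rw [length_tuple_cons_cons, tuple_singleton, length_doubleBits]
  have h₁ : (2 ^ i.length) ^ 2 ≤ p ^ 2 :=
    Nat.pow_le_pow_left ((two_pow_length_le_num i).trans hi.le) _
  have h₂ : (2 ^ (Nat.bits j).length) ^ 2 ≤ (2 * q + 1) ^ 2 :=
    Nat.pow_le_pow_left ((two_pow_length_bits_le j).trans (by omega)) _
  calc 2 * 2 ^ (2 * i.length + 2 + 2 * (Nat.bits j).length)
      = 8 * ((2 ^ i.length) ^ 2 * (2 ^ (Nat.bits j).length) ^ 2) := by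
        rw [pow_add, pow_add, mul_comm 2 i.length, pow_mul, mul_comm 2 (Nat.bits j).length, pow_mul]
        ring
    _ ≤ 8 * (p ^ 2 * (2 * q + 1) ^ 2) := Nat.mul_le_mul_left _ (Nat.mul_le_mul h₁ h₂)
    _ = _ := by ring

/-- A string whose length is the size of `x`. -/
def sized (x : List Bool) : List Bool := if x = [] then [true] else x

theorem length_sized (x : List Bool) : (sized x).length = size x := by
  rw [sized, size]
  split
  · next h => subst h; rfl
  · next h =>
    have := List.length_pos_iff.2 h
    omega

theorem sized_ne_nil (x : List Bool) : sized x ≠ [] := by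
  rw [sized]
  split <;> simp_all

theorem comput_sized {B : (ℕ → ℕ) → Prop} [Growth B] : Comput B sized :=
  Comput.ite (Dec.eq comput_id (comput_const [])) (comput_const [true]) comput_id

theorem size_pos (x : List Bool) : 0 < size x := by
  rw [size]
  omega

/-- The argument that belongs to the index `i`. -/
def outerArg (σ : Bool → List Bool → List Bool) (W : List Bool → List Bool)
    (x i : List Bool) : List Bool :=
  let y := tuple [List.replicate x.length true, i]
  tuple [x, i, W (σ false y), W (σ true y)]

/-- Skolemization of the inner guesses. The new function has the outer function behind the prefix
`false`, and behind `true` the block `J` of the inner guess that belongs to `i`, at the place `⟨i,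
J⟩`. The new indices are pairs `⟨i, j⟩`, and each needs two outer and two inner values. The
selection functions may not see the guess, but the inner ones need the size of the argument of `L'`.
The length of `ν` supplies this size in advance, and `hQb` says that it is correct for all answers
allowed by `Q`. -/
theorem mem_Xi_of_queries_Xi {C : Set (Language Bool)} {L₂ L' L : Language Bool}
    (hC : Absorbs C L₂) {e₁ e₂ : ℕ} {g₁ g₂ : ℕ → ℕ → ℕ} (hg₁ : PolyTimeIndex g₁)
    (hg₂ : PolyTimeIndex g₂) (he : e₂ ≤ e₁)
    (hg : ∀ n i, i < n ^ e₂ → g₁ n i < n ^ e₂ ∧ g₂ n i < n ^ e₂)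
    (hL' : ∀ x : List Bool, x ∈ L' ↔ ∃ w : List Bool, w.length = size x ^ e₁ ∧
      ∀ i < size x ^ e₂, tuple [x, numeral i, block (size x ^ (e₁ - e₂)) w (g₁ (size x) i),
        block (size x ^ (e₁ - e₂)) w (g₂ (size x) i)] ∈ L₂)
    {b : ℕ → ℕ} (hb : PolyB b) {V : List Bool → Prop} (hV : Dec PolyB V)
    {σ : Bool → List Bool → List Bool} (hσ : ∀ a, Comput PolyB (σ a))
    {Q : List Bool → Prop} (hQ : Dec LinB Q) {ζ : List Bool → List Bool} (hζ : Comput LinB ζ)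
    {ν : List Bool → List Bool} (hν : Comput PolyB ν)
    (hVb : ∀ n i, 2 ≤ n → V (tuple [List.replicate n true, i]) →
      num i < b n ∧ (∀ a, num (σ a (tuple [List.replicate n true, i])) < b n) ∧
        ν (tuple [List.replicate n true, i]) ≠ [])
    (hQb : ∀ x i c d, 2 ≤ x.length → V (tuple [List.replicate x.length true, i]) →
      Q (tuple [x, i, c, d]) → c.length ≤ b x.length ∧ d.length ≤ b x.length ∧
        size (ζ (tuple [x, i, c, d])) = (ν (tuple [List.replicate x.length true, i])).length)
    (hL : ∀ x, 2 ≤ x.length → (x ∈ L ↔ ∃ W : List Bool → List Bool,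
      ∀ i, V (tuple [List.replicate x.length true, i]) →
        Q (outerArg σ W x i) ∧ ζ (outerArg σ W x i) ∈ L')) : L ∈ Xi C := by
  obtain ⟨φ₁, hφ₁, hφ₁'⟩ := hg₁.exists_comput
  obtain ⟨φ₂, hφ₂, hφ₂'⟩ := hg₂.exists_comput
  obtain ⟨t, ht, hm, hνt⟩ := hν.length_le
  obtain ⟨N, hN⟩ : ∃ N : ℕ → List Bool → ℕ,
    N = fun n i => (ν (tuple [List.replicate n true, i])).length := ⟨_, rfl⟩
  -- A bound for the inner sizes: a valid index has `|i| < num i < b n`, so the argument of `ν` has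
  -- length at most `2 * n + 2 + 2 * b n`.
  obtain ⟨T, hT⟩ : ∃ T : ℕ → ℕ, T = fun n => t (2 * n + 2 + 2 * b n) := ⟨_, rfl⟩
  have hTB : PolyB T := by
    rw [hT]
    exact Growth.comp ht (Growth.add (Growth.lin 2) ((PolyB.const 2).mul hb))
  have hNT : ∀ n i, 2 ≤ n → V (tuple [List.replicate n true, i]) → N n i ≤ T n := by
    intro n i hn hi
    rw [hN, hT]
    refine (hνt _).trans (hm ?_)
    rw [length_tuple_cons_cons, tuple_singleton, length_doubleBits, List.length_replicate]
    have := (hVb n i hn hi).1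
    have := length_lt_num i
    omega
  obtain ⟨o, ho⟩ : ∃ o : List Bool → List Bool, o = fun z =>
    tuple [nth 0 z, nth 0 (nth 1 z)] := ⟨_, rfl⟩
  have hoc : Comput PolyB o := by
    rw [ho]
    exact (comput_nth 0).tuple₂ ((comput_nth 1).component 0)
  have ho' : ∀ n i j, o (tuple [n, tuple [i, j]]) = tuple [n, i] := by
    intro n i j
    simp [ho]
  obtain ⟨V', hV'⟩ : ∃ V' : List Bool → Prop, V' = fun z => V (o z) ∧
    nth 1 z = tuple [nth 0 (nth 1 z), nth 1 (nth 1 z)] ∧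
    ∃ k < (List.replicate ((ν (o z)).length ^ e₂) true).length, nth 1 (nth 1 z) = Nat.bits k :=
      ⟨_, rfl⟩
  -- Validity includes being exactly the code of a pair, with a second component that is the numeral
  -- of an inner index in range.
  have hV'c : Dec PolyB V' := by
    rw [hV']
    exact (hV.comp hoc).and ((Dec.eq (comput_nth 1) (((comput_nth 1).component 0).tuple₂
      ((comput_nth 1).component 1))).and
      (Dec.exists_bits ((comput_nth 1).component 1) ((hν.comp hoc).powLen e₂)))
  have hVV' : ∀ n l, V' (tuple [List.replicate n true, l]) ↔ ∃ i j, l = tuple [i, Nat.bits j] ∧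
      V (tuple [List.replicate n true, i]) ∧ j < N n i ^ e₂ := by
    intro n l
    rw [hV', hN]
    constructor
    · rintro ⟨h₁, h₂, j, h₃, h₄⟩
      simp only [ho, nth_tuple, List.getD_cons_zero, List.getD_cons_succ,
        List.length_replicate] at h₁ h₂ h₃ h₄
      exact ⟨_, j, h₄ ▸ h₂, h₁, h₃⟩
    · rintro ⟨i, j, rfl, h₁, h₂⟩
      rw [ho']
      exact ⟨h₁, by simp, j, by simpa using h₂, by simp⟩
  obtain ⟨σ', hσ'⟩ : ∃ σ' : Bool → Bool → List Bool → List Bool, σ' = fun c d z =>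
    if c = true then true :: tuple [nth 0 (nth 1 z), (if d = true then φ₂ else φ₁)
      (tuple [List.replicate (ν (o z)).length true, nth 1 (nth 1 z)])]
    else false :: σ d (o z) := ⟨_, rfl⟩
  have hσ'c : ∀ c d, Comput PolyB (σ' c d) := by
    intro c d
    have h₁ : Comput PolyB fun z => tuple [List.replicate (ν (o z)).length true,
      nth 1 (nth 1 z)] := (hν.comp hoc).ones.tuple₂ ((comput_nth 1).component 1)
    rw [hσ']
    cases c
    · exact (comput_const [false]).append ((hσ d).comp hoc)
    · refine (comput_const [true]).append (((comput_nth 1).component 0).tuple₂ ?_)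
      cases d
      · exact hφ₁.comp h₁
      · exact hφ₂.comp h₁
  have hσf : ∀ n i j d, σ' false d (tuple [n, tuple [i, j]]) = false :: σ d (tuple [n, i]) := by
    intro n i j d
    simp [hσ', ho']
  have hσt : ∀ n i j, σ' true false (tuple [List.replicate n true, tuple [i, Nat.bits j]]) =
      true :: tuple [i, Nat.bits (g₁ (N n i) j)] := by
    intro n i j
    simp [hσ', ho', hφ₁', hN]
  have hσt' : ∀ n i j, σ' true true (tuple [List.replicate n true, tuple [i, Nat.bits j]]) =
      true :: tuple [i, Nat.bits (g₂ (N n i) j)] := by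
    intro n i j
    simp [hσ', ho', hφ₂', hN]
  obtain ⟨p, hp⟩ : ∃ p : List Bool → List Bool, p = fun z =>
    tuple [nth 0 z, nth 0 (nth 1 z), nth 2 z, nth 3 z] := ⟨_, rfl⟩
  have hpc : Comput LinB p := by
    rw [hp]
    exact (comput_nth 0).tuple₄ ((comput_nth 1).component 0) (comput_nth 2) (comput_nth 3)
  have hpq : ∀ W x i j, p (query σ' W x (tuple [i, j])) =
      outerArg σ (fun s => W (false :: s)) x i := by
    intro W x i j
    simp [hp, query, outerArg, hσf]
  obtain ⟨Q', hQ'⟩ : ∃ Q' : List Bool → Prop, Q' = fun z => Q (p z) ∧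
    (sized (ζ (p z)) ≠ [] ∧ (nth 4 z).length = (sized (ζ (p z))).length ^ (e₁ - e₂)) ∧
    (sized (ζ (p z)) ≠ [] ∧ (nth 5 z).length = (sized (ζ (p z))).length ^ (e₁ - e₂)) :=
      ⟨_, rfl⟩
  have hQ'c : Dec LinB Q' := by
    have h₁ := comput_sized.comp (hζ.comp hpc)
    rw [hQ']
    exact (hQ.comp hpc).and ((Dec.length_eq_pow (comput_nth 4) h₁ _).and
      (Dec.length_eq_pow (comput_nth 5) h₁ _))
  have hQQ : ∀ W x i j, Q' (query σ' W x (tuple [i, Nat.bits j])) ↔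
      Q (outerArg σ (fun s => W (false :: s)) x i) ∧
      (W (true :: tuple [i, Nat.bits (g₁ (N x.length i) j)])).length =
        size (ζ (outerArg σ (fun s => W (false :: s)) x i)) ^ (e₁ - e₂) ∧
      (W (true :: tuple [i, Nat.bits (g₂ (N x.length i) j)])).length =
        size (ζ (outerArg σ (fun s => W (false :: s)) x i)) ^ (e₁ - e₂) := by
    intro W x i j
    rw [hQ']
    beta_reduce
    rw [hpq]
    simp [sized_ne_nil, length_sized, query, hσt, hσt']
  obtain ⟨ρ, hρ⟩ : ∃ ρ : List Bool → List Bool, ρ = fun z =>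
    tuple [ζ (p z), nth 1 (nth 1 z), nth 4 z, nth 5 z] := ⟨_, rfl⟩
  have hρc : Comput LinB ρ := by
    rw [hρ]
    exact (hζ.comp hpc).tuple₄ ((comput_nth 1).component 1) (comput_nth 4) (comput_nth 5)
  have hρq : ∀ W x i j, ρ (query σ' W x (tuple [i, Nat.bits j])) =
      tuple [ζ (outerArg σ (fun s => W (false :: s)) x i), Nat.bits j,
        W (true :: tuple [i, Nat.bits (g₁ (N x.length i) j)]),
        W (true :: tuple [i, Nat.bits (g₂ (N x.length i) j)])] := by
    intro W x i j
    rw [hρ]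
    beta_reduce
    rw [hpq]
    simp [query, hσt, hσt']
  -- The first term covers the numbers of pairs with a prefix bit, the term `2 * b n` outer places
  -- with a prefix bit as well as outer answers, the last term the inner blocks.
  obtain ⟨b', hb'⟩ : ∃ b' : ℕ → ℕ, b' = fun n =>
    2 * (8 * b n ^ 2 * (2 * T n ^ e₂ + 1) ^ 2) + 2 + 2 * b n + T n ^ (e₁ - e₂) := ⟨_, rfl⟩
  have hb'B : PolyB b' := by
    rw [hb']
    exact Growth.add (Growth.add (Growth.add ((PolyB.const 2).mul (((PolyB.const 8).mul
      (hb.pow 2)).mul ((Growth.add ((PolyB.const 2).mul (hTB.pow e₂)) (PolyB.const 1)).pow 2)))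
      (PolyB.const 2)) ((PolyB.const 2).mul hb)) (hTB.pow _)
  have hbb : ∀ n, 2 * b n ≤ b' n := by
    intro n
    rw [hb']
    beta_reduce
    omega
  have hnum : ∀ n i j, 2 ≤ n → V (tuple [List.replicate n true, i]) → j < N n i ^ e₂ →
      2 * num (tuple [i, Nat.bits j]) + 1 < b' n := by
    intro n i j hn hi hj
    have h₁ := num_tuple₂_lt (hVb n i hn hi).1
      (hj.trans_le (Nat.pow_le_pow_left (hNT n i hn hi) _))
    rw [hb']
    beta_reduce
    omega
  refine mem_Xi_of_queries hC hb'B hV'c hσ'c hQ'c hρc ?_ ?_ ?_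
  · intro n l hn hl
    obtain ⟨i, j, rfl, hi, hj⟩ := (hVV' n l).1 hl
    obtain ⟨h₁, h₂, -⟩ := hVb n i hn hi
    obtain ⟨h₃, h₄⟩ := hg _ _ hj
    refine ⟨by have := hnum n i j hn hi hj; omega, fun c d => ?_⟩
    cases c with
    | false =>
      rw [hσf, num_cons]
      have := h₂ d
      have := hbb n
      simp only [Bool.toNat_false]
      omega
    | true =>
      cases d with
      | false =>
        rw [hσt, num_cons]
        have := hnum n i _ hn hi h₃
        simp only [Bool.toNat_true]
        omega
      | true =>
        rw [hσt', num_cons]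
        have := hnum n i _ hn hi h₄
        simp only [Bool.toNat_true]
        omega
  · intro x W hx h
    refine (hL x hx).2 ⟨fun s => W (false :: s), fun i hi => ?_⟩
    have h' : ∀ j < N x.length i ^ e₂, Q' (query σ' W x (tuple [i, Nat.bits j])) ∧
        ρ (query σ' W x (tuple [i, Nat.bits j])) ∈ L₂ := fun j hj =>
      h _ ((hVV' _ _).2 ⟨i, j, rfl, hi, hj⟩)
    -- There must be at least one inner index, for otherwise nothing would enforce `Q` at `i`; this
    -- is where `ν` has to be nonempty.
    have hpos : 0 < N x.length i ^ e₂ := by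
      rw [hN]
      exact Nat.pow_pos (List.length_pos_iff.2 (hVb _ i hx hi).2.2)
    have hq := ((hQQ W x i 0).1 (h' 0 hpos).1).1
    refine ⟨hq, (hL' _).2 ?_⟩
    have hsz : size (ζ (outerArg σ (fun s => W (false :: s)) x i)) = N x.length i := by
      rw [hN]
      exact (hQb x i _ _ hx hi hq).2.2
    rw [hsz]
    classical
    -- Blocks that no check looks at may have wrong lengths in `W`; they are replaced by a filler of
    -- the right length.
    obtain ⟨v, hv, hvb⟩ := exists_blocks (cnt := N x.length i ^ e₂)
      (S := N x.length i ^ (e₁ - e₂))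
      (g := fun J => if (W (true :: tuple [i, Nat.bits J])).length = N x.length i ^ (e₁ - e₂)
        then W (true :: tuple [i, Nat.bits J]) else
          List.replicate (N x.length i ^ (e₁ - e₂)) true) (by
        intro J _
        split
        · assumption
        · simp)
    refine ⟨v, by rw [hv, ← pow_add, Nat.add_sub_cancel' he], fun j hj => ?_⟩
    obtain ⟨h₁, h₂⟩ := h' j hj
    obtain ⟨-, h₃, h₄⟩ := (hQQ W x i j).1 h₁
    obtain ⟨h₅, h₆⟩ := hg _ _ hj
    rw [hsz] at h₃ h₄
    rw [hρq] at h₂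
    rw [hvb _ h₅, hvb _ h₆, if_pos h₃, if_pos h₄]
    exact h₂
  · intro x hxL hx
    obtain ⟨W₀, hW₀⟩ := (hL x hx).1 hxL
    have hv : ∀ i, ∃ v : List Bool, V (tuple [List.replicate x.length true, i]) →
        v.length = N x.length i ^ e₁ ∧ ∀ j < N x.length i ^ e₂,
          tuple [ζ (outerArg σ W₀ x i), numeral j,
            block (N x.length i ^ (e₁ - e₂)) v (g₁ (N x.length i) j),
            block (N x.length i ^ (e₁ - e₂)) v (g₂ (N x.length i) j)] ∈ L₂ := by
      intro i
      by_cases hi : V (tuple [List.replicate x.length true, i])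
      · obtain ⟨hq, hi'⟩ := hW₀ i hi
        have hsz : size (ζ (outerArg σ W₀ x i)) = N x.length i := by
          rw [hN]
          exact (hQb x i _ _ hx hi hq).2.2
        obtain ⟨v, hv, h⟩ := (hL' _).1 hi'
        rw [hsz] at hv h
        exact ⟨v, fun _ => ⟨hv, h⟩⟩
      · exact ⟨[], fun h => absurd h hi⟩
    choose v hv using hv
    obtain ⟨W, hWt, hWf⟩ : ∃ W : List Bool → List Bool, (∀ i j, W (true :: tuple [i, Nat.bits j]) =
        block (N x.length i ^ (e₁ - e₂)) (v i) j) ∧ ∀ s, W (false :: s) = W₀ s := by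
      refine ⟨fun s => match s with
        | [] => []
        | true :: y => block (N x.length (nth 0 y) ^ (e₁ - e₂)) (v (nth 0 y)) (val (nth 1 y))
        | false :: y => W₀ y, fun i j => ?_, fun s => rfl⟩
      simp [val_bits]
    refine ⟨W, fun l hl => ?_⟩
    obtain ⟨i, j, rfl, hi, hj⟩ := (hVV' _ l).1 hl
    obtain ⟨hq, hi'⟩ := hW₀ i hi
    obtain ⟨hv₁, hv₂⟩ := hv i hi
    obtain ⟨h₃, h₄⟩ := hg _ _ hj
    obtain ⟨h₅, h₆, hsz'⟩ := hQb x i _ _ hx hi hq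
    have hsz : size (ζ (outerArg σ W₀ x i)) = N x.length i := by rw [hN]; exact hsz'
    have hWW : (fun s => W (false :: s)) = W₀ := funext hWf
    have hbl : ∀ J < N x.length i ^ e₂,
        (block (N x.length i ^ (e₁ - e₂)) (v i) J).length = N x.length i ^ (e₁ - e₂) :=
      fun J hJ => length_block (by rw [hv₁, ← pow_add, Nat.add_sub_cancel' he]) hJ
    have hTb : N x.length i ^ (e₁ - e₂) ≤ b' x.length := by
      have := Nat.pow_le_pow_left (hNT _ i hx hi) (e₁ - e₂)
      rw [hb']
      beta_reduce
      omega
    refine ⟨fun c d => ?_, ?_, ?_⟩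
    · have := hbb x.length
      cases c with
      | false =>
        rw [hσf, hWf]
        cases d
        · exact h₅.trans (by omega)
        · exact h₆.trans (by omega)
      | true =>
        cases d with
        | false => rw [hσt, hWt, hbl _ h₃]; exact hTb
        | true => rw [hσt', hWt, hbl _ h₄]; exact hTb
    · rw [hQQ, hWW, hsz, hWt, hWt]
      exact ⟨hq, hbl _ h₃, hbl _ h₄⟩
    · rw [hρq, hWW, hWt, hWt]
      exact hv₂ j hj

/-! ## Relations between the classes -/

theorem Xi_mono {C D : Set (Language Bool)} (h : C ⊆ D) : Xi C ⊆ Xi D := by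
  rintro L ⟨d₁, d₂, f₁, f₂, L', hd, hL', rest⟩
  exact ⟨d₁, d₂, f₁, f₂, L', hd, h hL', rest⟩

theorem QE_mono {C D : Set (Language Bool)} (h : C ⊆ D) : QE C ⊆ QE D := by
  rintro L ⟨m, L', hm, hL', hL⟩
  exact ⟨m, L', hm, h hL', hL⟩

theorem Qu_mono {C D : Set (Language Bool)} (h : C ⊆ D) : Qu C ⊆ Qu D := by
  rintro L ⟨m, L', hm, hL', hL⟩
  exact ⟨m, L', hm, h hL', hL⟩

theorem polyTimeIndex_zero : PolyTimeIndex fun _ _ => 0 :=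
  polyTimeIndex_of_comput (comput_const [])

theorem mem_Xi_of_forall {C : Set (Language Bool)} {L L₂ : Language Bool} (hL₂ : L₂ ∈ C)
    (h : ∀ x z, x ∈ L ↔ z ∈ L₂) : L ∈ Xi C :=
  ⟨0, 0, fun _ _ => 0, fun _ _ => 0, L₂, le_rfl, hL₂, polyTimeIndex_zero, polyTimeIndex_zero,
    fun n i _ => by simp, fun x => ⟨fun hx => ⟨[true], by simp, fun i _ => (h x _).1 hx⟩,
      fun ⟨_, _, hw⟩ => (h x _).2 (hw 0 (by simp))⟩⟩

theorem DLIN_subset_Xi : DLIN ⊆ Xi DLIN := by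
  intro L hL
  have h₁ : Dec LinB fun z => z ∈ L := mem_DLIN_iff.1 hL
  refine ⟨0, 0, fun _ _ => 0, fun _ _ => 0, ({z | nth 0 z ∈ L} : Set (List Bool)), le_rfl,
    mem_DLIN_iff.2 (h₁.comp (comput_nth 0)), polyTimeIndex_zero, polyTimeIndex_zero,
    fun n i _ => by simp, fun x => ?_⟩
  constructor
  · intro hx
    refine ⟨[true], by simp, fun i _ => ?_⟩
    change nth 0 (tuple _) ∈ L
    simpa using hx
  · rintro ⟨w, -, h⟩
    have : nth 0 (tuple _) ∈ L := h 0 (by simp)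
    simpa using this

/-- The outer guess is viewed as a function from block numbers to blocks; `Q` fixes the block
lengths, and the inner argument is the outer check itself. -/
theorem Xi_Xi_subset {C : Set (Language Bool)} (hC : ClosedUnderLinTimeReductions C) :
    Xi (Xi C) ⊆ Xi C := by
  rintro L ⟨d₁, d₂, f₁, f₂, L', hd, ⟨e₁, e₂, g₁, g₂, L₂, he, hL₂, hg₁, hg₂, hg, hL'⟩, hf₁, hf₂,
    hf, hL⟩
  -- If `L₂` is empty or contains everything, there are no two fixed strings with different answers
  -- to reduce to. In these cases `L` is trivial in the same way.
  by_cases hyes : ∃ z, z ∈ L₂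
  swap
  · push Not at hyes
    have h₁ : ∀ x, x ∉ L' := fun x hx => by
      obtain ⟨w, -, hw⟩ := (hL' x).1 hx
      exact hyes _ (hw 0 (Nat.pow_pos (size_pos x)))
    have h₂ : ∀ x, x ∉ L := fun x hx => by
      obtain ⟨w, -, hw⟩ := (hL x).1 hx
      exact h₁ _ (hw 0 (Nat.pow_pos (size_pos x)))
    exact mem_Xi_of_forall hL₂ fun x z => iff_of_false (h₂ x) (hyes z)
  by_cases hno : ∃ z, z ∉ L₂
  swap
  · push Not at hno
    have h₁ : ∀ x, x ∈ L' := fun x =>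
      (hL' x).2 ⟨List.replicate _ true, List.length_replicate, fun i _ => hno _⟩
    have h₂ : ∀ x, x ∈ L := fun x =>
      (hL x).2 ⟨List.replicate _ true, List.length_replicate, fun i _ => h₁ _⟩
    exact mem_Xi_of_forall hL₂ fun x z => iff_of_true (h₂ x) (hno z)
  obtain ⟨yes, hyes⟩ := hyes
  obtain ⟨no, hno⟩ := hno
  obtain ⟨φ₁, hφ₁, hφ₁'⟩ := hf₁.exists_comput
  obtain ⟨φ₂, hφ₂, hφ₂'⟩ := hf₂.exists_comput
  have hV : ∀ n i, (∃ k < (List.replicate ((nth 0 (tuple [List.replicate n true, i])).length ^ d₂)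
      true).length, nth 1 (tuple [List.replicate n true, i]) = Nat.bits k) ↔
      ∃ k < n ^ d₂, i = Nat.bits k := by
    intro n i
    simp
  refine mem_Xi_of_queries_Xi (hC.absorbs hL₂ hyes hno) hg₁ hg₂ he hg hL'
    (b := fun n => 4 * n ^ d₂ + 4 + n ^ (d₁ - d₂))
    (V := fun z => ∃ k < (List.replicate ((nth 0 z).length ^ d₂) true).length,
      nth 1 z = Nat.bits k)
    (σ := fun a => if a = true then φ₂ else φ₁)
    (Q := fun z => (nth 0 z ≠ [] ∧ (nth 2 z).length = (nth 0 z).length ^ (d₁ - d₂)) ∧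
      (nth 0 z ≠ [] ∧ (nth 3 z).length = (nth 0 z).length ^ (d₁ - d₂)))
    (ζ := fun z => z)
    -- A dummy argument with blocks of the prescribed length has the size of the true one.
    (ν := fun z => tuple [nth 0 z, nth 1 z, List.replicate ((nth 0 z).length ^ (d₁ - d₂)) true,
      List.replicate ((nth 0 z).length ^ (d₁ - d₂)) true])
    (Growth.add (Growth.add ((PolyB.const 4).mul (PolyB.id.pow _)) (PolyB.const 4))
      (PolyB.id.pow _))
    (Dec.exists_bits (comput_nth 1) ((comput_nth 0).powLen _)) (fun a => by
      cases a
      · exact hφ₁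
      · exact hφ₂)
    ((Dec.length_eq_pow (comput_nth 2) (comput_nth 0) _).and
      (Dec.length_eq_pow (comput_nth 3) (comput_nth 0) _)) comput_id
    ((comput_nth 0).tuple₄ (comput_nth 1) ((comput_nth 0).powLen _) ((comput_nth 0).powLen _))
    ?_ ?_ ?_
  · intro n i hn hi
    obtain ⟨k, hk, rfl⟩ := (hV n i).1 hi
    have key : ∀ j < n ^ d₂, num (Nat.bits j) < 4 * n ^ d₂ + 4 + n ^ (d₁ - d₂) := by
      intro j hj
      have := num_lt (Nat.bits j)
      have := two_pow_length_bits_le j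
      omega
    obtain ⟨h₁, h₂⟩ := hf n k hk
    refine ⟨key k hk, fun a => ?_, fun h => ?_⟩
    · cases a
      · simp only [Bool.false_eq_true, if_false, hφ₁']
        exact key _ h₁
      · simp only [if_true, hφ₂']
        exact key _ h₂
    · have := congrArg List.length h
      rw [length_tuple_cons_cons] at this
      simp at this
  · intro x i c d hx hi hq
    simp only [nth_tuple, List.getD_cons_zero, List.getD_cons_succ] at hq ⊢
    obtain ⟨⟨-, h₁⟩, -, h₂⟩ := hq
    refine ⟨by omega, by omega, ?_⟩
    rw [size]
    simp only [length_tuple_cons_cons, tuple_singleton, length_doubleBits, List.length_replicate,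
      h₁, h₂]
    omega
  · intro x hx
    have hs : size x = x.length := by rw [size]; omega
    have hx0 : x ≠ [] := by rintro rfl; simp at hx
    rw [hL, hs]
    obtain ⟨n, hn⟩ : ∃ n, x.length = n := ⟨_, rfl⟩
    have harg : ∀ W k, outerArg (fun a => if a = true then φ₂ else φ₁) W x (Nat.bits k) =
        tuple [x, Nat.bits k, W (Nat.bits (f₁ n k)), W (Nat.bits (f₂ n k))] := by
      intro W k
      simp [outerArg, hφ₁', hφ₂', hn]
    simp only [hV, hn]
    constructor
    · rintro ⟨w, hw, h⟩
      refine ⟨fun s => block (n ^ (d₁ - d₂)) w (val s), ?_⟩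
      rintro _ ⟨k, hk, rfl⟩
      obtain ⟨h₁, h₂⟩ := hf n k hk
      have hw' : w.length = n ^ d₂ * n ^ (d₁ - d₂) := by
        rw [hw, ← pow_add, Nat.add_sub_cancel' hd]
      rw [harg]
      simp only [nth_tuple, List.getD_cons_zero, List.getD_cons_succ, val_bits, hn,
        length_block hw' h₁, length_block hw' h₂]
      exact ⟨⟨⟨hx0, trivial⟩, hx0, trivial⟩, h k hk⟩
    · rintro ⟨W, hW⟩
      obtain ⟨w, hw, hwb⟩ := exists_blocks (cnt := n ^ d₂) (S := n ^ (d₁ - d₂))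
        (g := fun J => if (W (Nat.bits J)).length = n ^ (d₁ - d₂) then W (Nat.bits J) else
          List.replicate (n ^ (d₁ - d₂)) true) (by
          intro J _
          split
          · assumption
          · simp)
      refine ⟨w, by rw [hw, ← pow_add, Nat.add_sub_cancel' hd], fun k hk => ?_⟩
      have := hW _ ⟨k, hk, rfl⟩
      rw [harg] at this
      simp only [nth_tuple, List.getD_cons_zero, List.getD_cons_succ, hn] at this
      obtain ⟨⟨⟨-, h₁⟩, -, h₂⟩, h₃⟩ := this
      obtain ⟨h₄, h₅⟩ := hf n k hk
      rw [hwb _ h₄, hwb _ h₅, if_pos h₁, if_pos h₂]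
      exact h₃

/-- Both sides are the least `k` with `b - 1 < 2 ^ k`. This makes the length of the string
quantified by `Qu` computable. -/
theorem clog_eq_length_bits {b : ℕ} (hb : 0 < b) : Nat.clog 2 b = (Nat.bits (b - 1)).length := by
  rw [Nat.size_eq_bits_len]
  refine eq_of_forall_ge_iff fun k => ?_
  rw [Nat.size_le, Nat.clog_le_iff_le_pow (by omega)]
  omega

theorem exists_comput_mul_length {B : (ℕ → ℕ) → Prop} [Growth B] (m : ℕ) :
    ∃ r, Comput B r ∧ ∀ x, (r x).length = m * x.length := by
  induction m with
  | zero => exact ⟨_, comput_const [], fun x => by simp⟩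
  | succ m ih =>
    obtain ⟨r, hr, h⟩ := ih
    refine ⟨_, hr.append comput_id, fun x => ?_⟩
    rw [List.length_append, h, Nat.succ_mul]

/-- The string guessed by `QE` becomes the value of the outer function at the single place `[]`; the
logarithmically long string of `Qu` becomes the outer index, of which there are polynomially many.
-/
theorem QE_Qu_Xi_subset {C : Set (Language Bool)} (hC : ∀ L₂ ∈ C, Absorbs C L₂) :
    QE (Qu (Xi C)) ⊆ Xi C := by
  rintro L ⟨m, L₁, hm, ⟨m', L', hm', ⟨e₁, e₂, g₁, g₂, L₂, he, hL₂, hg₁, hg₂, hg, hL'⟩, hL₁⟩, hL⟩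
  obtain ⟨r, hr, hrl⟩ := exists_comput_mul_length (B := LinB) m
  obtain ⟨r', hr', hrl'⟩ := exists_comput_mul_length (B := PolyB) m'
  -- The number whose logarithm is the length quantified by `Qu`, namely `m'` times the length of
  -- `⟨x, y⟩`.
  obtain ⟨ℓ, hℓ⟩ : ∃ ℓ : ℕ → ℕ, ℓ = fun n => m' * (2 * n + 2 + 2 * (m * n)) := ⟨_, rfl⟩
  have hℓB : PolyB ℓ := by
    rw [hℓ]
    exact (PolyB.const m').mul (Growth.add (Growth.add ((PolyB.const 2).mul PolyB.id)
      (PolyB.const 2)) ((PolyB.const 2).mul ((PolyB.const m).mul PolyB.id)))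
  have hℓ0 : ∀ n, 0 < ℓ n := fun n => by
    rw [hℓ]
    exact Nat.mul_pos hm' (by omega)
  have hV : ∀ n i, ((nth 1 (tuple [List.replicate n true, i])).length = (Nat.bits
      (r' (tuple [nth 0 (tuple [List.replicate n true, i]),
        r (nth 0 (tuple [List.replicate n true, i]))])).tail.length).length) ↔
      i.length = Nat.clog 2 (ℓ n) := by
    intro n i
    rw [clog_eq_length_bits (hℓ0 n), hℓ]
    simp [hrl', hrl, length_tuple_cons_cons]
  refine mem_Xi_of_queries_Xi (hC L₂ hL₂) hg₁ hg₂ he hg hL'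
    (b := fun n => 4 * ℓ n + 4 + m * n)
    (V := fun z => (nth 1 z).length =
      (Nat.bits (r' (tuple [nth 0 z, r (nth 0 z)])).tail.length).length)
    (σ := fun _ _ => [])
    (Q := fun z => (nth 2 z).length = (r (nth 0 z)).length ∧
      (nth 3 z).length = (r (nth 0 z)).length)
    (ζ := fun z => tuple [tuple [nth 0 z, nth 2 z], nth 1 z])
    (ν := fun z => tuple [tuple [nth 0 z, r (nth 0 z)], nth 1 z])
    (Growth.add (Growth.add ((PolyB.const 4).mul hℓB) (PolyB.const 4))
      ((PolyB.const m).mul PolyB.id))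
    (Dec.length_eq (comput_nth 1) (comput_tail.comp (hr'.comp ((comput_nth 0).tuple₂
      (hr.poly.comp (comput_nth 0))))).bitsLen)
    (fun _ => comput_const [])
    ((Dec.length_eq (comput_nth 2) (hr.comp (comput_nth 0))).and
      (Dec.length_eq (comput_nth 3) (hr.comp (comput_nth 0))))
    (((comput_nth 0).tuple₂ (comput_nth 2)).tuple₂ (comput_nth 1))
    (((comput_nth 0).tuple₂ (hr.poly.comp (comput_nth 0))).tuple₂ (comput_nth 1)) ?_ ?_ ?_
  · intro n i hn hi
    have h₁ := (hV n i).1 hi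
    refine ⟨?_, fun _ => ?_, fun h => ?_⟩
    · have h₂ := num_lt i
      have h₃ := two_pow_length_bits_le (ℓ n - 1)
      have h₄ := hℓ0 n
      rw [h₁, clog_eq_length_bits (hℓ0 n)] at h₂
      omega
    · have : num [] = 1 := rfl
      rw [this]
      omega
    · have := congrArg List.length h
      rw [length_tuple_cons_cons] at this
      simp at this
  · intro x i c d hx hi hq
    simp only [nth_tuple, List.getD_cons_zero, List.getD_cons_succ, hrl] at hq ⊢
    obtain ⟨h₁, h₂⟩ := hq
    refine ⟨by omega, by omega, ?_⟩
    rw [size]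
    simp only [length_tuple_cons_cons, tuple_singleton, length_doubleBits, List.length_replicate,
      h₁, hrl]
    omega
  · intro x hx
    rw [hL]
    simp only [hV, hL₁]
    have harg : ∀ W i, outerArg (fun _ _ => []) W x i = tuple [x, i, W [], W []] := fun W i => rfl
    simp only [harg, nth_tuple, List.getD_cons_zero, List.getD_cons_succ, hrl]
    constructor
    · rintro ⟨y, hy, h⟩
      refine ⟨fun _ => y, fun i hi => ⟨⟨hy, hy⟩, h i ?_⟩⟩
      rw [hi, hℓ, length_tuple_cons_cons, tuple_singleton, length_doubleBits, hy]
    · rintro ⟨W, hW⟩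
      -- Some string of the required length exists, and the check at it shows that the guess has the
      -- right length.
      have hy : (W []).length = m * x.length :=
        (hW (List.replicate (Nat.clog 2 (ℓ x.length)) true) List.length_replicate).1.1
      refine ⟨W [], hy, fun i hi => (hW i ?_).2⟩
      rw [hi, hℓ, length_tuple_cons_cons, tuple_singleton, length_doubleBits, hy]

/-! ### The upper bound `NP` -/

theorem comput_block {f g h : List Bool → List Bool} (hf : Comput PolyB f) (hg : Comput PolyB g)
    (hh : Comput PolyB h) : Comput PolyB fun x => block (f x).length (g x) (h x).length :=
  (comput_take.comp hf (comput_drop.comp (hh.mulLen hf) hg)).congr fun x => by simp [block]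

theorem Xi_DLIN_subset_NP : Xi DLIN ⊆ NP := by
  rintro L ⟨d₁, d₂, f₁, f₂, L', -, hL', hf₁, hf₂, hf, hL⟩
  obtain ⟨φ₁, hφ₁, hφ₁'⟩ := hf₁.exists_comput
  obtain ⟨φ₂, hφ₂, hφ₂'⟩ := hf₂.exists_comput
  have hL'c : Dec PolyB fun z => z ∈ L' := LinB.dec_poly (mem_DLIN_iff.1 hL')
  have hU : ∀ d, Comput PolyB fun x => List.replicate ((sized x).length ^ d) true :=
    fun d => comput_sized.powLen d
  obtain ⟨y, hy⟩ : ∃ y : List Bool → List Bool, y = fun z => nth 0 (nth 0 (nth 0 z)) := ⟨_, rfl⟩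
  have hyc : Comput PolyB y := by
    rw [hy]
    exact ((comput_nth 0).component 0).component 0
  obtain ⟨q, hq⟩ : ∃ q : List Bool → List Bool, q = fun z =>
    tuple [List.replicate (sized (nth 0 (y z))).length true,
      Nat.bits (nth 1 (nth 0 (nth 0 z))).length] := ⟨_, rfl⟩
  have hqc : Comput PolyB q := by
    rw [hq]
    exact (comput_sized.comp (hyc.component 0)).ones.tuple₂
      (((comput_nth 0).component 0).component 1).bitsLen
  have hS : Comput PolyB fun z => List.replicate ((sized (nth 0 (y z))).length ^ (d₁ - d₂)) true :=
    (hU _).comp (hyc.component 0)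
  -- The two block numbers are searched for in unary instead of being converted from binary: all
  -- candidates below the number of blocks are tried, and wrong ones hold vacuously.
  obtain ⟨P, hP⟩ : ∃ P : List Bool → Prop, P = fun z =>
    φ₁ (q z) = Nat.bits (nth 1 (nth 0 z)).length → φ₂ (q z) = Nat.bits (nth 1 z).length →
      tuple [nth 0 (y z), Nat.bits (nth 1 (nth 0 (nth 0 z))).length,
        block (List.replicate ((sized (nth 0 (y z))).length ^ (d₁ - d₂)) true).length
          (nth 1 (y z)) (nth 1 (nth 0 z)).length,
        block (List.replicate ((sized (nth 0 (y z))).length ^ (d₁ - d₂)) true).length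
          (nth 1 (y z)) (nth 1 z).length] ∈ L' := ⟨_, rfl⟩
  have hPc : Dec PolyB P := by
    rw [hP]
    exact (Dec.eq (hφ₁.comp hqc) ((comput_nth 0).component 1).bitsLen).imp
      ((Dec.eq (hφ₂.comp hqc) (comput_nth 1).bitsLen).imp
      (hL'c.comp ((hyc.component 0).tuple₄ (((comput_nth 0).component 0).component 1).bitsLen
        (comput_block hS (hyc.component 1) ((comput_nth 0).component 1))
        (comput_block hS (hyc.component 1) (comput_nth 1)))))
  have hP' : ∀ x w i a b, P (tuple [tuple [tuple [tuple [x, w], List.replicate i true],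
      List.replicate a true], List.replicate b true]) ↔ (f₁ (size x) i = a → f₂ (size x) i = b →
        tuple [x, numeral i, block (size x ^ (d₁ - d₂)) w a,
          block (size x ^ (d₁ - d₂)) w b] ∈ L') := by
    intro x w i a b
    simp [hP, hy, hq, hφ₁', hφ₂', bits_injective.eq_iff, length_sized, numeral]
  have hR := ((hPc.forall_lt ((hU d₂).comp (((comput_nth 0).component 0).component 0))).forall_lt
    ((hU d₂).comp ((comput_nth 0).component 0))).forall_lt ((hU d₂).comp (comput_nth 0))
  -- Reversal brings the code of `x` to the front of the guessed string; the guess itself is then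
  -- reversed back.
  have hD : Comput PolyB fun z => tuple [hd z.reverse, (tl z.reverse).reverse] :=
    (comput_hd.comp comput_reverse).tuple₂
      (comput_reverse.comp (comput_tl.comp comput_reverse))
  refine mem_NP_of_comput (hU d₁) (hR.comp hD) (fun x => ?_) fun z => ?_
  · rw [hL]
    refine exists_congr fun w => ?_
    rw [List.length_replicate, length_sized]
    refine and_congr_right fun hw => Iff.trans ?_ chi_eq_true.symm
    have h₁ : (w ++ (doubleBits x ++ [false, true]).reverse).reverse =
        doubleBits x ++ (false :: true :: w.reverse) := by simp
    change _ ↔ ∀ i < _, _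
    rw [h₁, hd_append, tl_append, List.reverse_reverse]
    simp only [nth_tuple, List.getD_cons_zero, List.length_replicate, length_sized, hP']
    constructor
    · intro h i hi a _ b _ ha hb
      rw [← ha, ← hb]
      exact h i hi
    · intro h i hi
      obtain ⟨h₂, h₃⟩ := hf _ i hi
      exact h i hi _ h₂ _ h₃ rfl rfl
  · unfold chi
    split <;> simp

/-- Absorption gives `Xi (Xi DLIN) ⊆ Xi DLIN`, and monotonicity with `DLIN ⊆ Xi DLIN` gives the
converse. -/
theorem XiLin_succ (k : ℕ) : XiLin (k + 1) = Xi DLIN := by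
  induction k with
  | zero => rfl
  | succ k ih =>
    have : XiLin (k + 1 + 1) = Xi (XiLin (k + 1)) := iterate_succ_apply' _ _ _
    rw [this, ih]
    exact (Xi_Xi_subset closed_DLIN).antisymm (Xi_mono DLIN_subset_Xi)

theorem XiLin_subset (k : ℕ) : XiLin k ⊆ Xi DLIN := by
  cases k with
  | zero => exact DLIN_subset_Xi
  | succ k => exact (XiLin_succ k).le

/-- By induction and the collapse, level `k` lies in `Xi DLIN`; one more pair of quantifiers is
absorbed there, and `Xi DLIN` is also level `k + 1`. -/
theorem EuLin_subset (k : ℕ) : EuLin k ⊆ XiLin k := by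
  induction k with
  | zero => exact le_rfl
  | succ k ih =>
    have : EuLin (k + 1) = QE (Qu (EuLin k)) := iterate_succ_apply' _ _ _
    rw [this, XiLin_succ]
    exact (QE_mono (Qu_mono (ih.trans (XiLin_subset k)))).trans
      (QE_Qu_Xi_subset fun _ => absorbs_DLIN)

end XiHier

theorem mainTheorem11 :
    (∀ C : Set (Language Bool), XiHier.ClosedUnderLinTimeReductions C →
      XiHier.Xi (XiHier.Xi C) ⊆ XiHier.Xi C) ∧
    (∀ k : ℕ, 1 ≤ k →
      XiHier.XiLin k = XiHier.XiLin 1 ∧ XiHier.XiLin k = XiHier.Xi XiHier.DLIN) ∧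
    XiHier.Xi XiHier.DLIN ⊆ XiHier.NP ∧
    (∀ k : ℕ, XiHier.XiLin k ⊆ XiHier.NP) ∧
    (∀ k : ℕ, XiHier.EuLin k ⊆ XiHier.XiLin k) ∧
    XiHier.EuLinH ⊆ XiHier.XiLinH := by
  refine ⟨fun C hC => XiHier.Xi_Xi_subset hC, fun k hk => ?_, XiHier.Xi_DLIN_subset_NP,
    fun k => (XiHier.XiLin_subset k).trans XiHier.Xi_DLIN_subset_NP, XiHier.EuLin_subset,
    Set.iUnion_mono XiHier.EuLin_subset⟩
  obtain ⟨k, rfl⟩ := Nat.exists_eq_add_of_le' hk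
  exact ⟨(XiHier.XiLin_succ k).trans (XiHier.XiLin_succ 0).symm, XiHier.XiLin_succ k⟩
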